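/- Let $\sigma(p)=|p|_1=|p_1|+|p_2|+|p_3|$ on $\mathbb R^3$. For $0<r<R$ let $$S_{r,R}=\{x\in\mathbb R^3: |x|_\infty<R,\ |x_i|>r \text{ for at least two of } i=1,2,3\},\qquad Q_R=\{x\in\mathbb R^3:|x|_\infty<R\}.$$ For an open set $E\subset\mathbb R^3$ with a.e. defined unit outer normal $\nu$, a Cahn–Hoffman field is a vector field $z$ on $\partial E$ with $z\in\partial\sigma(\nu)$ a.e.; its surface divergence $\operatorname{div}_{\partial E}z\in L^2(\partial E)$ is understood weakly: $\int_{\partial E}\nu\cdot\big(z\,\operatorname{div}X-(z\cdot\nabla)X\big)\,dS=\int_{\partial E}(\operatorname{div}_{\partial E}z)\,X\cdot\nu\,dS$ for all $X\in C_c^\infty(\mathbb R^3;\mathbb R^3)$. The crystalline curvature is $\kappa_\sigma=-\operatorname{div}_{\partial E}z_{\min}$, where $z_{\min}$ minimizes $\|\operatorname{div}_{\partial E}z\|_{L^2(\partial E)}$ among Cahn–Hoffman fields. An evolution $\{E_t\}$ satisfies $V=\sigma(\nu)\kappa_\sigma$ at time $t$ if this holds at a.e. point of $\partial E_t$, $V$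 being the outer normal velocity. We say that $\{E_t\}_{t\ge0}$ is an evolution by $V=\sigma(\nu)\kappa_\sigma$ with singular times in a finite set $J$ if the law holds at every $t>0$, $t\notin J$, and the volume of $E_s\,\triangle\,E_t$ tends to $0$ as $s\to t$, for every $t\ge0$. It is self-similar if each nonempty $E_t$, $t\ge0$, is $\lambda E_0$ for some $\lambda>0$. (1) For $0<r<R$, $\partial S_{r,R}$ is a closed connected surface of genus $5$, and its crystalline curvature is $-\frac{2}{R-r}$ on the outer facets ($|x|_\infty=R$) and $\frac{R-3r}{r(R-r)}$ on the inner facets. (2) If $r(\cdot),R(\cdot)$ are differentiable at $t$ and $0<r(t)<R(t)$, then $s\mapsto S_{r(s),R(s)}$ satisfies $V=\sigma(\nu)\kappa_\sigma$ at time $t$ if and only if at time $t$ $$R'=-\frac{2}{R-r},\qquad r'=-\frac{R-3r}{r(R-r)}.\tag{$*$}$$ (3) Let $0<r_0<R_0$. The system $(*)$ with $r(0)=r_0$, $R(0)=R_0$ has a unique maximal solution $(r,R)$ with $0<r<R$; its existence interval $[0,T)$ is bounded. Put $\xi^*=\frac{3+\sqrt{17}}2$ and $c=\frac{\xi^*-3}{\xi^*-1}>0$.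 There is an evolution $\{E_t\}_{t\ge0}$ by $V=\sigma(\nu)\kappa_\sigma$, with singular times in a finite set $J$ as below, such that $E_0=S_{r_0,R_0}$ and $E_t=S_{r(t),R(t)}$ for $0\le t<T$. It is self-similar if and only if $R_0/r_0=\xi^*$. Moreover: (a) If $R_0/r_0<\xi^*$, then $J=\{T\}$, $R-r$ is strictly decreasing on $[0,T)$, and as $t\to T^-$ one has $R/r\to1$, $R-r\to0$, $R\to\rho$ for some $\rho>0$, and $E_t$ converges in Hausdorff distance to the union of the edges of the cube $Q_\rho$. For $t\ge T$, $E_t=\emptyset$. (b) If $R_0/r_0=\xi^*$, then $J=\{T\}$, $T=\frac{r_0^2}{2c}$, $r(t)=\sqrt{r_0^2-2ct}$ and $R(t)=\xi^*r(t)$ for $0\le t<T$, and $E_t=\emptyset$ for $t\ge T$. (c) If $R_0/r_0>\xi^*$, then $r\to0$ and $R/r\to\infty$ as $t\to T^-$, and there is $T_1>T$ with $J=\{T,T_1\}$ such that $R$ extends continuously to $[0,T_1]$ with $R(T)>0$, $R>0$ and $R'=-\frac2R$ on $(T,T_1)$, $R(T_1)=0$; $E_t=Q_{R(t)}$ for $T\le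 t<T_1$, and $E_t=\emptyset$ for $t\ge T_1$. -/

import Mathlib

open MeasureTheory Filter Topology
open scoped Pointwise ContDiff

noncomputable section

namespace Sponge

/-- Euclidean three-space. -/
abbrev E3 : Type := EuclideanSpace ℝ (Fin 3)

/-! ### Anisotropic curvature and the velocity law `V = σ(ν) κ_σ` -/

/-- The cubic anisotropy `σ(p) = |p|₁`. -/
def l1 (p : E3) : ℝ := ∑ i, |p i|

/-- The subdifferential `∂σ(p)`. -/
def subdiff (σ : E3 → ℝ) (p : E3) : Set E3 :=
  {ξ | ∀ h : E3, inner ℝ ξ h ≤ σ (p + h) - σ p}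

/-- Surface measure on the topological boundary of `E`. -/
def area (E : Set E3) : Measure E3 := (μHE[2] : Measure E3).restrict (frontier E)

/-- `ν` is the unit outer normal of `E` at `x`: near `x` the set is `{ψ < 0}` with `ψ x = 0`,
`ψ` differentiable at `x` with gradient `p ≠ 0`, and `ν = p / |p|`. -/
def IsOuterNormal (E : Set E3) (x ν : E3) : Prop :=
  ∃ (ψ : E3 → ℝ) (p : E3), ψ x = 0 ∧ HasGradientAt ψ p x ∧ p ≠ 0 ∧
    (∀ᶠ y in 𝓝 x, (y ∈ E ↔ ψ y < 0)) ∧ ν = ‖p‖⁻¹ • p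

/-- `ν` is the unit outer normal field of `E`, defined almost everywhere on `∂E`. -/
def IsNormalField (E : Set E3) (ν : E3 → E3) : Prop :=
  AEStronglyMeasurable ν (area E) ∧ ∀ᵐ x ∂(area E), IsOuterNormal E x (ν x)

/-- `z` is a Cahn-Hoffman vector field on `∂E`: `z ∈ ∂σ(ν)` almost everywhere on `∂E`. -/
def IsCahnHoffman (σ : E3 → ℝ) (E : Set E3) (ν z : E3 → E3) : Prop :=
  AEStronglyMeasurable z (area E) ∧ ∀ᵐ x ∂(area E), z x ∈ subdiff σ (ν x)

/-- The divergence of a vector field on three-space. -/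
def divergence (X : E3 → E3) (x : E3) : ℝ :=
  ∑ i, fderiv ℝ X x (EuclideanSpace.single i 1) i

/-- `w ∈ L²(∂E)` is the surface divergence `div_{∂E} z` of the Cahn-Hoffman field `z`, in the weak
sense (the first variation of `∫ σ(ν)` in the direction of a test field `X`):
`∫ ν · (z div X - (z · ∇) X) = ∫ w (X · ν)` over `∂E`.
For smooth `∂E` and `z` this is integration by parts on `∂E`: with `z` extended to a
neighbourhood, `z div X - (z · ∇) X = X div z - (X · ∇) z + curl (z × X)`, the flux of the curl
through `∂E` vanishes, and `ν · (X · ∇) z = (X · ν) ν · (ν · ∇) z`, because `z ∈ ∂σ(ν)` makes the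
part of `X` tangent to `∂E` contribute nothing. On a polyhedral surface
the formula says that on each facet `w` is the distributional divergence of the tangential part of
`z`, and that across an edge `z` takes the same normal components on both sides. -/
def IsSurfaceDivergence (E : Set E3) (ν z : E3 → E3) (w : E3 → ℝ) : Prop :=
  MemLp w 2 (area E) ∧
    ∀ X : E3 → E3, ContDiff ℝ ∞ X → HasCompactSupport X →
      ∫ x, inner ℝ (ν x) (divergence X x • z x - fderiv ℝ X x (z x)) ∂(area E)
        = ∫ x, w x * inner ℝ (X x) (ν x) ∂(area E)

/-- `κ` is the crystalline (anisotropic mean) curvature of `∂E`: `κ = - div z` for a Cahn-Hoffman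
field `z` that minimizes the `L²(∂E)` norm of the surface divergence. -/
def IsCrystallineCurvature (σ : E3 → ℝ) (E : Set E3) (κ : E3 → ℝ) : Prop :=
  ∃ ν : E3 → E3, IsNormalField E ν ∧
    (∃ z, IsCahnHoffman σ E ν z ∧ IsSurfaceDivergence E ν z (fun x => - κ x)) ∧
    ∀ z w, IsCahnHoffman σ E ν z → IsSurfaceDivergence E ν z w →
      eLpNorm κ 2 (area E) ≤ eLpNorm w 2 (area E)

/-- At time `t` and at `x ∈ ∂E_t` the evolution has unit outer normal `ν` and normal velocity `V`:
near `(x, t)` the evolution is `{ψ < 0}`, `ψ` is differentiable at `(x, t)` with spatial gradient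
`p ≠ 0` and time derivative `τ`, and `ν = p / |p|`, `V = - τ / |p|`. -/
def HasNormalVelocity (E : ℝ → Set E3) (t : ℝ) (x ν : E3) (V : ℝ) : Prop :=
  ∃ (ψ : E3 × ℝ → ℝ) (p : E3) (τ : ℝ), ψ (x, t) = 0 ∧ p ≠ 0 ∧
    HasFDerivAt ψ
      ((innerSL ℝ p).coprod (ContinuousLinearMap.toSpanSingleton ℝ τ)) (x, t) ∧
    (∀ᶠ q in 𝓝 (x, t), (q.1 ∈ E q.2 ↔ ψ q < 0)) ∧
    ν = ‖p‖⁻¹ • p ∧ V = - τ / ‖p‖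

/-- The velocity law `V = σ(ν) κ_σ` holds at time `t`, almost everywhere on `∂E_t`. -/
def SatisfiesLaw (σ : E3 → ℝ) (E : ℝ → Set E3) (t : ℝ) : Prop :=
  ∃ κ : E3 → ℝ, IsCrystallineCurvature σ (E t) κ ∧
    ∀ᵐ x ∂(area (E t)), ∃ (ν : E3) (V : ℝ), HasNormalVelocity E t x ν V ∧ V = σ ν * κ x

/-- `(E_t)_{t ≥ 0}` is an evolution by `V = σ(ν) κ_σ` with the finite set `J` of singular times
(topology changes, extinction): the law holds at every time `t > 0` outside `J`, and `E_t` depends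
continuously on `t ≥ 0` in the sense that the volume of `E_s ∆ E_t` tends to `0` as `s → t`. -/
structure IsFlow (σ : E3 → ℝ) (E : ℝ → Set E3) (J : Finset ℝ) : Prop where
  law : ∀ t, 0 < t → t ∉ J → SatisfiesLaw σ E t
  continuous : ∀ t, 0 ≤ t →
    Tendsto (fun s => volume (symmDiff (E s) (E t))) (𝓝[Set.Ici 0] t) (𝓝 0)

/-- Every `E_t` before extinction is a dilate of the initial set. -/
def IsSelfSimilar (E : ℝ → Set E3) : Prop :=
  ∀ t, 0 ≤ t → (E t).Nonempty → ∃ l : ℝ, 0 < l ∧ E t = l • E 0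

/-! ### Genus of a closed surface in three-space -/

/-- The relative interior of the convex hull of a nonempty finite set `F`. -/
def openCell (F : Finset E3) : Set E3 :=
  {x | ∃ a : E3 → ℝ, (∀ v ∈ F, 0 < a v) ∧ ∑ v ∈ F, a v = 1 ∧ ∑ v ∈ F, a v • v = x}

/-- The dimension of `openCell F`. -/
def cellDim (F : Finset E3) : ℕ := Module.finrank ℝ (vectorSpan ℝ (F : Set E3))

/-- `D` is a partition of `X` into finitely many relatively open convex polytopes. -/
def IsCellPartition (X : Set E3) (D : Finset (Finset E3)) : Prop :=
  (∀ F ∈ D, F.Nonempty) ∧ (D : Set (Finset E3)).PairwiseDisjoint openCell ∧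
    ⋃ F ∈ D, openCell F = X

/-- `X` is a polyhedral closed connected surface of genus `g`: a compact connected
topological 2-manifold (orientable, being embedded in three-space) whose Euler characteristic, the
alternating count of the cells of a partition into relatively open polytopes, is `2 - 2g`. -/
structure IsClosedSurfaceOfGenus (X : Set E3) (g : ℕ) : Prop where
  isCompact : IsCompact X
  isConnected : IsConnected X
  locallyPlanar : Nonempty (ChartedSpace (EuclideanSpace ℝ (Fin 2)) X)
  eulerChar : ∃ D : Finset (Finset E3), IsCellPartition X D ∧
    ∑ F ∈ D, (-1 : ℤ) ^ cellDim F = 2 - 2 * (g : ℤ)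

/-! ### The sponge -/

/-- `S_{r,R}`: the points with `|x|_∞ < R` such that `|x_i| > r` for at least two indices `i`. -/
def sponge (r R : ℝ) : Set E3 :=
  {x | (∀ i, |x i| < R) ∧ ∃ i j, i ≠ j ∧ r < |x i| ∧ r < |x j|}

/-- The open cube `Q_R = {|x|_∞ < R}`. -/
def cube (R : ℝ) : Set E3 := {x | ∀ i, |x i| < R}

/-- The union of the twelve closed edges of `Q_R`. -/
def cubeEdges (R : ℝ) : Set E3 :=
  {x | (∀ i, |x i| ≤ R) ∧ ∃ i j, i ≠ j ∧ |x i| = R ∧ |x j| = R}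

open Classical in
/-- The function on `∂S_{r,R}` equal to `-2/(R-r)` on the outer facets (where `|x|_∞ = R`) and to
`(R-3r)/(r(R-r))` on the inner facets. -/
def spongeCurvature (r R : ℝ) (x : E3) : ℝ :=
  if ∃ i, |x i| = R then -2 / (R - r) else (R - 3 * r) / (r * (R - r))

/-- `(r, R)` solves `R' = -2/(R-r)`, `r' = -(R-3r)/(r(R-r))` on `(0, T)` with `0 < r < R` and
initial values `r₀, R₀`. -/
structure IsSpongeODE (r₀ R₀ T : ℝ) (r R : ℝ → ℝ) : Prop where
  pos : 0 < T
  cont_r : ContinuousOn r (Set.Ico 0 T)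
  cont_R : ContinuousOn R (Set.Ico 0 T)
  init_r : r 0 = r₀
  init_R : R 0 = R₀
  range : ∀ t ∈ Set.Ioo 0 T, 0 < r t ∧ r t < R t
  deriv_R : ∀ t ∈ Set.Ioo 0 T, HasDerivAt R (-2 / (R t - r t)) t
  deriv_r : ∀ t ∈ Set.Ioo 0 T, HasDerivAt r (-(R t - 3 * r t) / (r t * (R t - r t))) t

/-- `ξ* = (3 + √17)/2`. -/
def xiStar : ℝ := (3 + √17) / 2

/-- `c = (ξ* - 3)/(ξ* - 1)`. -/
def cStar : ℝ := (xiStar - 3) / (xiStar - 1)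

end Sponge

end

open Sponge

/-! ### Topology of the boundary of the sponge. -/

namespace Sponge

/-! Topology. Near each of its points the boundary of a sponge is the zero set of a min-max
polynomial that increases at unit speed along a fixed direction, hence a graph
(`nonempty_chartedSpace_frontier_sponge`). The levels ±r, ±R of the three coordinates cut the
boundary into open boxes of dimension at most two, whose alternating count is -8.

Curvature. A Cahn-Hoffman field whose divergence is constant on facets is optimal as soon as the
constants come from a function of the level. Indeed, for a test field X = (φ(x₁), φ(x₂), φ(x₃)) the
first-variation density does not see the tangential part of z, so the divergences of all
Cahn-Hoffman fields have the same integral against X · ν, which on the facet x_i = c is ±φ(c). If φ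
is chosen so that this is the curvature, Pythagoras in L² gives minimality and uniqueness
(`HasFacets.minimal_surfaceDivergence`). The field itself is built from planar slices x_i = t, which
are four squares for |t| < r and a square annulus for |t| > r. In a slice the weak identity is the
fundamental theorem of calculus on each edge, and the corner terms cancel when every component of z
interpolates between the normals at the ends of an edge (`sliceIdentity_sponge`). The two slice
derivatives on a facet add up to 2/(R-r) outside and 2/(R-r) - 1/r inside (`isFacetField_sponge`).
Since normal, velocity and curvature are unique almost everywhere, the law is equivalent to the
system for (r, R) (`satisfiesLaw_sponge_iff`).

Dynamics. In the time τ with dτ = dt / (r(R-r)) the system is linear, r' = 3r - R, R' = -2r, with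
eigenvalues ξ* > 0 > 3 - ξ*, the roots of x² = 3x + 2. The coefficient of the growing mode is a
positive multiple of ξ* r₀ - R₀. If it is positive, R - r vanishes first; if negative, r vanishes
first; if zero, the orbit stays on the ray R = ξ* r. Every solution runs along this explicit orbit
(`IsSpongeODE.exists_orbit_parameter`), which gives maximality and uniqueness. After T the evolution
is empty, or a cube, for which the field x / R gives the law. Continuity in volume is dominated
convergence, and self-similarity would force R/r to be constant. -/

theorem isOpen_sponge (r R : ℝ) : IsOpen (sponge r R) := by
  have h : sponge r R = (⋂ i : Fin 3, {x : E3 | |x i| < R}) ∩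
      ⋃ i : Fin 3, ⋃ j : Fin 3, ⋃ _ : i ≠ j, ({x : E3 | r < |x i|} ∩ {x : E3 | r < |x j|}) := by
    ext x; simp [sponge]; grind
  rw [h]
  refine (isOpen_iInter_of_finite fun i => isOpen_lt (by fun_prop) (by fun_prop)).inter
    (isOpen_iUnion fun i => isOpen_iUnion fun j => isOpen_iUnion fun _ =>
      (isOpen_lt (by fun_prop) (by fun_prop)).inter (isOpen_lt (by fun_prop) (by fun_prop)))

theorem isClosed_sponge_le (r R : ℝ) :
    IsClosed {x : E3 | (∀ i, |x i| ≤ R) ∧ ∃ i j, i ≠ j ∧ r ≤ |x i| ∧ r ≤ |x j|} := by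
  have h : {x : E3 | (∀ i, |x i| ≤ R) ∧ ∃ i j, i ≠ j ∧ r ≤ |x i| ∧ r ≤ |x j|} =
      (⋂ i : Fin 3, {x : E3 | |x i| ≤ R}) ∩
      ⋃ i : Fin 3, ⋃ j : Fin 3, ⋃ _ : i ≠ j, ({x : E3 | r ≤ |x i|} ∩ {x : E3 | r ≤ |x j|}) := by
    ext x; simp; grind
  rw [h]
  refine (isClosed_iInter fun i => isClosed_le (by fun_prop) (by fun_prop)).inter
    (isClosed_iUnion_of_finite fun i => isClosed_iUnion_of_finite fun j =>
      isClosed_iUnion_of_finite fun _ =>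
      (isClosed_le (by fun_prop) (by fun_prop)).inter (isClosed_le (by fun_prop) (by fun_prop)))

/-- Moving a towards the point of absolute value m on its own side of zero never crosses zero, so
the absolute value is interpolated linearly. The closure and the connecting paths both rest on this
computation. -/
theorem abs_add_smul_sign (a m t : ℝ) (hm : 0 ≤ m) (h0 : 0 ≤ t) (h1 : t ≤ 1) :
    |a + t * ((if 0 ≤ a then m else -m) - a)| = (1 - t) * |a| + t * m := by
  split_ifs with h
  · rw [abs_of_nonneg h, abs_of_nonneg]
    · ring
    · nlinarith
  · push Not at h
    rw [abs_of_neg h, abs_of_nonpos]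
    · ring
    · nlinarith

theorem closure_sponge {r R : ℝ} (hr : 0 < r) (hR : r < R) :
    closure (sponge r R) =
      {x : E3 | (∀ i, |x i| ≤ R) ∧ ∃ i j, i ≠ j ∧ r ≤ |x i| ∧ r ≤ |x j|} := by
  apply Set.Subset.antisymm
  · refine closure_minimal ?_ (isClosed_sponge_le r R)
    rintro x ⟨h1, i, j, hij, hi, hj⟩
    exact ⟨fun i => (h1 i).le, i, j, hij, hi.le, hj.le⟩
  · rintro x ⟨h1, i, j, hij, hi, hj⟩
    -- Moving every |x k| towards the midpoint of r and R makes all the weak inequalities strict.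
    set m := (r + R) / 2 with hm
    let d : E3 := WithLp.toLp 2 fun k => if 0 ≤ x k then m else -m
    have ht : Tendsto (fun t : ℝ => x + t • (d - x)) (𝓝[>] 0) (𝓝 x) := by
      have : Tendsto (fun t : ℝ => x + t • (d - x)) (𝓝 0) (𝓝 (x + (0 : ℝ) • (d - x))) :=
        (Continuous.tendsto (by fun_prop) 0)
      rw [zero_smul, add_zero] at this
      exact this.mono_left nhdsWithin_le_nhds
    refine mem_closure_of_tendsto ht ?_
    filter_upwards [Ioo_mem_nhdsGT (show (0 : ℝ) < 1 by norm_num)] with t ht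
    have key : ∀ k, |(x + t • (d - x)) k| = (1 - t) * |x k| + t * m := fun k => by
      simpa [d] using abs_add_smul_sign (x k) m t (by linarith) ht.1.le ht.2.le
    refine ⟨fun k => ?_, i, j, hij, ?_, ?_⟩
    · rw [key]; nlinarith [h1 k, ht.1, ht.2]
    · rw [key]; nlinarith [ht.1, ht.2]
    · rw [key]; nlinarith [ht.1, ht.2]

theorem mem_frontier_sponge {r R : ℝ} (hr : 0 < r) (hR : r < R) {x : E3} :
    x ∈ frontier (sponge r R) ↔
      ((∀ i, |x i| ≤ R) ∧ ∃ i j, i ≠ j ∧ r ≤ |x i| ∧ r ≤ |x j|) ∧ x ∉ sponge r R := by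
  rw [(isOpen_sponge r R).frontier_eq, closure_sponge hr hR]; rfl

theorem sponge_subset_closedBall {r R : ℝ} (hR : 0 < R) : sponge r R ⊆ Metric.closedBall 0 (3 * R) := by
  rintro x ⟨h1, -⟩
  rw [mem_closedBall_zero_iff, EuclideanSpace.norm_eq]
  apply Real.sqrt_le_iff.2 ⟨by linarith, ?_⟩
  simp only [Fin.sum_univ_three, Real.norm_eq_abs]
  have := h1 0; have := h1 1; have := h1 2
  nlinarith [abs_nonneg (x 0), abs_nonneg (x 1), abs_nonneg (x 2)]

theorem isCompact_frontier_sponge {r R : ℝ} (hR : 0 < R) : IsCompact (frontier (sponge r R)) :=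
  (isCompact_closedBall (0 : E3) (3 * R)).of_isClosed_subset isClosed_frontier
    (frontier_subset_closure.trans (closure_minimal (sponge_subset_closedBall hR)
      Metric.isClosed_closedBall))

/-! ### Charts -/

/-- On each line parallel to d the function φ increases with slope one, so {φ = 0} meets it exactly
once: the level set is a graph over the plane where the last coordinate vanishes, and pr projects to
that plane along d. No smoothness of φ is needed. -/
theorem exists_chart_of_translation {X U : Set E3} {φ : E3 → ℝ} {d : E3} (hU : IsOpen U)
    (hφ : Continuous φ) (hd : d 2 ≠ 0) (ht : ∀ x (t : ℝ), φ (x + t • d) = φ x + t)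
    (hX : ∀ x ∈ U, x ∈ X ↔ φ x = 0) {p : E3} (hp : p ∈ X) (hpU : p ∈ U) :
    ∃ e : OpenPartialHomeomorph X (EuclideanSpace ℝ (Fin 2)), (⟨p, hp⟩ : X) ∈ e.source := by
  classical
  let pr : E3 → EuclideanSpace ℝ (Fin 2) := fun x =>
    WithLp.toLp 2 ![x 0 - d 0 / d 2 * x 2, x 1 - d 1 / d 2 * x 2]
  let em : EuclideanSpace ℝ (Fin 2) → E3 := fun y => WithLp.toLp 2 ![y 0, y 1, 0]
  -- The unique zero of φ on the line through em y parallel to d.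
  let s : EuclideanSpace ℝ (Fin 2) → E3 := fun y => em y + (-φ (em y)) • d
  have hpr : Continuous pr := by
    refine (PiLp.continuous_toLp 2 _).comp (continuous_pi fun i => ?_)
    fin_cases i <;> simp <;> fun_prop
  have hem : Continuous em := by
    refine (PiLp.continuous_toLp 2 _).comp (continuous_pi fun i => ?_)
    fin_cases i <;> simp <;> fun_prop
  have hs : Continuous s := by fun_prop
  have hs0 : ∀ y, φ (s y) = 0 := fun y => by
    simp only [s, ht, add_neg_cancel]
  have hprs : ∀ y, pr (s y) = y := fun y => by
    ext i; fin_cases i <;> simp [pr, s, em] <;> field_simp <;> ring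
  have hsX : ∀ y, s y ∈ U → s y ∈ X := fun y hy => (hX _ hy).2 (hs0 y)
  have hspr : ∀ x, φ x = 0 → s (pr x) = x := fun x hx => by
    have e1 : em (pr x) = x + (-(x 2 / d 2)) • d := by
      ext i; fin_cases i <;> simp [em, pr] <;> field_simp <;> ring
    have e2 : φ (em (pr x)) = -(x 2 / d 2) := by rw [e1, ht, hx, zero_add]
    simp only [s, e2]
    rw [e1, add_assoc, ← add_smul]; simp
  refine ⟨{
    toFun := fun x => pr x
    invFun := fun y => if h : s y ∈ U then ⟨s y, hsX y h⟩ else ⟨p, hp⟩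
    source := {x | (x : E3) ∈ U}
    target := {y | s y ∈ U}
    map_source' := fun x hx => ?_
    map_target' := fun y hy => ?_
    left_inv' := fun x hx => ?_
    right_inv' := fun y hy => ?_
    open_source := hU.preimage continuous_subtype_val
    open_target := hU.preimage hs
    continuousOn_toFun := (hpr.comp continuous_subtype_val).continuousOn
    continuousOn_invFun := ?_ }, hpU⟩
  · show s (pr x) ∈ U
    rw [hspr _ ((hX _ hx).1 x.2)]; exact hx
  · have hy' : s y ∈ U := hy
    simp [hy']
  · have h : s (pr x) = x := hspr _ ((hX _ hx).1 x.2)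
    have h' : s (pr x) ∈ U := by rw [h]; exact hx
    rw [dif_pos h']; exact Subtype.ext h
  · have hy' : s y ∈ U := hy
    simp only [dif_pos hy', hprs]
  · rw [Topology.IsInducing.subtypeVal.continuousOn_iff]
    refine hs.continuousOn.congr fun y hy => ?_
    have hy' : s y ∈ U := hy
    simp [hy']

theorem frontier_lt_zero_of_translation {φ : E3 → ℝ} {d : E3} (hφ : Continuous φ)
    (ht : ∀ x (t : ℝ), φ (x + t • d) = φ x + t) : frontier {x | φ x < 0} = {x | φ x = 0} := by
  refine Set.Subset.antisymm (fun x hx => frontier_lt_subset_eq hφ continuous_const hx)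
    fun x hx => ?_
  have hx' : φ x = 0 := hx
  rw [(isOpen_lt hφ continuous_const).frontier_eq]
  refine ⟨?_, fun h => (lt_irrefl (0 : ℝ)) (hx' ▸ h)⟩
  have h1 : Tendsto (fun t : ℝ => x + t • d) (𝓝[<] 0) (𝓝 x) := by
    have : Tendsto (fun t : ℝ => x + t • d) (𝓝 0) (𝓝 (x + (0 : ℝ) • d)) :=
      Continuous.tendsto (by fun_prop) 0
    rw [zero_smul, add_zero] at this
    exact this.mono_left nhdsWithin_le_nhds
  refine mem_closure_of_tendsto h1 ?_
  filter_upwards [self_mem_nhdsWithin] with t htt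
  show φ (x + t • d) < 0
  rw [ht, hx', zero_add]; exact htt

/-- A translation equivariant lattice polynomial whose negativity expresses that all coordinates in
`h` are negative and that all but at most one coordinate outside `h` are negative. -/
theorem exists_lattice_polynomial (h : Fin 3 → Bool) : ∃ L : (Fin 3 → ℝ) → ℝ, Continuous L ∧
    (∀ v t, L (fun i => v i + t) = L v + t) ∧
    ∀ v, L v < 0 ↔ ((∀ i, h i → v i < 0) ∧
      ∃ i j, i ≠ j ∧ (h i ∨ v i < 0) ∧ (h j ∨ v j < 0)) := by
  -- A missing condition cannot be replaced by a constant, which would not be translated by t. The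
  -- fillers used instead, the minimum of all coordinates in a and a repeated coordinate in b, are
  -- negative as soon as the genuine conditions hold.
  let a : Fin 3 → (Fin 3 → ℝ) → ℝ := fun i v =>
    if h i then v i else min (v 0) (min (v 1) (v 2))
  let b : Fin 3 → Fin 3 → (Fin 3 → ℝ) → ℝ := fun i j v =>
    if h i then v i else if h j then v j else min (v i) (v j)
  refine ⟨fun v => max (a 0 v) (max (a 1 v) (max (a 2 v)
    (max (b 0 1 v) (max (b 0 2 v) (b 1 2 v))))), ?_, fun v t => ?_, fun v => ?_⟩
  · have ha : ∀ i, Continuous (a i) := fun i => by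
      simp only [a]; split_ifs <;> fun_prop
    have hb : ∀ i j, Continuous (b i j) := fun i j => by
      simp only [b]; split_ifs <;> fun_prop
    fun_prop
  · have ha : ∀ i, a i (fun i => v i + t) = a i v + t := fun i => by
      simp only [a]; split_ifs <;> simp [min_add_add_right]
    have hb : ∀ i j, b i j (fun i => v i + t) = b i j v + t := fun i j => by
      simp only [b]; split_ifs <;> simp [min_add_add_right]
    simp only [ha, hb, max_add_add_right]
  · simp only [max_lt_iff, a, b]
    -- At least two of three hold iff every pair contains one that holds; this is a maximum of
    -- minima.
    have hex : ∀ P : Fin 3 → Prop, (∃ i j, i ≠ j ∧ P i ∧ P j) ↔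
        (P 0 ∨ P 1) ∧ (P 0 ∨ P 2) ∧ (P 1 ∨ P 2) := fun P => by
      simp only [Fin.exists_fin_succ, Fin.exists_fin_zero]
      simp
      tauto
    rw [hex fun i => h i ∨ v i < 0]
    rw [Fin.forall_fin_succ, Fin.forall_fin_two]
    simp only [Fin.succ_zero_eq_one, Fin.succ_one_eq_two]
    rcases h 0 with - | - <;> rcases h 1 with - | - <;> rcases h 2 with - | - <;>
      simp <;> tauto

/-- After a reflection p has nonnegative coordinates. Near p a coordinate needs to be compared only
with R (if |p i| > r) or only with r (if |p i| ≤ r), and v i < 0 is the favourable side of that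
level. The direction d raises all v i at unit speed, so L ∘ v is equivariant along d. Facets, edges
and corners are treated alike. -/
theorem nonempty_chartedSpace_frontier_sponge {r R : ℝ} (hr : 0 < r) (hR : r < R) :
    Nonempty (ChartedSpace (EuclideanSpace ℝ (Fin 2)) (frontier (sponge r R))) := by
  suffices H : ∀ p : frontier (sponge r R),
      ∃ e : OpenPartialHomeomorph (frontier (sponge r R)) (EuclideanSpace ℝ (Fin 2)),
        p ∈ e.source by
    choose e he using H
    exact ⟨{ atlas := Set.range e, chartAt := e, mem_chart_source := he,
             chart_mem_atlas := fun x => ⟨x, rfl⟩ }⟩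
  rintro ⟨p, hp⟩
  let ε : Fin 3 → ℝ := fun i => if 0 ≤ p i then 1 else -1
  let h : Fin 3 → Bool := fun i => decide (r < |p i|)
  have hε : ∀ i, ε i = 1 ∨ ε i = -1 := fun i => by simp only [ε]; split_ifs <;> simp
  have hε2 : ∀ i, ε i * ε i = 1 := fun i => by rcases hε i with h | h <;> rw [h] <;> norm_num
  have hεp : ∀ i, ε i * p i = |p i| := fun i => by
    simp only [ε]; split_ifs with h
    · rw [abs_of_nonneg h, one_mul]
    · rw [abs_of_neg (by linarith)]; ring
  have hεx : ∀ i (y : ℝ), |y| = |ε i * y| := fun i y => by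
    rcases hε i with h | h <;> rw [h] <;> simp
  obtain ⟨L, hLc, hLt, hL⟩ := exists_lattice_polynomial h
  let v : E3 → Fin 3 → ℝ := fun x i => if h i then ε i * x i - R else r - ε i * x i
  let d : E3 := WithLp.toLp 2 fun i => if h i then ε i else -ε i
  let U : Set E3 := {x | ∀ i, -r < ε i * x i ∧ (if h i then r < ε i * x i else ε i * x i < R)}
  have hv : Continuous v := continuous_pi fun i => by
    simp only [v]; split_ifs <;> fun_prop
  have hU : IsOpen U := by
    simp only [U, Set.ofPred_forall]
    refine isOpen_iInter_of_finite fun i => ?_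
    refine (isOpen_lt (by fun_prop) (by fun_prop)).and ?_
    split_ifs <;> exact isOpen_lt (by fun_prop) (by fun_prop)
  have htr : ∀ x (t : ℝ), L (v (x + t • d)) = L (v x) + t := fun x t => by
    rw [← hLt]; congr 1; ext i
    simp only [v, d, PiLp.add_apply, PiLp.smul_apply, smul_eq_mul]
    split_ifs
    · linear_combination t * hε2 i
    · linear_combination t * hε2 i
  have hloc : ∀ x ∈ U, (x ∈ sponge r R ↔ L (v x) < 0) := fun x hx => by
    rw [hL]
    have h1 : ∀ i, (|x i| < R ↔ (h i → v x i < 0)) := fun i => by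
      obtain ⟨ha, hb⟩ := hx i
      rw [hεx i, abs_lt]
      simp only [v]
      split_ifs at hb ⊢ with hi <;> simp [hi]
      · intro; linarith
      · exact ⟨by linarith, hb⟩
    have h2 : ∀ i, (r < |x i| ↔ (h i ∨ v x i < 0)) := fun i => by
      obtain ⟨ha, hb⟩ := hx i
      rw [hεx i, lt_abs]
      simp only [v]
      split_ifs at hb ⊢ with hi <;> simp [hi]
      · exact Or.inl hb
      · intro; linarith
    simp only [sponge, Set.mem_ofPred_eq, h1, h2]
  refine exists_chart_of_translation (φ := fun x => L (v x)) (d := d) hU (hLc.comp hv) ?_ htr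
    (fun x hx => ?_) hp ?_
  · simp only [d]
    split_ifs <;> rcases hε 2 with h | h <;> rw [h] <;> norm_num
  · have e1 : sponge r R ∩ U = {x | L (v x) < 0} ∩ U := by
      ext y; exact and_congr_left fun hy => hloc y hy
    have e2 := frontier_inter_open_inter (s := sponge r R) hU
    rw [e1, frontier_inter_open_inter hU,
      frontier_lt_zero_of_translation (φ := fun x => L (v x)) (hLc.comp hv) htr] at e2
    have := Set.ext_iff.1 e2 x
    simp only [Set.mem_inter_iff, hx, and_true, Set.mem_ofPred_eq] at this
    exact this.symm
  · intro i
    rw [hεp]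
    refine ⟨by linarith [abs_nonneg (p i)], ?_⟩
    split_ifs with hi
    · simpa [h] using hi
    · simp [h] at hi; linarith
end Sponge

noncomputable section
namespace Sponge

/-! ### Connectedness -/

theorem mem_frontier_sponge_outer {r R : ℝ} (hr : 0 < r) (hR : r < R) {x : E3}
    (h : ∀ i, |x i| ≤ R) {i j : Fin 3} (hij : i ≠ j) (hi : |x i| = R) (hj : r ≤ |x j|) :
    x ∈ frontier (sponge r R) :=
  (mem_frontier_sponge hr hR).2 ⟨⟨h, i, j, hij, by linarith, hj⟩, fun hx => (hx.1 i).ne hi⟩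

theorem mem_frontier_sponge_inner {r R : ℝ} (hr : 0 < r) (hR : r < R) {x : E3}
    (h : ∀ i, |x i| ≤ R) {i j k : Fin 3} (hij : i ≠ j) (hik : i ≠ k) (hjk : j ≠ k)
    (hi : |x i| = r) (hj : r ≤ |x j|) (hk : |x k| ≤ r) :
    x ∈ frontier (sponge r R) := by
  refine (mem_frontier_sponge hr hR).2 ⟨⟨h, i, j, hij, by linarith, hj⟩, ?_⟩
  rintro ⟨-, a, b, hab, ha, hb⟩
  have key : ∀ a, r < |x a| → a = j := fun a ha => by
    have h1 : a ≠ i := by rintro rfl; linarith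
    have h2 : a ≠ k := by rintro rfl; linarith
    omega
  exact hab ((key a ha).trans (key b hb).symm)

/-- Off the outer faces a boundary point lies outside the sponge only because no two coordinates
exceed r in absolute value; since two are at least r, one of them is exactly r. -/
theorem frontier_sponge_cases {r R : ℝ} (hr : 0 < r) (hR : r < R) {x : E3}
    (hx : x ∈ frontier (sponge r R)) :
    (∃ i j, i ≠ j ∧ |x i| = R ∧ r ≤ |x j|) ∨
    ((∀ i, |x i| < R) ∧
      ∃ i j k : Fin 3, i ≠ j ∧ i ≠ k ∧ j ≠ k ∧ |x i| = r ∧ r ≤ |x j| ∧ |x k| ≤ r) := by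
  obtain ⟨⟨h1, i, j, hij, hi, hj⟩, h2⟩ := (mem_frontier_sponge hr hR).1 hx
  by_cases h : ∃ a, |x a| = R
  · obtain ⟨a, ha⟩ := h
    by_cases hai : a = i
    · exact Or.inl ⟨a, j, hai ▸ hij, ha, hj⟩
    · exact Or.inl ⟨a, i, hai, ha, hi⟩
  · push Not at h
    have h3 : ∀ a, |x a| < R := fun a => lt_of_le_of_ne (h1 a) (h a)
    refine Or.inr ⟨h3, ?_⟩
    have h4 : ∀ a b, a ≠ b → r < |x a| → |x b| ≤ r := fun a b hab ha => by
      by_contra hb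
      exact h2 ⟨h3, a, b, hab, ha, not_le.1 hb⟩
    obtain ⟨k, hki, hkj⟩ : ∃ k : Fin 3, k ≠ i ∧ k ≠ j := by
      clear * - 
      decide +revert
    by_cases hk : r < |x k|
    · exact ⟨i, k, j, hki.symm, hij, hkj, le_antisymm (h4 k i hki hk) hi, hk.le, h4 k j hkj hk⟩
    · rcases hi.eq_or_lt with hi' | hi'
      · exact ⟨i, j, k, hij, hki.symm, hkj.symm, hi'.symm, hj, not_lt.1 hk⟩
      · exact ⟨j, i, k, hij.symm, hkj.symm, hki.symm, le_antisymm (h4 i j hij hi') hj, hi,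
          not_lt.1 hk⟩

theorem joinedIn_of_forall_lineMap {s : Set E3} {x y : E3}
    (h : ∀ t : ℝ, 0 ≤ t → t ≤ 1 → x + t • (y - x) ∈ s) : JoinedIn s x y := by
  apply JoinedIn.of_segment_subset
  rw [segment_eq_image']
  rintro _ ⟨t, ht, rfl⟩
  exact h t ht.1 ht.2

/-- The corner of the cube of half side `R` in the same octant as `x`. -/
def cubeCorner (R : ℝ) (x : E3) : E3 := WithLp.toLp 2 fun i => if 0 ≤ x i then R else -R

theorem joinedIn_frontier_sponge_corner {r R : ℝ} (hr : 0 < r) (hR : r < R) {x : E3}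
    (h : ∀ i, |x i| ≤ R) {i j : Fin 3} (hij : i ≠ j) (hi : |x i| = R) (hj : r ≤ |x j|) :
    JoinedIn (frontier (sponge r R)) x (cubeCorner R x) := by
  refine joinedIn_of_forall_lineMap fun t h0 h1 => ?_
  have key : ∀ k, |(x + t • (cubeCorner R x - x)) k| = (1 - t) * |x k| + t * R := fun k => by
    simpa [cubeCorner] using abs_add_smul_sign (x k) R t (by linarith) h0 h1
  refine mem_frontier_sponge_outer hr hR (fun k => ?_) hij ?_ ?_
  · rw [key]; nlinarith [h k]
  · rw [key, hi]; ring
  · rw [key]; nlinarith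

theorem joinedIn_frontier_sponge_edge {r R : ℝ} (hr : 0 < r) (hR : r < R) {x y : E3}
    (hx : ∀ i, |x i| ≤ R) (hy : ∀ i, |y i| ≤ R) {i j : Fin 3} (hij : i ≠ j)
    (hi : |x i| = R) (hj : |x j| = R) (hi' : y i = x i) (hj' : y j = x j) :
    JoinedIn (frontier (sponge r R)) x y := by
  refine joinedIn_of_forall_lineMap fun t h0 h1 => ?_
  refine mem_frontier_sponge_outer hr hR (fun k => ?_) hij ?_ ?_
  · have a := abs_le.1 (hx k); have b := abs_le.1 (hy k)
    simp only [PiLp.add_apply, PiLp.smul_apply, PiLp.sub_apply, smul_eq_mul]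
    rw [abs_le]; constructor <;> nlinarith
  · simp [hi', hi]
  · simp [hj', hj, hR.le]

/-- A point on the wall of a tunnel slides along the tunnel to an outer face; a point of an outer
face moves straight to the corner of its octant; the corners are joined along the edges of the cube.
-/
theorem isConnected_frontier_sponge {r R : ℝ} (hr : 0 < r) (hR : r < R) :
    IsConnected (frontier (sponge r R)) := by
  have hR0 : 0 < R := hr.trans hR
  have hc : ∀ x : E3, JoinedIn (frontier (sponge r R)) (cubeCorner R x) (cubeCorner R 0) := by
    intro x
    -- One coordinate at a time is changed to R, so each step runs along an edge of the cube or
    -- stays put.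
    let y1 : E3 := WithLp.toLp 2 ![R, cubeCorner R x 1, cubeCorner R x 2]
    let y2 : E3 := WithLp.toLp 2 ![R, R, cubeCorner R x 2]
    have ha : ∀ i, |cubeCorner R x i| = R := fun i => by
      simp only [cubeCorner]; split_ifs <;> simp [abs_of_pos hR0]
    have hab : ∀ i, |cubeCorner R 0 i| = R := fun i => by simp [cubeCorner, abs_of_pos hR0]
    have h1 : ∀ i, |y1 i| = R := fun i => by
      fin_cases i <;> simp [y1, ha, abs_of_pos hR0]
    have h2 : ∀ i, |y2 i| = R := fun i => by
      fin_cases i <;> simp [y2, ha, abs_of_pos hR0]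
    refine (joinedIn_frontier_sponge_edge hr hR (y := y1) (fun i => (ha i).le)
      (fun i => (h1 i).le) (i := 1) (j := 2) (by decide) (ha _) (ha _) rfl rfl).trans ?_
    refine (joinedIn_frontier_sponge_edge hr hR (y := y2) (fun i => (h1 i).le)
      (fun i => (h2 i).le) (i := 0) (j := 2) (by decide) (h1 _) (h1 _) rfl rfl).trans ?_
    exact (joinedIn_frontier_sponge_edge hr hR (fun i => (h2 i).le)
      (fun i => (hab i).le) (i := 0) (j := 1) (by decide) (h2 _) (h2 _)
      (by simp [cubeCorner, y2]) (by simp [cubeCorner, y2]))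
  have ho : ∀ x : E3, (∀ i, |x i| ≤ R) → ∀ i j, i ≠ j → |x i| = R → r ≤ |x j| →
      JoinedIn (frontier (sponge r R)) x (cubeCorner R 0) := fun x h i j hij hi hj =>
    (joinedIn_frontier_sponge_corner hr hR h hij hi hj).trans (hc x)
  refine IsPathConnected.isConnected ⟨cubeCorner R 0, (hc 0).target_mem, fun {x} hx => ?_⟩
  refine JoinedIn.symm ?_
  have hle := ((mem_frontier_sponge hr hR).1 hx).1.1
  rcases frontier_sponge_cases hr hR hx with ⟨i, j, hij, hi, hj⟩ |
      ⟨-, i, j, k, hij, hik, hjk, hi, hj, hk⟩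
  · exact ho x hle i j hij hi hj
  · let y : E3 := WithLp.toLp 2 fun m => if m = j then (if 0 ≤ x j then R else -R) else x m
    have hyj : |y j| = R := by simp only [y]; split_ifs <;> simp_all [abs_of_pos hR0]
    have hyi : |y i| = r := by simp [y, hij, hi]
    refine JoinedIn.trans (y := y) (joinedIn_of_forall_lineMap fun t h0 h1 => ?_)
      (ho y (fun m => ?_) j i hij.symm hyj hyi.ge)
    · have key : |(x + t • (y - x)) j| = (1 - t) * |x j| + t * R := by
        simpa [y] using abs_add_smul_sign (x j) R t (by linarith) h0 h1
      have key' : ∀ m, m ≠ j → (x + t • (y - x)) m = x m := fun m hm => by simp [y, hm]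
      refine mem_frontier_sponge_inner hr hR (fun m => ?_) hij hik hjk ?_ ?_ ?_
      · by_cases hm : m = j
        · rw [hm, key]; nlinarith [hle j]
        · rw [key' m hm]; exact hle m
      · rw [key' i hij, hi]
      · rw [key]; nlinarith
      · rwa [key' k hjk.symm]
    · by_cases hm : m = j
      · rw [hm, hyj]
      · simpa [y, hm] using hle m

/-! ### Cells -/

/-- The vertices of the box with lower corner `l` and upper corner `u`. -/
def boxVertices (l u : Fin 3 → ℝ) : Finset E3 :=
  (Fintype.piFinset fun i => ({l i, u i} : Finset ℝ)).map (WithLp.equiv 2 (Fin 3 → ℝ)).symm.toEmbedding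

theorem mem_boxVertices {l u : Fin 3 → ℝ} {x : E3} :
    x ∈ boxVertices l u ↔ ∀ i, x i = l i ∨ x i = u i := by
  simp only [boxVertices, Finset.mem_map_equiv, Fintype.mem_piFinset, Finset.mem_insert,
    Finset.mem_singleton]
  rfl

/-- Forwards, strictly positive weights put each coordinate strictly between two distinct end
values. Backwards, the weights are products of two-point barycentric weights, one factor per
coordinate, and the sums factor by distributivity. -/
theorem mem_openCell_boxVertices {l u : Fin 3 → ℝ} (hlu : ∀ i, l i ≤ u i) {x : E3} :
    x ∈ openCell (boxVertices l u) ↔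
      ∀ i, (l i = u i ∧ x i = l i) ∨ (l i < x i ∧ x i < u i) := by
  constructor
  · rintro ⟨a, ha, ha1, rfl⟩ i
    have e : (∑ v ∈ boxVertices l u, a v • v) i = ∑ v ∈ boxVertices l u, a v * v i := by
      simp
    have el : l i = ∑ v ∈ boxVertices l u, a v * l i := by rw [← Finset.sum_mul, ha1, one_mul]
    have eu : u i = ∑ v ∈ boxVertices l u, a v * u i := by rw [← Finset.sum_mul, ha1, one_mul]
    have hb : ∀ v ∈ boxVertices l u, l i ≤ v i ∧ v i ≤ u i := fun v hv => by
      rcases mem_boxVertices.1 hv i with h | h <;> rw [h] <;> simp [hlu i]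
    rcases (hlu i).eq_or_lt with h | h
    · refine Or.inl ⟨h, ?_⟩
      rw [e]; conv_rhs => rw [el]
      refine Finset.sum_congr rfl fun v hv => ?_
      rw [le_antisymm ((hb v hv).2.trans h.ge) (hb v hv).1]
    · refine Or.inr ⟨?_, ?_⟩
      · rw [e]; conv_lhs => rw [el]
        have hu : WithLp.toLp 2 u ∈ boxVertices l u := mem_boxVertices.2 fun i => Or.inr rfl
        exact Finset.sum_lt_sum (fun v hv => mul_le_mul_of_nonneg_left (hb v hv).1 (ha v hv).le)
          ⟨_, hu, mul_lt_mul_of_pos_left h (ha _ hu)⟩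
      · rw [e]; conv_rhs => rw [eu]
        have hl : WithLp.toLp 2 l ∈ boxVertices l u := mem_boxVertices.2 fun i => Or.inl rfl
        exact Finset.sum_lt_sum (fun v hv => mul_le_mul_of_nonneg_left (hb v hv).2 (ha v hv).le)
          ⟨_, hl, mul_lt_mul_of_pos_left h (ha _ hl)⟩
  · intro hx
    have hw : ∀ i, ∃ w : ℝ → ℝ, 0 < w (l i) ∧ 0 < w (u i) ∧
        ∑ y ∈ ({l i, u i} : Finset ℝ), w y = 1 ∧ ∑ y ∈ ({l i, u i} : Finset ℝ), w y * y = x i := by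
      intro i
      rcases hx i with ⟨h, h'⟩ | ⟨h, h'⟩
      · exact ⟨fun _ => 1, one_pos, one_pos, by simp [h], by simp [h', h]⟩
      · have hne : l i ≠ u i := (h.trans h').ne
        have hpos : 0 < u i - l i := by linarith
        refine ⟨fun y => if y = l i then (u i - x i) / (u i - l i) else (x i - l i) / (u i - l i),
          ?_, ?_, ?_, ?_⟩
        · simp only [if_true]; exact div_pos (by linarith) hpos
        · simp only [hne.symm, if_false]; exact div_pos (by linarith) hpos
        · rw [Finset.sum_pair hne]; simp only [if_true, hne.symm, if_false]; field_simp; ring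
        · rw [Finset.sum_pair hne]; simp only [if_true, hne.symm, if_false]; field_simp; ring
    choose w hwl hwu hw1 hwx using hw
    refine ⟨fun v => ∏ i, w i (v i), fun v hv => Finset.prod_pos fun i _ => ?_, ?_, ?_⟩
    · rcases mem_boxVertices.1 hv i with h | h <;> rw [h]
      · exact hwl i
      · exact hwu i
    · rw [boxVertices, Finset.sum_map]
      have := Finset.prod_univ_sum (fun i => ({l i, u i} : Finset ℝ)) (fun i y => w i y)
      rw [Finset.prod_congr rfl (fun i _ => hw1 i), Finset.prod_const_one] at this
      exact this.symm
    · ext j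
      rw [boxVertices, Finset.sum_map]
      -- Inserting the coordinate in the j-th factor only turns that factor into x j, while the
      -- others stay 1.
      have := Finset.prod_univ_sum (fun i => ({l i, u i} : Finset ℝ))
        (fun i y => w i y * if i = j then y else 1)
      have e1 : ∀ i, ∑ y ∈ ({l i, u i} : Finset ℝ), w i y * (if i = j then y else 1) =
          if i = j then x i else 1 := fun i => by
        split_ifs with hij
        · exact hwx i
        · simp [hw1 i]
      simp only [e1, Finset.prod_mul_distrib, Finset.prod_ite_eq', Finset.mem_univ, if_true] at this
      rw [this]
      simp

/-- Differences of vertices vanish in the coordinates with l i = u i; in the others, changing a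
single l i to u i produces a multiple of the basis vector. -/
theorem cellDim_boxVertices {l u : Fin 3 → ℝ} (hlu : ∀ i, l i ≤ u i) :
    cellDim (boxVertices l u) = (Finset.univ.filter fun i => l i < u i).card := by
  let e : {i // l i < u i} → E3 := fun i => EuclideanSpace.single (i : Fin 3) 1
  have hli : LinearIndependent ℝ e := by
    have := (EuclideanSpace.basisFun (Fin 3) ℝ).toBasis.linearIndependent
    have h2 := this.comp (Subtype.val : {i // l i < u i} → Fin 3) Subtype.val_injective
    have h3 : e = (EuclideanSpace.basisFun (Fin 3) ℝ).toBasis ∘ Subtype.val := by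
      ext i; simp [e]
    rw [h3]; exact h2
  have hspan : vectorSpan ℝ (boxVertices l u : Set E3) = Submodule.span ℝ (Set.range e) := by
    apply le_antisymm
    · rw [vectorSpan_def, Submodule.span_le]
      rintro _ ⟨v, hv, w, hw, rfl⟩
      have hz : v - w = ∑ i, (v i - w i) • EuclideanSpace.single i (1 : ℝ) := by
        ext j; simp [Pi.single_apply]
      show v - w ∈ _
      rw [hz]
      refine Submodule.sum_mem _ fun i _ => ?_
      by_cases hi : l i < u i
      · exact Submodule.smul_mem _ _ (Submodule.subset_span ⟨⟨i, hi⟩, rfl⟩)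
      · have hi' : l i = u i := le_antisymm (hlu i) (not_lt.1 hi)
        have h1 : v i = w i := by
          rcases mem_boxVertices.1 hv i with h | h <;>
            rcases mem_boxVertices.1 hw i with h' | h' <;> rw [h, h'] <;> simp [hi']
        rw [h1, sub_self, zero_smul]; exact Submodule.zero_mem _
    · rw [Submodule.span_le]
      rintro _ ⟨⟨i, hi⟩, rfl⟩
      let v : E3 := WithLp.toLp 2 (Function.update l i (u i))
      have hv : v ∈ boxVertices l u := mem_boxVertices.2 fun j => by
        by_cases h : j = i
        · subst h; simp [v]
        · simp [v, h]
      have hw : (WithLp.toLp 2 l : E3) ∈ boxVertices l u := mem_boxVertices.2 fun j => Or.inl rfl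
      have h1 := vsub_mem_vectorSpan ℝ (s := (boxVertices l u : Set E3)) hv hw
      have h2 : e ⟨i, hi⟩ = (u i - l i)⁻¹ • (v -ᵥ (WithLp.toLp 2 l : E3)) := by
        have : u i - l i ≠ 0 := by linarith
        ext j
        by_cases h : j = i
        · subst h; simp [v, e, this]
        · simp [v, e, h]
      rw [SetLike.mem_coe, h2]
      exact Submodule.smul_mem _ _ h1
  rw [cellDim, hspan, finrank_span_eq_card hli, Fintype.card_subtype]
end Sponge
end

/-! ### The cell partition of the boundary and its Euler characteristic. -/

noncomputable section
namespace Sponge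

/-- Lower ends of the seven open cells into which `±r`, `±R` divide `[-R, R]`. -/
def cellLower (r R : ℝ) : Fin 7 → ℝ := ![-R, -R, -r, -r, r, r, R]

/-- Upper ends of the seven open cells into which `±r`, `±R` divide `[-R, R]`. -/
def cellUpper (r R : ℝ) : Fin 7 → ℝ := ![-R, -r, -r, r, r, R, R]

/-- The position of `|y|` with respect to `r < R` for `y` in a one-dimensional cell. -/
def cellClass : Fin 7 → ℕ := ![3, 2, 1, 0, 1, 2, 3]

/-- The one-dimensional cell with number `a`. -/
def InCell (r R : ℝ) (a : Fin 7) (y : ℝ) : Prop :=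
  (cellLower r R a = cellUpper r R a ∧ y = cellLower r R a) ∨
    (cellLower r R a < y ∧ y < cellUpper r R a)

theorem cellLower_le_cellUpper {r R : ℝ} (hr : 0 < r) (hR : r < R) (a : Fin 7) :
    cellLower r R a ≤ cellUpper r R a := by
  fin_cases a <;> simp [cellLower, cellUpper] <;> linarith

theorem cellLower_lt_cellUpper_iff {r R : ℝ} (hr : 0 < r) (hR : r < R) (a : Fin 7) :
    cellLower r R a < cellUpper r R a ↔ (a : ℕ) % 2 = 1 := by
  fin_cases a <;> simp [cellLower, cellUpper] <;> linarith

theorem exists_inCell {r R y : ℝ} (hy : |y| ≤ R) : ∃ a, InCell r R a y := by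
  obtain ⟨h1, h2⟩ := abs_le.1 hy
  rcases lt_trichotomy y (-r) with h | h | h
  · rcases h1.eq_or_lt with h' | h'
    · exact ⟨0, Or.inl ⟨rfl, h'.symm⟩⟩
    · exact ⟨1, Or.inr ⟨h', h⟩⟩
  · exact ⟨2, Or.inl ⟨rfl, h⟩⟩
  · rcases lt_trichotomy y r with h' | h' | h'
    · exact ⟨3, Or.inr ⟨h, h'⟩⟩
    · exact ⟨4, Or.inl ⟨rfl, h'⟩⟩
    · rcases h2.eq_or_lt with h'' | h''
      · exact ⟨6, Or.inl ⟨rfl, h''⟩⟩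
      · exact ⟨5, Or.inr ⟨h', h''⟩⟩

theorem InCell.unique {r R y : ℝ} (hr : 0 < r) (hR : r < R) {a b : Fin 7} (ha : InCell r R a y)
    (hb : InCell r R b y) : a = b := by
  fin_cases a <;> fin_cases b <;> first | rfl | (
    exfalso
    simp [InCell, cellLower, cellUpper] at ha hb
    grind)

theorem InCell.abs {r R y : ℝ} (hr : 0 < r) (hR : r < R) {a : Fin 7} (ha : InCell r R a y) :
    |y| ≤ R ∧ (|y| < R ↔ cellClass a ≤ 2) ∧ (r ≤ |y| ↔ 1 ≤ cellClass a) ∧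
      (r < |y| ↔ 2 ≤ cellClass a) := by
  fin_cases a <;> simp [InCell, cellLower, cellUpper, cellClass] at ha ⊢ <;>
    grind

/-- The products of one-dimensional cells that make up the boundary of the sponge. -/
def IsBoundaryCell (a : Fin 3 → Fin 7) : Prop :=
  (∃ i j, i ≠ j ∧ 1 ≤ cellClass (a i) ∧ 1 ≤ cellClass (a j)) ∧
    ¬ ((∀ i, cellClass (a i) ≤ 2) ∧ ∃ i j, i ≠ j ∧ 2 ≤ cellClass (a i) ∧ 2 ≤ cellClass (a j))

instance : DecidablePred IsBoundaryCell := fun a => by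
  unfold IsBoundaryCell; infer_instance

/-- The vertices of a product of one-dimensional cells. -/
def cellVertices (r R : ℝ) (a : Fin 3 → Fin 7) : Finset E3 :=
  boxVertices (fun i => cellLower r R (a i)) (fun i => cellUpper r R (a i))

theorem mem_openCell_cellVertices {r R : ℝ} (hr : 0 < r) (hR : r < R) {a : Fin 3 → Fin 7} {x : E3} :
    x ∈ openCell (cellVertices r R a) ↔ ∀ i, InCell r R (a i) (x i) :=
  mem_openCell_boxVertices fun i => cellLower_le_cellUpper hr hR (a i)

theorem cellVertices_nonempty (r R : ℝ) (a : Fin 3 → Fin 7) : (cellVertices r R a).Nonempty :=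
  ⟨WithLp.toLp 2 fun i => cellLower r R (a i), mem_boxVertices.2 fun _ => Or.inl rfl⟩

theorem exists_inCell_of_cell {r R : ℝ} (hr : 0 < r) (hR : r < R) (a : Fin 7) :
    ∃ y, InCell r R a y := by
  rcases (cellLower_le_cellUpper hr hR a).eq_or_lt with h | h
  · exact ⟨_, Or.inl ⟨h, rfl⟩⟩
  · exact ⟨(cellLower r R a + cellUpper r R a) / 2, Or.inr ⟨by linarith, by linarith⟩⟩

/-- Open cells are nonempty and any of their points determines the triple of indices. Injectivity
turns the alternating sum over vertex sets into a sum over triples. -/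
theorem cellVertices_injective {r R : ℝ} (hr : 0 < r) (hR : r < R) :
    Function.Injective (cellVertices r R) := by
  intro a b hab
  choose y hy using fun i => exists_inCell_of_cell hr hR (a i)
  have h : (WithLp.toLp 2 y : E3) ∈ openCell (cellVertices r R a) :=
    (mem_openCell_cellVertices hr hR).2 hy
  rw [hab] at h
  ext1 i
  exact (hy i).unique hr hR ((mem_openCell_cellVertices hr hR).1 h i)

/-- The open intervals carry the odd numbers, so the sign (-1)^dim of a product cell is the product
of the (-1)^(a i). The total is 2 - 2 · 5. -/
theorem sum_boundaryCells :
    ∑ a : Fin 3 → Fin 7, (if IsBoundaryCell a then ∏ i, (-1 : ℤ) ^ (a i : ℕ) else 0) = -8 := by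
  -- Written as three nested sums, the 343 terms can be evaluated by computation.
  have e : ∀ f : (Fin 3 → Fin 7) → ℤ, ∑ a, f a = ∑ x, ∑ y, ∑ z, f ![x, y, z] := fun f => by
    rw [← (Fin.consEquiv fun _ : Fin 3 => Fin 7).sum_comp, Fintype.sum_prod_type]
    refine Finset.sum_congr rfl fun x _ => ?_
    rw [← (Fin.consEquiv fun _ : Fin 2 => Fin 7).sum_comp, Fintype.sum_prod_type]
    refine Finset.sum_congr rfl fun y _ => ?_
    rw [← (Fin.consEquiv fun _ : Fin 1 => Fin 7).sum_comp, Fintype.sum_prod_type]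
    refine Finset.sum_congr rfl fun z _ => ?_
    rw [Fintype.sum_unique]
    congr 1
  rw [e]
  decide +kernel

theorem isClosedSurfaceOfGenus_frontier_sponge {r R : ℝ} (hr : 0 < r) (hR : r < R) :
    IsClosedSurfaceOfGenus (frontier (sponge r R)) 5 where
  isCompact := isCompact_frontier_sponge (hr.trans hR)
  isConnected := isConnected_frontier_sponge hr hR
  locallyPlanar := nonempty_chartedSpace_frontier_sponge hr hR
  eulerChar := by
    refine ⟨(Finset.univ.filter IsBoundaryCell).map ⟨_, cellVertices_injective hr hR⟩,
      ⟨?_, ?_, ?_⟩, ?_⟩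
    · intro F hF
      obtain ⟨a, -, rfl⟩ := Finset.mem_map.1 hF
      exact cellVertices_nonempty r R a
    · rintro F hF G hG hFG
      obtain ⟨a, -, rfl⟩ := Finset.mem_map.1 (Finset.mem_coe.1 hF)
      obtain ⟨b, -, rfl⟩ := Finset.mem_map.1 (Finset.mem_coe.1 hG)
      refine Set.disjoint_left.2 fun x hx hx' => hFG ?_
      congr 1; ext1 i
      exact ((mem_openCell_cellVertices hr hR).1 hx i).unique hr hR
        ((mem_openCell_cellVertices hr hR).1 hx' i)
    -- Lying on the boundary depends only on how the three |x i| compare with r and R, hence only on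
    -- the cell.
    · have key : ∀ (a : Fin 3 → Fin 7) (x : E3), (∀ i, InCell r R (a i) (x i)) →
          (x ∈ frontier (sponge r R) ↔ IsBoundaryCell a) := fun a x hx => by
        rw [mem_frontier_sponge hr hR, IsBoundaryCell]
        simp only [sponge, Set.mem_ofPred_eq, ((hx _).abs hr hR).2.1, ((hx _).abs hr hR).2.2.1,
          ((hx _).abs hr hR).2.2.2]
        refine and_congr_left fun _ => and_iff_right fun i => ((hx i).abs hr hR).1
      ext x
      simp only [Finset.mem_map, Finset.mem_filter, Finset.mem_univ, true_and, Set.mem_iUnion,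
        Function.Embedding.coeFn_mk, exists_prop]
      constructor
      · rintro ⟨_, ⟨a, ha, rfl⟩, hx⟩
        exact (key a x ((mem_openCell_cellVertices hr hR).1 hx)).2 ha
      · intro hx
        choose a ha using fun i => exists_inCell (r := r)
          (((mem_frontier_sponge hr hR).1 hx).1.1 i)
        exact ⟨_, ⟨a, (key a x ha).1 hx, rfl⟩, (mem_openCell_cellVertices hr hR).2 ha⟩
    · rw [Finset.sum_map, Finset.sum_filter]
      have h8 : (2 - 2 * ((5 : ℕ) : ℤ)) = -8 := by norm_num
      rw [h8, ← sum_boundaryCells]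
      refine Finset.sum_congr rfl fun a _ => ?_
      congr 1
      rw [Function.Embedding.coeFn_mk, cellVertices,
        cellDim_boxVertices fun i => cellLower_le_cellUpper hr hR (a i)]
      simp only [cellLower_lt_cellUpper_iff hr hR]
      rw [← Finset.prod_const, Finset.prod_filter]
      refine Finset.prod_congr rfl fun i _ => ?_
      split_ifs with h
      · rw [Odd.neg_one_pow (Nat.odd_iff.2 h)]
      · rw [Even.neg_one_pow (Nat.even_iff.2 (by omega))]
end Sponge
end

/-! ### Measure, normals and weak divergence on surfaces with axis-parallel facets. -/

noncomputable section
namespace Sponge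

/-! ### Surface measure on coordinate planes -/

theorem sum_fin_three_add {M : Type*} [AddCommMonoid M] (f : Fin 3 → M) (i : Fin 3) :
    ∑ j, f j = f i + f (i + 1) + f (i + 2) := by
  rw [Fin.sum_univ_three]
  fin_cases i
  · rfl
  · show _ = f 1 + f 2 + f 0
    abel
  · show _ = f 2 + f 0 + f 1
    abel

/-- The point with `i`-th coordinate `c` and the following two coordinates, cyclically, `y`. -/
def facetMap (i : Fin 3) (c : ℝ) (y : ℝ × ℝ) : E3 :=
  WithLp.toLp 2 fun m => if m = i then c else if m = i + 1 then y.1 else y.2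

@[simp] theorem facetMap_self (i : Fin 3) (c : ℝ) (y : ℝ × ℝ) : facetMap i c y i = c := by
  simp [facetMap]

@[simp] theorem facetMap_one (i : Fin 3) (c : ℝ) (y : ℝ × ℝ) : facetMap i c y (i + 1) = y.1 := by
  simp [facetMap]

@[simp] theorem facetMap_two (i : Fin 3) (c : ℝ) (y : ℝ × ℝ) : facetMap i c y (i + 2) = y.2 := by
  have h1 : i + 2 ≠ i := by decide +revert
  have h2 : i + 2 ≠ i + 1 := by decide +revert
  simp [facetMap, h1, h2]

theorem facetMap_eq (i : Fin 3) (x : E3) : facetMap i (x i) (x (i + 1), x (i + 2)) = x := by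
  have h : ∀ m, m = i ∨ m = i + 1 ∨ m = i + 2 := by decide +revert
  ext m
  rcases h m with rfl | h | h
  · simp
  · rw [h, facetMap_one]
  · rw [h, facetMap_two]

theorem fin_three_cases (i m : Fin 3) : m = i ∨ m = i + 1 ∨ m = i + 2 := by decide +revert

/-- Facets normal to e_i and to e_{i+1} are cut by the same plane x_{i+2} = t. This identifies
points of the two slices, a and b being the coordinates i and i + 1, and so brings both families of
edges into one planar identity. -/
theorem facetMap_succ (i : Fin 3) (a b t : ℝ) :
    facetMap (i + 1) b (t, a) = facetMap i a (b, t) := by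
  have h : ∀ m, m = i ∨ m = i + 1 ∨ m = i + 2 := by decide +revert
  ext m
  rcases h m with rfl | h | h
  · have e : m = m + 1 + 2 := by decide +revert
    rw [facetMap_self]
    conv_lhs => rw [e]
    rw [← e, e, ← e]
    have := facetMap_two (m + 1) b (t, a)
    rwa [← e] at this
  · rw [h, facetMap_self, facetMap_one]
  · have e : i + 2 = i + 1 + 1 := by decide +revert
    rw [h, facetMap_two, e, facetMap_one]

theorem continuous_facetMap' (i : Fin 3) : Continuous fun p : ℝ × ℝ × ℝ => facetMap i p.1 p.2 := by
  refine (PiLp.continuous_toLp 2 _).comp (continuous_pi fun m => ?_)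
  split_ifs <;> fun_prop

theorem continuous_facetMap (i : Fin 3) (c : ℝ) : Continuous (facetMap i c) :=
  (continuous_facetMap' i).comp (by fun_prop : Continuous fun y : ℝ × ℝ => (c, y))

theorem measurableEmbedding_facetMap (i : Fin 3) (c : ℝ) : MeasurableEmbedding (facetMap i c) := by
  refine (continuous_facetMap i c).measurableEmbedding fun y y' h => ?_
  have h1 := congrArg (fun x : E3 => x (i + 1)) h
  have h2 := congrArg (fun x : E3 => x (i + 2)) h
  simp only [facetMap_one, facetMap_two] at h1 h2
  exact Prod.ext h1 h2

/-- The product ℝ × ℝ carries the maximum distance; e replaces it by the Euclidean plane while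
preserving Lebesgue measure, and facetMap becomes an isometry onto the coordinate plane. -/
theorem map_facetMap_volume (i : Fin 3) (c : ℝ) :
    (volume : Measure (ℝ × ℝ)).map (facetMap i c) = (μHE[2] : Measure E3).restrict {x | x i = c} := by
  let e : EuclideanSpace ℝ (Fin 2) ≃ᵐ ℝ × ℝ :=
    (MeasurableEquiv.toLp 2 (Fin 2 → ℝ)).symm.trans MeasurableEquiv.finTwoArrow
  have he : MeasurePreserving e volume volume :=
    (EuclideanSpace.volume_preserving_symm_measurableEquiv_toLp (Fin 2)).trans
      (volume_preserving_finTwoArrow ℝ)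
  have hiso : Isometry (facetMap i c ∘ e) := by
    refine Isometry.of_dist_eq fun x y => ?_
    have h1 : ∀ x, e x = (x 0, x 1) := fun x => rfl
    rw [EuclideanSpace.dist_eq, EuclideanSpace.dist_eq, sum_fin_three_add _ i]
    simp [h1]
  have hr : Set.range (facetMap i c ∘ e) = {x | x i = c} := by
    ext x
    constructor
    · rintro ⟨y, rfl⟩; simp
    · intro hx
      refine ⟨e.symm (x (i + 1), x (i + 2)), ?_⟩
      have hx' : x i = c := hx
      rw [Function.comp_apply, e.apply_symm_apply, ← hx', facetMap_eq]
  rw [← hr, ← hiso.map_euclideanHausdorffMeasure, EuclideanSpace.euclideanHausdorffMeasure_eq_volume,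
    ← Measure.map_map (continuous_facetMap i c).measurable e.measurable, he.map_eq]

theorem volume_fst_eq (c : ℝ) : volume {y : ℝ × ℝ | y.1 = c} = 0 := by
  have : {y : ℝ × ℝ | y.1 = c} = {c} ×ˢ Set.univ := by ext; simp
  rw [this, Measure.volume_eq_prod, Measure.prod_prod]; simp

theorem volume_snd_eq (c : ℝ) : volume {y : ℝ × ℝ | y.2 = c} = 0 := by
  have : {y : ℝ × ℝ | y.2 = c} = Set.univ ×ˢ {c} := by ext; simp
  rw [this, Measure.volume_eq_prod, Measure.prod_prod]; simp

theorem measurableSet_coord_eq (i : Fin 3) (c : ℝ) : MeasurableSet {x : E3 | x i = c} :=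
  (isClosed_eq (by fun_prop) (by fun_prop)).measurableSet

/-- Distinct coordinate planes are disjoint or meet in a line, which has no area. -/
theorem aedisjoint_coord_planes {i j : Fin 3} {c d : ℝ} (h : (i, c) ≠ (j, d)) :
    AEDisjoint (μHE[2] : Measure E3) {x | x i = c} {x | x j = d} := by
  by_cases hij : i = j
  · subst hij
    have hcd : c ≠ d := fun h' => h (by rw [h'])
    refine Disjoint.aedisjoint (Set.disjoint_left.2 fun x hx hx' => hcd ?_)
    exact (show x i = c from hx).symm.trans hx'
  · have h1 : (μHE[2] : Measure E3) ({x | x i = c} ∩ {x | x j = d}) =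
        volume (facetMap i c ⁻¹' {x | x j = d}) := by
      rw [← (measurableEmbedding_facetMap i c).map_apply, map_facetMap_volume,
        Measure.restrict_apply (measurableSet_coord_eq j d), Set.inter_comm]
    rw [AEDisjoint, h1]
    rcases fin_three_cases i j with h | h | h
    · exact absurd h.symm hij
    · subst h; simpa using volume_fst_eq d
    · subst h; simpa using volume_snd_eq d

/-! ### Surfaces made of axis-parallel facets -/

/-- The boundary of `E` consists of the facets `x i = c`, `c ∈ C`, where the other two coordinates
lie in `Reg c`, with normal `s c • e_i`. -/
structure HasFacets (E : Set E3) (C : Finset ℝ) (Reg : ℝ → Set (ℝ × ℝ)) (s : ℝ → ℝ) : Prop where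
  frontier_eq : frontier E = {x | ∃ i, x i ∈ C ∧ (x (i + 1), x (i + 2)) ∈ Reg (x i)}
  measurableSet : ∀ c ∈ C, MeasurableSet (Reg c)
  symm : ∀ c a b, (a, b) ∈ Reg c ↔ (b, a) ∈ Reg c
  bounded : ∃ M, ∀ c ∈ C, Reg c ⊆ Set.Icc (-M) M ×ˢ Set.Icc (-M) M
  sign : ∀ c ∈ C, s c = 1 ∨ s c = -1
  normal : ∀ i, ∀ c ∈ C, ∀ᵐ y ∂(volume.restrict (Reg c)),
    IsOuterNormal E (facetMap i c y) (s c • EuclideanSpace.single i 1)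

variable {E : Set E3} {C : Finset ℝ} {Reg : ℝ → Set (ℝ × ℝ)} {s : ℝ → ℝ}

/-- Facets overlap only in null sets, so surface measure is a sum of planar Lebesgue measures. All
boundary integrals are computed through this formula. -/
theorem HasFacets.area_eq (h : HasFacets E C Reg s) :
    area E = ∑ i : Fin 3, ∑ c ∈ C, (volume.restrict (Reg c)).map (facetMap i c) := by
  let P : Fin 3 × C → Set E3 := fun p => {x | x p.1 = p.2} ∩ {x | (x (p.1 + 1), x (p.1 + 2)) ∈ Reg p.2}
  have hmeas2 : ∀ p : Fin 3 × C, MeasurableSet {x : E3 | (x (p.1 + 1), x (p.1 + 2)) ∈ Reg p.2} :=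
    fun p => (by fun_prop : Measurable fun x : E3 => (x (p.1 + 1), x (p.1 + 2)))
      (h.measurableSet p.2 p.2.2)
  have hm : ∀ p, MeasurableSet (P p) := fun p =>
    (measurableSet_coord_eq _ _).inter (hmeas2 p)
  have hU : frontier E = ⋃ p, P p := by
    rw [h.frontier_eq]
    ext x
    simp only [P, Set.mem_iUnion, Set.mem_inter_iff, Set.mem_ofPred_eq, Prod.exists,
      Subtype.exists, exists_and_left]
    constructor
    · rintro ⟨i, hc, hR⟩; exact ⟨i, x i, rfl, hc, hR⟩
    · rintro ⟨i, c, hc, hC, hR⟩; exact ⟨i, hc ▸ hC, hc ▸ hR⟩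
  rw [area, hU, Measure.restrict_iUnion_ae _ fun p => (hm p).nullMeasurableSet, Measure.sum_fintype,
    Fintype.sum_prod_type]
  · refine Finset.sum_congr rfl fun i _ => ?_
    rw [← Finset.sum_coe_sort C]
    refine Finset.sum_congr rfl fun c _ => ?_
    rw [← Measure.restrict_restrict (measurableSet_coord_eq _ _),
      Measure.restrict_comm (measurableSet_coord_eq _ _), ← map_facetMap_volume,
      (measurableEmbedding_facetMap i c).restrict_map]
    congr 2
    ext y; simp
  · rintro ⟨i, c⟩ ⟨j, d⟩ hne
    refine (aedisjoint_coord_planes (i := i) (j := j) (c := c) (d := d) fun he => hne ?_).mono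
      Set.inter_subset_left Set.inter_subset_left
    rw [Prod.mk.injEq] at he
    exact Prod.ext he.1 (Subtype.ext he.2)

theorem HasFacets.ae_area_iff (h : HasFacets E C Reg s) {p : E3 → Prop} :
    (∀ᵐ x ∂(area E), p x) ↔
      ∀ i, ∀ c ∈ C, ∀ᵐ y ∂(volume.restrict (Reg c)), p (facetMap i c y) := by
  rw [h.area_eq, ← Measure.sum_fintype, Measure.ae_sum_iff]
  refine forall_congr' fun i => ?_
  rw [← Finset.sum_coe_sort C, ← Measure.sum_fintype, Measure.ae_sum_iff]
  simp only [(measurableEmbedding_facetMap i _).ae_map_iff, Subtype.forall]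

theorem HasFacets.volume_lt_top (h : HasFacets E C Reg s) {c : ℝ} (hc : c ∈ C) :
    volume (Reg c) < ⊤ := by
  obtain ⟨M, hM⟩ := h.bounded
  exact (measure_mono (hM c hc)).trans_lt
    (isCompact_Icc.prod isCompact_Icc).measure_lt_top

theorem HasFacets.isFiniteMeasure_area (h : HasFacets E C Reg s) : IsFiniteMeasure (area E) := by
  refine ⟨?_⟩
  rw [h.area_eq]
  simp only [Measure.coe_finsetSum, Finset.sum_apply]
  refine ENNReal.sum_lt_top.2 fun i _ => ENNReal.sum_lt_top.2 fun c hc => ?_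
  rw [(measurableEmbedding_facetMap i c).map_apply]
  simpa using h.volume_lt_top hc

theorem HasFacets.integrable_iff (h : HasFacets E C Reg s) {f : E3 → ℝ} :
    Integrable f (area E) ↔
      ∀ i, ∀ c ∈ C, IntegrableOn (fun y => f (facetMap i c y)) (Reg c) := by
  rw [h.area_eq, integrable_finsetSum_measure]
  simp only [integrable_finsetSum_measure, (measurableEmbedding_facetMap _ _).integrable_map_iff,
    Finset.mem_univ, true_imp_iff]
  rfl

theorem HasFacets.integral_area (h : HasFacets E C Reg s) {f : E3 → ℝ}
    (hf : Integrable f (area E)) :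
    ∫ x, f x ∂(area E) = ∑ i : Fin 3, ∑ c ∈ C, ∫ y in Reg c, f (facetMap i c y) := by
  rw [h.area_eq] at hf ⊢
  rw [integrable_finsetSum_measure] at hf
  rw [integral_finsetSum_measure hf]
  refine Finset.sum_congr rfl fun i hi => ?_
  have := hf i hi
  rw [integrable_finsetSum_measure] at this
  rw [integral_finsetSum_measure this]
  refine Finset.sum_congr rfl fun c hc => ?_
  rw [(measurableEmbedding_facetMap i c).integral_map]

/-- The normal field of a surface with axis-parallel facets. -/
def facetNormal (C : Finset ℝ) (s : ℝ → ℝ) (x : E3) : E3 :=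
  WithLp.toLp 2 fun i => if x i ∈ C then s (x i) else 0

/-- `facetNormal` has extra nonzero components only where a second coordinate lies in the finite set
C, a null set in each facet. -/
theorem ae_facetNormal (C : Finset ℝ) (s : ℝ → ℝ) (i : Fin 3) {c : ℝ} (hc : c ∈ C)
    (A : Set (ℝ × ℝ)) : ∀ᵐ y ∂(volume.restrict A),
      facetNormal C s (facetMap i c y) = s c • EuclideanSpace.single i 1 := by
  refine ae_restrict_of_ae ?_
  have h1 : ∀ᵐ y : ℝ × ℝ, ∀ d ∈ C, y.1 ≠ d :=
    (ae_ball_iff C.countable_toSet).2 fun d _ => by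
      rw [ae_iff]; simpa using volume_fst_eq d
  have h2 : ∀ᵐ y : ℝ × ℝ, ∀ d ∈ C, y.2 ≠ d :=
    (ae_ball_iff C.countable_toSet).2 fun d _ => by
      rw [ae_iff]; simpa using volume_snd_eq d
  filter_upwards [h1, h2] with y hy1 hy2
  have hy1' : y.1 ∉ C := fun h => hy1 _ h rfl
  have hy2' : y.2 ∉ C := fun h => hy2 _ h rfl
  have n1 : i + 1 ≠ i := by decide +revert
  have n2 : i + 2 ≠ i := by decide +revert
  ext m
  rcases fin_three_cases i m with h | h | h
  · subst h; simp [facetNormal, hc]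
  · subst h; simp [facetNormal, hy1']
  · subst h; simp [facetNormal, hy2', n2]

theorem measurable_facetNormal (C : Finset ℝ) (s : ℝ → ℝ) : Measurable (facetNormal C s) := by
  classical
  refine (WithLp.measurable_toLp 2 _).comp (measurable_pi_lambda _ fun i => ?_)
  have : (fun x : E3 => if x i ∈ C then s (x i) else 0) =
      fun x : E3 => ∑ c ∈ C, if x i = c then s c else 0 := by
    ext x
    rw [Finset.sum_ite_eq]
  rw [this]
  refine Finset.measurable_fun_sum _ fun c _ => ?_
  exact Measurable.ite (measurableSet_coord_eq i c) measurable_const measurable_const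

theorem HasFacets.isNormalField (h : HasFacets E C Reg s) : IsNormalField E (facetNormal C s) := by
  refine ⟨(measurable_facetNormal C s).aestronglyMeasurable, h.ae_area_iff.2 fun i c hc => ?_⟩
  filter_upwards [h.normal i c hc, ae_facetNormal C s i hc (Reg c)] with y h1 h2
  rwa [h2]

/-! ### Uniqueness of normals -/

/-- A vector of ker f with g > 0 could be scaled to outweigh any fixed direction in {f < 0}; so g
vanishes on ker f and is determined by its value where f = 1. -/
theorem exists_smul_of_neg_imp {V : Type*} [AddCommGroup V] [Module ℝ V] {f g : V →ₗ[ℝ] ℝ}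
    (hf : f ≠ 0) (h : ∀ v, f v < 0 → g v ≤ 0) : ∃ c : ℝ, 0 ≤ c ∧ g = c • f := by
  obtain ⟨w, hw⟩ : ∃ w, f w ≠ 0 := by
    by_contra! h0
    exact hf (LinearMap.ext h0)
  obtain ⟨w, hw⟩ : ∃ w, f w = 1 := ⟨(f w)⁻¹ • w, by simp [hw]⟩
  have hker : ∀ v, f v = 0 → g v ≤ 0 := fun v hv => by
    by_contra! hpos
    -- At this vector f is -1 while g is |g w| + 1 - g w > 0.
    have h1 := h (((|g w| + 1) / g v) • v - w) (by simp [hv, hw])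
    simp only [map_sub, map_smul, smul_eq_mul] at h1
    rw [div_mul_cancel₀ _ hpos.ne'] at h1
    linarith [le_abs_self (g w)]
  refine ⟨g w, ?_, LinearMap.ext fun v => ?_⟩
  · have := h (-w) (by simp [hw])
    simp at this; exact this
  · have h1 := hker (v - f v • w) (by simp [hw])
    have h2 := hker (-(v - f v • w)) (by simp [hw])
    simp only [map_sub, map_neg, map_smul, smul_eq_mul] at h1 h2
    simp only [LinearMap.smul_apply, smul_eq_mul]
    linarith

theorem eventually_neg_of_hasFDerivAt {V : Type*} [NormedAddCommGroup V] [NormedSpace ℝ V]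
    {ψ : V → ℝ} {f : V →L[ℝ] ℝ} {x v : V} (hψ : HasFDerivAt ψ f x) (h0 : ψ x = 0) (hv : f v < 0) :
    ∀ᶠ t in 𝓝[>] (0 : ℝ), ψ (x + t • v) < 0 := by
  have h1 : HasDerivAt (fun t : ℝ => ψ (x + t • v)) (f v) 0 := by
    have hl : HasDerivAt (fun t : ℝ => x + t • v) v 0 := by
      simpa using ((hasDerivAt_id (0 : ℝ)).smul_const v).const_add x
    have h2 : HasFDerivAt ψ f (x + (0 : ℝ) • v) := by simpa using hψ
    exact h2.comp_hasDerivAt 0 hl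
  have h2 := (hasDerivAt_iff_tendsto_slope.1 h1).mono_left
    (nhdsWithin_mono 0 (fun t (ht : 0 < t) => ht.ne' : Set.Ioi (0 : ℝ) ⊆ {0}ᶜ))
  filter_upwards [h2.eventually (eventually_lt_nhds hv), self_mem_nhdsWithin] with t ht ht0
  have ht0' : (0 : ℝ) < t := ht0
  simp only [slope, zero_smul, add_zero, h0, sub_zero, vsub_eq_sub, smul_eq_mul] at ht
  by_contra! hc
  exact absurd ht (not_lt.2 (by positivity))

/-- Along a direction of negative derivative a function vanishing at x becomes negative at once, so
the half-spaces of the two differentials cannot disagree. In space this gives uniqueness of the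
normal, in space-time that of the velocity. -/
theorem exists_smul_of_neg_iff {V : Type*} [NormedAddCommGroup V] [NormedSpace ℝ V]
    {ψ₁ ψ₂ : V → ℝ} {f₁ f₂ : V →L[ℝ] ℝ} {x : V} (h₁ : HasFDerivAt ψ₁ f₁ x)
    (h₂ : HasFDerivAt ψ₂ f₂ x) (h0₁ : ψ₁ x = 0) (h0₂ : ψ₂ x = 0) (hf₁ : f₁ ≠ 0) (hf₂ : f₂ ≠ 0)
    (h : ∀ᶠ y in 𝓝 x, (ψ₁ y < 0 ↔ ψ₂ y < 0)) : ∃ c : ℝ, 0 < c ∧ f₂ = c • f₁ := by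
  have key : ∀ v, f₁ v < 0 → f₂ v ≤ 0 := fun v hv => by
    by_contra! hpos
    have hpos' : (-f₂) v < 0 := by simpa using hpos
    have e1 := eventually_neg_of_hasFDerivAt h₁ h0₁ hv
    have e2 := eventually_neg_of_hasFDerivAt (ψ := fun y => -ψ₂ y) h₂.neg (by simp [h0₂]) hpos'
    have hl : Tendsto (fun t : ℝ => x + t • v) (𝓝[>] 0) (𝓝 x) := by
      have : Tendsto (fun t : ℝ => x + t • v) (𝓝 0) (𝓝 (x + (0 : ℝ) • v)) :=
        Continuous.tendsto (by fun_prop) 0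
      rw [zero_smul, add_zero] at this
      exact this.mono_left nhdsWithin_le_nhds
    obtain ⟨t, ht1, ht2, ht3⟩ := (e1.and (e2.and (hl.eventually h))).exists
    have := ht3.1 ht1
    linarith
  obtain ⟨c, hc, hcf⟩ := exists_smul_of_neg_imp (f := (f₁ : V →ₗ[ℝ] ℝ)) (g := (f₂ : V →ₗ[ℝ] ℝ))
    (fun h0 => hf₁ (ContinuousLinearMap.coe_injective h0)) key
  have hcf' : f₂ = c • f₁ := ContinuousLinearMap.coe_injective hcf
  refine ⟨c, lt_of_le_of_ne hc fun h0 => hf₂ ?_, hcf'⟩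
  rw [hcf', ← h0, zero_smul]

theorem IsOuterNormal.unique {x ν ν' : E3} (h : IsOuterNormal E x ν) (h' : IsOuterNormal E x ν') :
    ν = ν' := by
  obtain ⟨ψ, p, h0, hg, hp, hE, rfl⟩ := h
  obtain ⟨ψ', p', h0', hg', hp', hE', rfl⟩ := h'
  have hne : ∀ {p : E3}, p ≠ 0 → (InnerProductSpace.toDual ℝ E3) p ≠ 0 := fun hp h => hp (by simpa using h)
  obtain ⟨c, hc, he⟩ := exists_smul_of_neg_iff hg hg' h0 h0' (hne hp) (hne hp')
    ((hE.and hE').mono fun y hy => hy.1.symm.trans hy.2)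
  have hpp : p' = c • p := by
    apply (InnerProductSpace.toDual ℝ E3).injective
    rw [he]; simp
  rw [hpp, norm_smul, smul_smul, Real.norm_eq_abs, abs_of_pos hc]
  congr 1
  field_simp

end Sponge
end

noncomputable section
namespace Sponge

variable {E : Set E3} {C : Finset ℝ} {Reg : ℝ → Set (ℝ × ℝ)} {s : ℝ → ℝ}

theorem fin_three_add_one_ne (i : Fin 3) : i + 1 ≠ i := by decide +revert

theorem fin_three_add_two_ne (i : Fin 3) : i + 2 ≠ i := by decide +revert

/-! ### The subdifferential at a coordinate normal -/

theorem l1_add_single (i : Fin 3) (σ : ℝ) (h : E3) :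
    l1 (σ • EuclideanSpace.single i 1 + h) = |σ + h i| + |h (i + 1)| + |h (i + 2)| := by
  have n1 := fin_three_add_one_ne i
  have n2 := fin_three_add_two_ne i
  rw [l1, sum_fin_three_add _ i]
  simp [n1, n2]

theorem l1_single {σ : ℝ} (hσ : σ = 1 ∨ σ = -1) (i : Fin 3) :
    l1 (σ • EuclideanSpace.single i 1) = 1 := by
  have := l1_add_single i σ 0
  simp only [add_zero, PiLp.zero_apply, abs_zero] at this
  rw [this]; rcases hσ with h | h <;> simp [h]

theorem inner_eq_sum (x y : E3) : inner ℝ x y = ∑ i, x i * y i := by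
  simp [PiLp.inner_apply, mul_comm]

theorem mem_subdiff_single {σ : ℝ} (hσ : σ = 1 ∨ σ = -1) {i : Fin 3} {z : E3} (hz : z i = σ)
    (h1 : |z (i + 1)| ≤ 1) (h2 : |z (i + 2)| ≤ 1) :
    z ∈ subdiff l1 (σ • EuclideanSpace.single i 1) := by
  intro h
  rw [l1_add_single, l1_single hσ, inner_eq_sum, sum_fin_three_add _ i, hz]
  have a1 : z (i + 1) * h (i + 1) ≤ |h (i + 1)| := (le_abs_self _).trans (by
    rw [abs_mul]; exact mul_le_of_le_one_left (abs_nonneg _) h1)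
  have a2 : z (i + 2) * h (i + 2) ≤ |h (i + 2)| := (le_abs_self _).trans (by
    rw [abs_mul]; exact mul_le_of_le_one_left (abs_nonneg _) h2)
  have a3 : σ * h i ≤ |σ + h i| - 1 := by
    rcases hσ with rfl | rfl
    · linarith [le_abs_self (1 + h i)]
    · linarith [neg_le_abs (-1 + h i)]
  linarith

/-- Testing with ±e_i suffices. Only the normal component is extracted, since the minimality
argument does not see the tangential part of z. -/
theorem eq_of_mem_subdiff_single {σ : ℝ} (hσ : σ = 1 ∨ σ = -1) {i : Fin 3} {z : E3}
    (hz : z ∈ subdiff l1 (σ • EuclideanSpace.single i 1)) : z i = σ := by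
  have n1 := fin_three_add_one_ne i
  have n2 := fin_three_add_two_ne i
  have key : ∀ a : ℝ, z i * a ≤ |σ + a| - 1 := fun a => by
    have := hz (EuclideanSpace.single i a)
    rw [l1_add_single, l1_single hσ, inner_eq_sum, sum_fin_three_add _ i] at this
    simpa [n1, n2] using this
  rcases hσ with rfl | rfl
  · have h1 := key 1; have h2 := key (-1)
    norm_num at h1 h2; linarith
  · have h1 := key 1; have h2 := key (-1)
    norm_num at h1 h2; linarith

/-! ### Square integrable functions -/

theorem eLpNorm_two_eq_ofReal {α : Type*} [MeasurableSpace α] {μ : Measure α} {f : α → ℝ}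
    (hf : MemLp f 2 μ) : eLpNorm f 2 μ = ENNReal.ofReal (√(∫ x, f x ^ 2 ∂μ)) := by
  rw [hf.eLpNorm_eq_integral_rpow_norm (by simp) (by simp), Real.sqrt_eq_rpow]
  simp

theorem eLpNorm_two_le_iff {α : Type*} [MeasurableSpace α] {μ : Measure α} {f g : α → ℝ}
    (hf : MemLp f 2 μ) (hg : MemLp g 2 μ) :
    eLpNorm f 2 μ ≤ eLpNorm g 2 μ ↔ ∫ x, f x ^ 2 ∂μ ≤ ∫ x, g x ^ 2 ∂μ := by
  rw [eLpNorm_two_eq_ofReal hf, eLpNorm_two_eq_ofReal hg,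
    ENNReal.ofReal_le_ofReal_iff (Real.sqrt_nonneg _),
    Real.sqrt_le_sqrt_iff (integral_nonneg fun x => sq_nonneg _)]

/-- Pythagoras: the hypothesis says that g - f is orthogonal to f in L². -/
theorem integral_sq_eq_add {α : Type*} [MeasurableSpace α] {μ : Measure α} {f g : α → ℝ}
    (hf : MemLp f 2 μ) (hg : MemLp g 2 μ) (h : ∫ x, g x * f x ∂μ = ∫ x, f x ^ 2 ∂μ) :
    ∫ x, g x ^ 2 ∂μ = ∫ x, f x ^ 2 ∂μ + ∫ x, (g x - f x) ^ 2 ∂μ := by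
  have i1 : Integrable (fun x => g x * f x) μ := hg.integrable_mul hf
  have i2 := hf.integrable_sq
  have i3 := hg.integrable_sq
  have e : ∫ x, (g x - f x) ^ 2 ∂μ =
      ∫ x, g x ^ 2 ∂μ - 2 * ∫ x, g x * f x ∂μ + ∫ x, f x ^ 2 ∂μ := by
    have i4 : Integrable (fun x => g x ^ 2 - 2 * (g x * f x)) μ := i3.sub (i1.const_mul 2)
    rw [← integral_const_mul, ← integral_sub i3 (i1.const_mul 2), ← integral_add i4 i2]
    congr 1; ext x; ring
  rw [e, h]; ring

/-! ### Vector fields -/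

/-- The partial derivative `∂_j X_i`. -/
def partialD (X : E3 → E3) (i j : Fin 3) (x : E3) : ℝ :=
  fderiv ℝ X x (EuclideanSpace.single j 1) i

theorem divergence_eq (X : E3 → E3) (i : Fin 3) (x : E3) :
    divergence X x = partialD X i i x + partialD X (i + 1) (i + 1) x +
      partialD X (i + 2) (i + 2) x := by
  rw [divergence, sum_fin_three_add _ i]; rfl

theorem fderiv_apply_eq (X : E3 → E3) (i k : Fin 3) (x z : E3) :
    fderiv ℝ X x z k = z i * partialD X k i x + z (i + 1) * partialD X k (i + 1) x +
      z (i + 2) * partialD X k (i + 2) x := by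
  have hz : z = ∑ j, z j • EuclideanSpace.single j (1 : ℝ) := by
    ext m; simp [Pi.single_apply]
  conv_lhs => rw [hz, map_sum, sum_fin_three_add _ i]
  simp [partialD]

theorem continuous_partialD {X : E3 → E3} (hX : ContDiff ℝ ∞ X) (i j : Fin 3) :
    Continuous (partialD X i j) := by
  have h := hX.continuous_fderiv (by simp)
  unfold partialD
  fun_prop

theorem hasDerivAt_coord {X : E3 → E3} (hX : ContDiff ℝ ∞ X) (i j : Fin 3) {g : ℝ → E3} {b : ℝ}
    (hg : HasDerivAt g (EuclideanSpace.single j 1) b) :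
    HasDerivAt (fun b => X (g b) i) (partialD X i j (g b)) b := by
  have h1 := ((hX.differentiable (by simp)) (g b)).hasFDerivAt.comp_hasDerivAt b hg
  exact (EuclideanSpace.proj (𝕜 := ℝ) i : E3 →L[ℝ] ℝ).hasFDerivAt.comp_hasDerivAt b h1

theorem hasDerivAt_facetMap_fst (i : Fin 3) (c b t : ℝ) :
    HasDerivAt (fun b => facetMap i c (b, t)) (EuclideanSpace.single (i + 1) 1) b := by
  have h : (fun b => facetMap i c (b, t)) =
      fun b => facetMap i c (0, t) + b • EuclideanSpace.single (i + 1) (1 : ℝ) := by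
    have n1 : i + 2 ≠ i + 1 := by decide +revert
    ext b m
    rcases fin_three_cases i m with h | h | h
    · subst h; simp
    · subst h; simp
    · subst h; simp [n1]
  rw [h]
  simpa using ((hasDerivAt_id b).smul_const (EuclideanSpace.single (i + 1) (1 : ℝ))).const_add
    (facetMap i c (0, t))

theorem hasDerivAt_facetMap_base (i : Fin 3) (c b t : ℝ) :
    HasDerivAt (fun c => facetMap i c (b, t)) (EuclideanSpace.single i 1) c := by
  have h : (fun c => facetMap i c (b, t)) =
      fun c => facetMap i 0 (b, t) + c • EuclideanSpace.single i (1 : ℝ) := by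
    have n1 := fin_three_add_one_ne i
    have n2 := fin_three_add_two_ne i
    ext b m
    rcases fin_three_cases i m with h | h | h
    · subst h; simp
    · subst h; simp [n1]
    · subst h; simp [n2]
  rw [h]
  simpa using ((hasDerivAt_id c).smul_const (EuclideanSpace.single i (1 : ℝ))).const_add
    (facetMap i 0 (b, t))

theorem bounded_partialD {X : E3 → E3} (hX : ContDiff ℝ ∞ X) (hc : HasCompactSupport X) :
    ∃ K, 0 ≤ K ∧ ∀ x, (∀ i, |X x i| ≤ K) ∧ ∀ i j, |partialD X i j x| ≤ K := by
  obtain ⟨K1, h1⟩ := hX.continuous.bounded_above_of_compact_support hc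
  obtain ⟨K2, h2⟩ := (hX.continuous_fderiv (by simp)).bounded_above_of_compact_support (hc.fderiv ℝ)
  refine ⟨max K1 K2, (norm_nonneg _).trans ((h1 0).trans (le_max_left _ _)),
    fun x => ⟨fun i => ?_, fun i j => ?_⟩⟩
  · rw [← Real.norm_eq_abs]
    exact (PiLp.norm_apply_le _ _).trans ((h1 x).trans (le_max_left _ _))
  · rw [← Real.norm_eq_abs]
    refine (PiLp.norm_apply_le _ _).trans (((fderiv ℝ X x).le_opNorm _).trans ?_)
    simpa using (h2 x).trans (le_max_right _ _)

/-! ### The minimality of facetwise constant divergences -/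

/-- For a diagonal Jacobian the tangential components of z drop out of the first-variation density,
so its integral is the same for all Cahn-Hoffman fields. -/
theorem divergence_form_of_diagonal {X : E3 → E3} {x z : E3} {a : Fin 3 → ℝ} {σ : ℝ} {i : Fin 3}
    (hσ : σ = 1 ∨ σ = -1) (hX : ∀ k j, partialD X k j x = if k = j then a j else 0)
    (hz : z i = σ) :
    inner ℝ (σ • EuclideanSpace.single i (1 : ℝ)) (divergence X x • z - fderiv ℝ X x z) =
      a (i + 1) + a (i + 2) := by
  have n1 := (fin_three_add_one_ne i).symm
  have n2 := (fin_three_add_two_ne i).symm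
  have hσ2 : σ * σ = 1 := by rcases hσ with rfl | rfl <;> norm_num
  rw [inner_smul_left, EuclideanSpace.inner_single_left]
  simp only [PiLp.sub_apply, PiLp.smul_apply, smul_eq_mul]
  rw [fderiv_apply_eq X i, divergence_eq X i]
  simp only [hX, if_true, n1, n2, if_false, hz]
  simp
  linear_combination (a (i + 1) + a (i + 2)) * hσ2

/-- A smooth compactly supported field which on a given ball is `(φ x₁, φ x₂, φ x₃)`. -/
theorem exists_diagonal_field {φ : ℝ → ℝ} (hφ : ContDiff ℝ ∞ φ) (M : ℝ) :
    ∃ X : E3 → E3, ContDiff ℝ ∞ X ∧ HasCompactSupport X ∧ ∀ x, ‖x‖ ≤ M →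
      (∀ i, X x i = φ (x i)) ∧ ∀ k j, partialD X k j x = if k = j then deriv φ (x j) else 0 := by
  -- The cutoff equals 1 on a neighbourhood of the given ball, so it does not disturb derivatives
  -- there.
  let χ : ContDiffBump (0 : E3) := ⟨max M 0 + 1, max M 0 + 2, by positivity, by linarith⟩
  let Y : E3 → E3 := fun x => WithLp.toLp 2 fun i => φ (x i)
  have hY : ContDiff ℝ ∞ Y := by
    refine contDiff_euclidean.2 fun i => ?_
    exact hφ.comp (by fun_prop)
  refine ⟨fun x => χ x • Y x, χ.contDiff.smul hY, χ.hasCompactSupport.smul_right, fun x hx => ?_⟩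
  have hev : (fun x => χ x • Y x) =ᶠ[𝓝 x] Y := by
    have : Metric.ball (0 : E3) (max M 0 + 1) ∈ 𝓝 x := by
      refine Metric.isOpen_ball.mem_nhds ?_
      rw [mem_ball_zero_iff]; linarith [le_max_left M 0]
    filter_upwards [this] with y hy
    rw [χ.one_of_mem_closedBall (Metric.ball_subset_closedBall hy), one_smul]
  refine ⟨fun i => congrArg (fun x : E3 => x i) hev.eq_of_nhds, fun k j => ?_⟩
  rw [partialD, hev.fderiv_eq]
  have hd : HasDerivAt (fun t : ℝ => Y (x + t • EuclideanSpace.single j 1) k)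
      (fderiv ℝ Y x (EuclideanSpace.single j 1) k) 0 := by
    have hl : HasDerivAt (fun t : ℝ => x + t • EuclideanSpace.single j (1 : ℝ))
        (EuclideanSpace.single j 1) 0 := by
      simpa using ((hasDerivAt_id (0 : ℝ)).smul_const (EuclideanSpace.single j (1 : ℝ))).const_add x
    have := hasDerivAt_coord hY k j hl
    simpa [partialD] using this
  have hd2 : HasDerivAt (fun t : ℝ => Y (x + t • EuclideanSpace.single j 1) k)
      (if k = j then deriv φ (x j) else 0) 0 := by
    by_cases hkj : k = j
    · subst hkj
      simp only [Y, PiLp.add_apply, PiLp.smul_apply, PiLp.single_apply, if_true, smul_eq_mul,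
        mul_one]
      have h1 : HasDerivAt φ (deriv φ (x k)) (x k + 0) := by
        rw [add_zero]; exact (hφ.differentiable (by simp) _).hasDerivAt
      exact h1.comp_const_add (x k) 0
    · simp only [Y, PiLp.add_apply, PiLp.smul_apply, PiLp.single_apply, hkj, if_false, smul_eq_mul,
        mul_zero, add_zero]
      exact hasDerivAt_const _ _
  exact hd.unique hd2

theorem HasFacets.frontier_subset_closedBall (h : HasFacets E C Reg s) :
    ∃ M, ∀ x ∈ frontier E, ‖x‖ ≤ M := by
  obtain ⟨M, hM⟩ := h.bounded
  obtain ⟨K, hK⟩ : ∃ K, ∀ c ∈ C, |c| ≤ K := by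
    obtain ⟨K, hK⟩ := (C.image abs).bddAbove
    exact ⟨K, fun c hc => hK (by simpa using ⟨c, hc, rfl⟩)⟩
  refine ⟨K + M + M, fun x hx => ?_⟩
  rw [h.frontier_eq] at hx
  obtain ⟨i, hc, hR⟩ := hx
  have h1 := hM _ hc hR
  have b1 : |x (i + 1)| ≤ M := abs_le.2 h1.1
  have b2 : |x (i + 2)| ≤ M := abs_le.2 h1.2
  have hn : ‖x‖ ≤ |x i| + |x (i + 1)| + |x (i + 2)| := by
    rw [EuclideanSpace.norm_eq, sum_fin_three_add _ i]
    apply Real.sqrt_le_iff.2 ⟨by positivity, ?_⟩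
    simp only [Real.norm_eq_abs]
    nlinarith [abs_nonneg (x i), abs_nonneg (x (i + 1)), abs_nonneg (x (i + 2)),
      mul_nonneg (abs_nonneg (x i)) (abs_nonneg (x (i + 1))),
      mul_nonneg (abs_nonneg (x i)) (abs_nonneg (x (i + 2))),
      mul_nonneg (abs_nonneg (x (i + 1))) (abs_nonneg (x (i + 2)))]
  linarith [hK _ hc]

/-- Two surface divergences have the same integral against a function which is, on the facets
`x i = c`, a function of `c` alone. -/
theorem HasFacets.integral_surfaceDivergence_mul (h : HasFacets E C Reg s) {φ : ℝ → ℝ}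
    (hφ : ContDiff ℝ ∞ φ) {κ : E3 → ℝ}
    (hκ : ∀ i, ∀ c ∈ C, ∀ᵐ y ∂(volume.restrict (Reg c)), κ (facetMap i c y) = s c * φ c)
    {ν ν' z z' : E3 → E3} {w w' : E3 → ℝ} (hν : IsNormalField E ν) (hν' : IsNormalField E ν')
    (hz : IsCahnHoffman l1 E ν z) (hz' : IsCahnHoffman l1 E ν' z')
    (hw : IsSurfaceDivergence E ν z w) (hw' : IsSurfaceDivergence E ν' z' w') :
    ∫ x, w x * κ x ∂(area E) = ∫ x, w' x * κ x ∂(area E) := by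
  obtain ⟨M, hM⟩ := h.frontier_subset_closedBall
  obtain ⟨X, hX, hXc, hX1⟩ := exists_diagonal_field hφ M
  have hmem : ∀ᵐ x ∂(area E), x ∈ frontier E := ae_restrict_mem isClosed_frontier.measurableSet
  have hfr := h.ae_area_iff.1 hmem
  have hnorm : ∀ {ν : E3 → E3}, IsNormalField E ν → ∀ i, ∀ c ∈ C, ∀ᵐ y ∂(volume.restrict (Reg c)),
      ν (facetMap i c y) = s c • EuclideanSpace.single i 1 := fun hν i c hc => by
    filter_upwards [h.ae_area_iff.1 hν.2 i c hc, h.normal i c hc] with y h1 h2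
    exact h1.unique h2
  -- On the facet x i = c the flux X · ν is s c * φ c, that is κ.
  have hR : ∀ {ν : E3 → E3} {w : E3 → ℝ}, IsNormalField E ν →
      (fun x => w x * inner ℝ (X x) (ν x)) =ᵐ[area E] fun x => w x * κ x := fun {ν w} hν => by
    refine h.ae_area_iff.2 fun i c hc => ?_
    filter_upwards [hnorm hν i c hc, hκ i c hc, hfr i c hc] with y h1 h2 h3
    rw [h1, h2, inner_smul_right, EuclideanSpace.inner_single_right]
    simp [(hX1 _ (hM _ h3)).1]
  have hL : (fun x => inner ℝ (ν x) (divergence X x • z x - fderiv ℝ X x (z x))) =ᵐ[area E]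
      fun x => inner ℝ (ν' x) (divergence X x • z' x - fderiv ℝ X x (z' x)) := by
    refine h.ae_area_iff.2 fun i c hc => ?_
    filter_upwards [hnorm hν i c hc, hnorm hν' i c hc, hfr i c hc, h.ae_area_iff.1 hz.2 i c hc,
      h.ae_area_iff.1 hz'.2 i c hc] with y h1 h2 h3 h4 h5
    rw [h1] at h4 ⊢
    rw [h2] at h5 ⊢
    have hd := (hX1 _ (hM _ h3)).2
    rw [divergence_form_of_diagonal (a := fun j => deriv φ (facetMap i c y j)) (h.sign c hc) hd
        (eq_of_mem_subdiff_single (h.sign c hc) h4),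
      divergence_form_of_diagonal (a := fun j => deriv φ (facetMap i c y j)) (h.sign c hc) hd
        (eq_of_mem_subdiff_single (h.sign c hc) h5)]
  rw [← integral_congr_ae (hR hν), ← integral_congr_ae (hR hν'), ← hw.2 X hX hXc, ← hw'.2 X hX hXc]
  exact integral_congr_ae hL

/-- A surface divergence whose value on the facets `x i = c` depends on `c` only
is the unique one of minimal norm. -/
theorem HasFacets.minimal_surfaceDivergence (h : HasFacets E C Reg s) {φ : ℝ → ℝ}
    (hφ : ContDiff ℝ ∞ φ) {κ : E3 → ℝ}
    (hκ : ∀ i, ∀ c ∈ C, ∀ᵐ y ∂(volume.restrict (Reg c)), κ (facetMap i c y) = s c * φ c)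
    {ν ν' z z' : E3 → E3} {w : E3 → ℝ} (hν : IsNormalField E ν) (hν' : IsNormalField E ν')
    (hz : IsCahnHoffman l1 E ν z) (hz' : IsCahnHoffman l1 E ν' z')
    (hw : IsSurfaceDivergence E ν z fun x => -κ x) (hw' : IsSurfaceDivergence E ν' z' w) :
    eLpNorm κ 2 (area E) ≤ eLpNorm w 2 (area E) ∧
      (eLpNorm w 2 (area E) ≤ eLpNorm κ 2 (area E) → w =ᵐ[area E] fun x => -κ x) := by
  have e := h.integral_surfaceDivergence_mul hφ hκ hν hν' hz hz' hw hw'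
  -- Both divergences w and -κ have the same inner product with κ, so w + κ is orthogonal to κ.
  have e2 : ∫ x, w x * (-κ x) ∂(area E) = ∫ x, (-κ x) ^ 2 ∂(area E) := by
    have : ∀ x, w x * (-κ x) = -(w x * κ x) := fun x => by ring
    simp only [this, integral_neg, ← e]
    rw [← integral_neg]
    congr 1; ext x; ring
  have hκ' : eLpNorm κ 2 (area E) = eLpNorm (fun x => -κ x) 2 (area E) := by
    rw [← eLpNorm_neg]; rfl
  have key := integral_sq_eq_add hw.1 hw'.1 e2
  have hnn : 0 ≤ ∫ x, (w x - -κ x) ^ 2 ∂(area E) := integral_nonneg fun x => sq_nonneg _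
  rw [hκ', eLpNorm_two_le_iff hw.1 hw'.1, eLpNorm_two_le_iff hw'.1 hw.1]
  refine ⟨by linarith, fun hle => ?_⟩
  have h0 : ∫ x, (w x - -κ x) ^ 2 ∂(area E) = 0 := le_antisymm (by linarith) hnn
  have hi : Integrable (fun x => (w x - -κ x) ^ 2) (area E) := (hw'.1.sub hw.1).integrable_sq
  rw [integral_eq_zero_iff_of_nonneg (fun x => sq_nonneg _) hi] at h0
  filter_upwards [h0] with x hx
  have : (w x - -κ x) ^ 2 = 0 := hx
  exact sub_eq_zero.1 (pow_eq_zero_iff (by norm_num) |>.1 this)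

end Sponge
end

noncomputable section
namespace Sponge

variable {E : Set E3} {C : Finset ℝ} {Reg : ℝ → Set (ℝ × ℝ)} {s k : ℝ → ℝ} {ζ η : ℝ → ℝ → ℝ → ℝ}

/-! ### Cahn-Hoffman fields with facetwise constant divergence -/

/-- The contribution of the edges `{x₁ = c}` of a planar slice to the weak divergence identity. -/
def edgeSum (C : Finset ℝ) (Reg : ℝ → Set (ℝ × ℝ)) (s : ℝ → ℝ) (ζ η : ℝ → ℝ → ℝ → ℝ) (t : ℝ)
    (F F₂ G₂ : ℝ → ℝ → ℝ) : ℝ :=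
  ∑ c ∈ C, ∫ b in {b | (b, t) ∈ Reg c},
    (G₂ c b - s c * (ζ b c t * F₂ c b) - s c * (η b c t * F c b))

/-- The weak divergence identity in the planar slice at height `t`. -/
def SliceIdentity (C : Finset ℝ) (Reg : ℝ → Set (ℝ × ℝ)) (s : ℝ → ℝ) (ζ η : ℝ → ℝ → ℝ → ℝ)
    (t : ℝ) : Prop :=
  ∀ F F₁ F₂ G G₁ G₂ : ℝ → ℝ → ℝ, Continuous (Function.uncurry F₁) → Continuous (Function.uncurry F₂) →
    Continuous (Function.uncurry G₁) → Continuous (Function.uncurry G₂) →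
    (∀ a b, HasDerivAt (fun a => F a b) (F₁ a b) a) → (∀ a b, HasDerivAt (F a) (F₂ a b) b) →
    (∀ a b, HasDerivAt (fun a => G a b) (G₁ a b) a) → (∀ a b, HasDerivAt (G a) (G₂ a b) b) →
    edgeSum C Reg s ζ η t F F₂ G₂ +
      edgeSum C Reg s ζ η t (fun c a => G a c) (fun c a => G₁ a c) (fun c a => F₁ a c) = 0

/-- The field with `j`-th component `ζ (x j) (x (j + 1)) (x (j + 2))` is a Cahn-Hoffman field whose
surface divergence is `-k c` on the facets `x i = c`; `η` is the derivative of `ζ` in the first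
variable. -/
structure IsFacetField (C : Finset ℝ) (Reg : ℝ → Set (ℝ × ℝ)) (s k : ℝ → ℝ)
    (ζ η : ℝ → ℝ → ℝ → ℝ) : Prop where
  measurable_ζ : Measurable fun p : ℝ × ℝ × ℝ => ζ p.1 p.2.1 p.2.2
  measurable_η : Measurable fun p : ℝ × ℝ × ℝ => η p.1 p.2.1 p.2.2
  bounded_η : ∃ K, ∀ b a t, |η b a t| ≤ K
  ζ_symm : ∀ b a t, ζ b a t = ζ b t a
  ζ_facet : ∀ c ∈ C, ∀ᵐ y ∂(volume.restrict (Reg c)), ζ c y.1 y.2 = s c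
  ζ_le : ∀ c ∈ C, ∀ᵐ y ∂(volume.restrict (Reg c)), |ζ y.1 c y.2| ≤ 1 ∧ |ζ y.2 c y.1| ≤ 1
  curvature : ∀ c ∈ C, ∀ᵐ y ∂(volume.restrict (Reg c)), η y.1 c y.2 + η y.2 c y.1 = -k c
  slice : ∀ᵐ t, SliceIdentity C Reg s ζ η t

/-- The Cahn-Hoffman field with `j`-th component `ζ (x j) (x (j + 1)) (x (j + 2))`. -/
def facetField (ζ : ℝ → ℝ → ℝ → ℝ) (x : E3) : E3 :=
  WithLp.toLp 2 fun j => ζ (x j) (x (j + 1)) (x (j + 2))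

theorem fin_three_add_one_add_two (i : Fin 3) : i + 1 + 2 = i := by decide +revert

theorem fin_three_add_two_add_one (i : Fin 3) : i + 2 + 1 = i := by decide +revert

theorem fin_three_add_two_add_two (i : Fin 3) : i + 2 + 2 = i + 1 := by decide +revert

theorem fin_three_add_one_add_one (i : Fin 3) : i + 1 + 1 = i + 2 := by decide +revert

theorem facetField_self (ζ : ℝ → ℝ → ℝ → ℝ) (i : Fin 3) (c : ℝ) (y : ℝ × ℝ) :
    facetField ζ (facetMap i c y) i = ζ c y.1 y.2 := by
  simp [facetField]

theorem facetField_one (hζ : ∀ b a t, ζ b a t = ζ b t a) (i : Fin 3) (c : ℝ) (y : ℝ × ℝ) :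
    facetField ζ (facetMap i c y) (i + 1) = ζ y.1 c y.2 := by
  simp [facetField, fin_three_add_one_add_one, fin_three_add_one_add_two, hζ y.1 c]

theorem facetField_two (i : Fin 3) (c : ℝ) (y : ℝ × ℝ) :
    facetField ζ (facetMap i c y) (i + 2) = ζ y.2 c y.1 := by
  simp [facetField, fin_three_add_two_add_one, fin_three_add_two_add_two]

theorem measurable_facetField (hζ : Measurable fun p : ℝ × ℝ × ℝ => ζ p.1 p.2.1 p.2.2) :
    Measurable (facetField ζ) := by
  refine (WithLp.measurable_toLp 2 _).comp (measurable_pi_lambda _ fun j => ?_)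
  exact hζ.comp (by fun_prop : Measurable fun x : E3 => (x j, x (j + 1), x (j + 2)))

theorem IsFacetField.isCahnHoffman (hf : IsFacetField C Reg s k ζ η) (h : HasFacets E C Reg s) :
    IsCahnHoffman l1 E (facetNormal C s) (facetField ζ) := by
  refine ⟨(measurable_facetField hf.measurable_ζ).aestronglyMeasurable,
    h.ae_area_iff.2 fun i c hc => ?_⟩
  filter_upwards [ae_facetNormal C s i hc (Reg c), hf.ζ_facet c hc,
    hf.ζ_le c hc] with y h1 h2 h3
  rw [h1]
  refine mem_subdiff_single (h.sign c hc) ?_ ?_ ?_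
  · rw [facetField_self, h2]
  · rw [facetField_one hf.ζ_symm]; exact h3.1
  · rw [facetField_two]; exact h3.2

/-- The part of the weak divergence identity on the facet `x i = c` that involves derivatives in
the direction `i + 1`. -/
def facetTermOne (s : ℝ → ℝ) (ζ η : ℝ → ℝ → ℝ → ℝ) (X : E3 → E3) (i : Fin 3) (c : ℝ) (y : ℝ × ℝ) : ℝ :=
  partialD X (i + 1) (i + 1) (facetMap i c y) -
    s c * (ζ y.1 c y.2 * partialD X i (i + 1) (facetMap i c y)) -
    s c * (η y.1 c y.2 * X (facetMap i c y) i)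

/-- The part of the weak divergence identity on the facet `x i = c` that involves derivatives in
the direction `i + 2`. -/
def facetTermTwo (s : ℝ → ℝ) (ζ η : ℝ → ℝ → ℝ → ℝ) (X : E3 → E3) (i : Fin 3) (c : ℝ) (y : ℝ × ℝ) : ℝ :=
  partialD X (i + 2) (i + 2) (facetMap i c y) -
    s c * (ζ y.2 c y.1 * partialD X i (i + 2) (facetMap i c y)) -
    s c * (η y.2 c y.1 * X (facetMap i c y) i)

/-- The term ∂_i X_i cancels because σ² = 1. The rest separates into derivatives in the directions i
+ 1 and i + 2, and each group is integrated in its own family of planar slices. -/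
theorem divergence_form_eq {X : E3 → E3} {x z : E3} {σ : ℝ} {i : Fin 3} (hσ : σ = 1 ∨ σ = -1)
    (hz : z i = σ) :
    inner ℝ (σ • EuclideanSpace.single i (1 : ℝ)) (divergence X x • z - fderiv ℝ X x z) =
      (partialD X (i + 1) (i + 1) x - σ * (z (i + 1) * partialD X i (i + 1) x)) +
      (partialD X (i + 2) (i + 2) x - σ * (z (i + 2) * partialD X i (i + 2) x)) := by
  have hσ2 : σ * σ = 1 := by rcases hσ with rfl | rfl <;> norm_num
  rw [inner_smul_left, EuclideanSpace.inner_single_left]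
  simp only [PiLp.sub_apply, PiLp.smul_apply, smul_eq_mul]
  rw [fderiv_apply_eq X i, divergence_eq X i, hz]
  simp
  linear_combination (partialD X (i + 1) (i + 1) x + partialD X (i + 2) (i + 2) x) * hσ2

theorem setIntegral_eq_integral_slice_fst {A : Set (ℝ × ℝ)} (hA : MeasurableSet A) {f : ℝ × ℝ → ℝ}
    (hf : IntegrableOn f A) :
    Integrable (fun t => ∫ b in {b | (b, t) ∈ A}, f (b, t)) ∧
      ∫ y in A, f y = ∫ t, ∫ b in {b | (b, t) ∈ A}, f (b, t) := by
  have hi : Integrable (A.indicator f) ((volume : Measure ℝ).prod (volume : Measure ℝ)) :=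
    (integrable_indicator_iff hA).2 hf
  have e : ∀ t, ∫ b, A.indicator f (b, t) = ∫ b in {b | (b, t) ∈ A}, f (b, t) := fun t => by
    have hs : MeasurableSet {b | (b, t) ∈ A} := measurable_prodMk_right hA
    rw [← integral_indicator hs]
    rfl
  constructor
  · simpa only [e] using hi.integral_prod_right
  · rw [← integral_indicator hA, Measure.volume_eq_prod, integral_prod_symm _ hi]
    simp only [e]

theorem setIntegral_eq_integral_slice_snd {A : Set (ℝ × ℝ)} (hA : MeasurableSet A) {f : ℝ × ℝ → ℝ}
    (hf : IntegrableOn f A) :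
    Integrable (fun t => ∫ a in {a | (t, a) ∈ A}, f (t, a)) ∧
      ∫ y in A, f y = ∫ t, ∫ a in {a | (t, a) ∈ A}, f (t, a) := by
  have hi : Integrable (A.indicator f) ((volume : Measure ℝ).prod (volume : Measure ℝ)) :=
    (integrable_indicator_iff hA).2 hf
  have e : ∀ t, ∫ a, A.indicator f (t, a) = ∫ a in {a | (t, a) ∈ A}, f (t, a) := fun t => by
    have hs : MeasurableSet {a | (t, a) ∈ A} := measurable_prodMk_left hA
    rw [← integral_indicator hs]
    rfl
  constructor
  · simpa only [e] using hi.integral_prod_left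
  · rw [← integral_indicator hA, Measure.volume_eq_prod, integral_prod _ hi]
    simp only [e]

theorem IsFacetField.integrableOn_facetTerms (hf : IsFacetField C Reg s k ζ η)
    (h : HasFacets E C Reg s) {X : E3 → E3} (hX : ContDiff ℝ ∞ X) (hXc : HasCompactSupport X)
    (i : Fin 3) {c : ℝ} (hc : c ∈ C) :
    IntegrableOn (facetTermOne s ζ η X i c) (Reg c) ∧
      IntegrableOn (facetTermTwo s ζ η X i c) (Reg c) ∧
      IntegrableOn (fun y => X (facetMap i c y) i) (Reg c) := by
  obtain ⟨K, hK0, hK⟩ := bounded_partialD hX hXc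
  obtain ⟨W, hW⟩ := hf.bounded_η
  have hW0 : 0 ≤ W := (abs_nonneg _).trans (hW 0 0 0)
  have mp : ∀ a b, Measurable fun y => partialD X a b (facetMap i c y) := fun a b =>
    (continuous_partialD hX a b).measurable.comp (continuous_facetMap i c).measurable
  have mX : Measurable fun y => X (facetMap i c y) i := by
    have h1 : Continuous fun x => X x i :=
      (EuclideanSpace.proj (𝕜 := ℝ) i : E3 →L[ℝ] ℝ).continuous.comp hX.continuous
    exact h1.measurable.comp (continuous_facetMap i c).measurable
  have m1 : Measurable fun y : ℝ × ℝ => ζ y.1 c y.2 := hf.measurable_ζ.comp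
    (by fun_prop : Measurable fun y : ℝ × ℝ => (y.1, c, y.2))
  have m2 : Measurable fun y : ℝ × ℝ => ζ y.2 c y.1 := hf.measurable_ζ.comp
    (by fun_prop : Measurable fun y : ℝ × ℝ => (y.2, c, y.1))
  have m3 : Measurable fun y : ℝ × ℝ => η y.1 c y.2 := hf.measurable_η.comp
    (by fun_prop : Measurable fun y : ℝ × ℝ => (y.1, c, y.2))
  have m4 : Measurable fun y : ℝ × ℝ => η y.2 c y.1 := hf.measurable_η.comp
    (by fun_prop : Measurable fun y : ℝ × ℝ => (y.2, c, y.1))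
  have hs : |s c| = 1 := by rcases h.sign c hc with h | h <;> rw [h] <;> norm_num
  have bd : ∀ p q z w x : ℝ, |p| ≤ K → |q| ≤ K → |x| ≤ K → |z| ≤ 1 → |w| ≤ W →
      ‖p - s c * (z * q) - s c * (w * x)‖ ≤ K + K + W * K := by
    intro p q z w x hp hq hx hz hw
    have e1 : |s c * (z * q)| ≤ K := by
      rw [abs_mul, abs_mul, hs, one_mul]
      calc |z| * |q| ≤ 1 * K := mul_le_mul hz hq (abs_nonneg _) zero_le_one
        _ = K := one_mul K
    have e2 : |s c * (w * x)| ≤ W * K := by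
      rw [abs_mul, abs_mul, hs, one_mul]
      exact mul_le_mul hw hx (abs_nonneg _) hW0
    rw [Real.norm_eq_abs]
    exact (abs_sub _ _).trans (add_le_add ((abs_sub _ _).trans (add_le_add hp e1)) e2)
  have hvol := h.volume_lt_top hc
  refine ⟨IntegrableOn.of_bound hvol ?_ (K + K + W * K) ?_,
    IntegrableOn.of_bound hvol ?_ (K + K + W * K) ?_, IntegrableOn.of_bound hvol
      mX.aestronglyMeasurable K (ae_of_all _ fun y => (hK _).1 i)⟩
  · exact ((((mp _ _).sub ((m1.mul (mp _ _)).const_mul _)).sub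
      ((m3.mul mX).const_mul _))).aestronglyMeasurable
  · filter_upwards [hf.ζ_le c hc] with y hy
    exact bd _ _ _ _ _ ((hK _).2 _ _) ((hK _).2 _ _) ((hK _).1 _) hy.1 (hW _ _ _)
  · exact ((((mp _ _).sub ((m2.mul (mp _ _)).const_mul _)).sub
      ((m4.mul mX).const_mul _))).aestronglyMeasurable
  · filter_upwards [hf.ζ_le c hc] with y hy
    exact bd _ _ _ _ _ ((hK _).2 _ _) ((hK _).2 _ _) ((hK _).1 _) hy.2 (hW _ _ _)

/-- In the plane x_{i+2} = t the facets normal to e_i contribute edges in direction i + 1, and those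
normal to e_{i+1} contribute edges in direction (i + 1) + 2 = i. By Fubini the sum is an integral
over t of the slice identity with F = X_i and G = X_{i+1}. -/
theorem IsFacetField.sum_facetTerms (hf : IsFacetField C Reg s k ζ η)
    (h : HasFacets E C Reg s) {X : E3 → E3} (hX : ContDiff ℝ ∞ X) (hXc : HasCompactSupport X)
    (i : Fin 3) :
    (∑ c ∈ C, ∫ y in Reg c, facetTermOne s ζ η X i c y) +
      ∑ c ∈ C, ∫ y in Reg c, facetTermTwo s ζ η X (i + 1) c y = 0 := by
  have h1 := fun c (hc : c ∈ C) => setIntegral_eq_integral_slice_fst (h.measurableSet c hc)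
    (hf.integrableOn_facetTerms h hX hXc i hc).1
  have h2 := fun c (hc : c ∈ C) => setIntegral_eq_integral_slice_snd (h.measurableSet c hc)
    (hf.integrableOn_facetTerms h hX hXc (i + 1) hc).2.1
  rw [Finset.sum_congr rfl fun c hc => (h1 c hc).2, Finset.sum_congr rfl fun c hc => (h2 c hc).2,
    ← integral_finsetSum _ fun c hc => (h1 c hc).1, ← integral_finsetSum _ fun c hc => (h2 c hc).1,
    ← integral_add (integrable_finsetSum _ fun c hc => (h1 c hc).1)
      (integrable_finsetSum _ fun c hc => (h2 c hc).1)]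
  refine integral_eq_zero_of_ae ?_
  filter_upwards [hf.slice] with t ht
  have hc2 : ∀ a b, Continuous (Function.uncurry fun p q => partialD X a b (facetMap i p (q, t))) :=
    fun a b => ((continuous_partialD hX a b).comp (continuous_facetMap' i)).comp
      (by fun_prop : Continuous fun p : ℝ × ℝ => (p.1, p.2, t))
  have key := ht (fun p q => X (facetMap i p (q, t)) i)
    (fun p q => partialD X i i (facetMap i p (q, t)))
    (fun p q => partialD X i (i + 1) (facetMap i p (q, t)))
    (fun p q => X (facetMap i p (q, t)) (i + 1))
    (fun p q => partialD X (i + 1) i (facetMap i p (q, t)))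
    (fun p q => partialD X (i + 1) (i + 1) (facetMap i p (q, t)))
    (hc2 _ _) (hc2 _ _) (hc2 _ _) (hc2 _ _)
    (fun a b => hasDerivAt_coord hX i i (hasDerivAt_facetMap_base i a b t))
    (fun a b => hasDerivAt_coord hX i (i + 1) (hasDerivAt_facetMap_fst i a b t))
    (fun a b => hasDerivAt_coord hX (i + 1) i (hasDerivAt_facetMap_base i a b t))
    (fun a b => hasDerivAt_coord hX (i + 1) (i + 1) (hasDerivAt_facetMap_fst i a b t))
  rw [edgeSum, edgeSum] at key
  refine Eq.trans ?_ key
  congr 1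
  refine Finset.sum_congr rfl fun c _ => ?_
  have hset : {a | (t, a) ∈ Reg c} = {b | (b, t) ∈ Reg c} := by
    ext a; exact h.symm c t a
  rw [hset]
  congr 1
  ext a
  simp only [facetTermTwo, facetMap_succ, fin_three_add_one_add_two]

theorem IsFacetField.isSurfaceDivergence (hf : IsFacetField C Reg s k ζ η)
    (h : HasFacets E C Reg s) {κ : E3 → ℝ}
    (hκ : ∀ i, ∀ c ∈ C, ∀ᵐ y ∂(volume.restrict (Reg c)), κ (facetMap i c y) = k c) :
    IsSurfaceDivergence E (facetNormal C s) (facetField ζ) fun x => -κ x := by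
  have := h.isFiniteMeasure_area
  have hmeas : AEStronglyMeasurable κ (area E) := by
    rw [h.area_eq, ← Measure.sum_fintype, aestronglyMeasurable_sum_measure_iff]
    intro i
    rw [← Finset.sum_coe_sort C, ← Measure.sum_fintype, aestronglyMeasurable_sum_measure_iff]
    rintro ⟨c, hc⟩
    rw [(measurableEmbedding_facetMap i c).aestronglyMeasurable_map_iff]
    exact ⟨fun _ => k c, stronglyMeasurable_const, hκ i c hc⟩
  obtain ⟨K, hK⟩ : ∃ K, ∀ c ∈ C, |k c| ≤ K := by
    obtain ⟨K, hK⟩ := (C.image fun c => |k c|).bddAbove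
    exact ⟨K, fun c hc => hK (by simpa using ⟨c, hc, rfl⟩)⟩
  refine ⟨MemLp.of_bound hmeas.neg K (h.ae_area_iff.2 fun i c hc => ?_), fun X hX hXc => ?_⟩
  · filter_upwards [hκ i c hc] with y hy
    rw [norm_neg, hy]; exact hK c hc
  · have e2 : ∀ i, ∀ c ∈ C, ∀ᵐ y ∂(volume.restrict (Reg c)),
        -κ (facetMap i c y) * inner ℝ (X (facetMap i c y)) (facetNormal C s (facetMap i c y)) =
        -k c * s c * X (facetMap i c y) i := fun i c hc => by
      filter_upwards [hκ i c hc, ae_facetNormal C s i hc (Reg c)] with y h1 h2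
      rw [h1, h2, inner_smul_right, EuclideanSpace.inner_single_right]
      simp [mul_assoc]
    -- The two η terms subtracted in the facet terms add up to the curvature term, because the two
    -- values of η sum to -k c.
    have e1 : ∀ i, ∀ c ∈ C, ∀ᵐ y ∂(volume.restrict (Reg c)),
        inner ℝ (facetNormal C s (facetMap i c y)) (divergence X (facetMap i c y) •
          facetField ζ (facetMap i c y) - fderiv ℝ X (facetMap i c y)
            (facetField ζ (facetMap i c y))) =
        facetTermOne s ζ η X i c y + facetTermTwo s ζ η X i c y +
          -k c * s c * X (facetMap i c y) i := fun i c hc => by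
      filter_upwards [ae_facetNormal C s i hc (Reg c), hf.ζ_facet c hc, hf.curvature c hc]
        with y h1 h2 h3
      rw [h1, divergence_form_eq (h.sign c hc) (by rw [facetField_self, h2]),
        facetField_one hf.ζ_symm, facetField_two, facetTermOne, facetTermTwo, ← h3]
      ring
    have hI := fun i c hc => hf.integrableOn_facetTerms h hX hXc i (c := c) hc
    have i1 : Integrable (fun x => inner ℝ (facetNormal C s x)
        (divergence X x • facetField ζ x - fderiv ℝ X x (facetField ζ x))) (area E) :=
      h.integrable_iff.2 fun i c hc =>
      ((((hI i c hc).1.add (hI i c hc).2.1).add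
        ((hI i c hc).2.2.const_mul (-k c * s c))).congr ((e1 i c hc).mono fun y hy => hy.symm))
    have i2 : Integrable (fun x => -κ x * inner ℝ (X x) (facetNormal C s x)) (area E) :=
      h.integrable_iff.2 fun i c hc =>
      (((hI i c hc).2.2.const_mul (-k c * s c)).congr ((e2 i c hc).mono fun y hy => hy.symm))
    rw [h.integral_area i1, h.integral_area i2]
    have e3 : ∀ i, ∀ c ∈ C, ∫ y in Reg c, inner ℝ (facetNormal C s (facetMap i c y))
          (divergence X (facetMap i c y) • facetField ζ (facetMap i c y) -
            fderiv ℝ X (facetMap i c y) (facetField ζ (facetMap i c y))) =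
        (∫ y in Reg c, facetTermOne s ζ η X i c y) + (∫ y in Reg c, facetTermTwo s ζ η X i c y) +
        ∫ y in Reg c, -κ (facetMap i c y) *
          inner ℝ (X (facetMap i c y)) (facetNormal C s (facetMap i c y)) := fun i c hc => by
      have a1 := (hI i c hc).1
      have a2 := (hI i c hc).2.1
      have a3 : IntegrableOn (fun y => -k c * s c * X (facetMap i c y) i) (Reg c) :=
        (hI i c hc).2.2.const_mul (-k c * s c)
      have a12 : IntegrableOn (fun y => facetTermOne s ζ η X i c y + facetTermTwo s ζ η X i c y)
        (Reg c) := a1.add a2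
      rw [integral_congr_ae (e1 i c hc), integral_congr_ae (e2 i c hc), integral_add a12 a3,
        integral_add a1 a2]
    rw [Finset.sum_congr rfl fun i _ => Finset.sum_congr rfl fun c hc => e3 i c hc]
    simp only [Finset.sum_add_distrib]
    -- The cyclic shift brings together the two families of edges that lie in the same slices.
    have e4 : ∑ i : Fin 3, ∑ c ∈ C, ∫ y in Reg c, facetTermTwo s ζ η X i c y =
        ∑ i : Fin 3, ∑ c ∈ C, ∫ y in Reg c, facetTermTwo s ζ η X (i + 1) c y :=
      (Equiv.sum_comp (Equiv.addRight (1 : Fin 3))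
        (fun i => ∑ c ∈ C, ∫ y in Reg c, facetTermTwo s ζ η X i c y)).symm
    rw [e4, ← Finset.sum_add_distrib, Finset.sum_congr rfl fun i _ => hf.sum_facetTerms h hX hXc i]
    simp

/-- The function φ supplies the test field of the minimality argument, and hk says that its flux
through a facet is the curvature there. A competitor κ' comes with its own normal field, which
agrees almost everywhere with `facetNormal` by uniqueness of normals. -/
theorem IsFacetField.isCrystallineCurvature (hf : IsFacetField C Reg s k ζ η)
    (h : HasFacets E C Reg s) {φ : ℝ → ℝ} (hφ : ContDiff ℝ ∞ φ) (hk : ∀ c ∈ C, k c = s c * φ c)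
    {κ : E3 → ℝ}
    (hκ : ∀ i, ∀ c ∈ C, ∀ᵐ y ∂(volume.restrict (Reg c)), κ (facetMap i c y) = k c) :
    IsCrystallineCurvature l1 E κ ∧
      ∀ κ', IsCrystallineCurvature l1 E κ' → κ' =ᵐ[area E] κ := by
  have hκφ : ∀ i, ∀ c ∈ C, ∀ᵐ y ∂(volume.restrict (Reg c)), κ (facetMap i c y) = s c * φ c :=
    fun i c hc => by rw [← hk c hc]; exact hκ i c hc
  have hν := h.isNormalField
  have hz := hf.isCahnHoffman h
  have hw := hf.isSurfaceDivergence h hκ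
  refine ⟨⟨_, hν, ⟨_, hz, hw⟩, fun z w hz' hw' =>
    (h.minimal_surfaceDivergence hφ hκφ hν hν hz hz' hw hw').1⟩, ?_⟩
  rintro κ' ⟨ν', hν', ⟨z', hz', hw'⟩, hmin⟩
  have hnu : ν' =ᵐ[area E] facetNormal C s := by
    filter_upwards [hν.2, hν'.2] with x h1 h2
    exact h2.unique h1
  have hz2 : IsCahnHoffman l1 E ν' (facetField ζ) :=
    ⟨hz.1, by filter_upwards [hz.2, hnu] with x h1 h2; rwa [h2]⟩
  have hw2 : IsSurfaceDivergence E ν' (facetField ζ) fun x => -κ x := by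
    refine ⟨hw.1, fun X hX hXc => ?_⟩
    refine (integral_congr_ae ?_).trans ((hw.2 X hX hXc).trans (integral_congr_ae ?_))
    · filter_upwards [hnu] with x hx; rw [hx]
    · filter_upwards [hnu] with x hx; rw [hx]
  have hn : ∀ f : E3 → ℝ, eLpNorm (fun x => -f x) 2 (area E) = eLpNorm f 2 (area E) := fun f => by
    rw [← eLpNorm_neg f]; rfl
  have hle := hmin _ _ hz2 hw2
  rw [hn] at hle
  have := (h.minimal_surfaceDivergence hφ hκφ hν hν' hz hz' hw hw').2 (by rw [hn]; exact hle)
  filter_upwards [this] with x hx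
  linarith

end Sponge
end

/-! ### Facets, slices and curvature of the sponge. -/

noncomputable section
namespace Sponge

/-! ### The facets of the sponge -/

theorem ae_abs_ne (r : ℝ) : ∀ᵐ y : ℝ × ℝ, |y.1| ≠ r ∧ |y.2| ≠ r := by
  have h1 : ∀ d, ∀ᵐ y : ℝ × ℝ, y.1 ≠ d := fun d => by
    rw [ae_iff]; simpa using volume_fst_eq d
  have h2 : ∀ d, ∀ᵐ y : ℝ × ℝ, y.2 ≠ d := fun d => by
    rw [ae_iff]; simpa using volume_snd_eq d
  filter_upwards [h1 r, h1 (-r), h2 r, h2 (-r)] with y a b c d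
  constructor
  · intro h; rcases eq_or_eq_neg_of_abs_eq h with h | h
    · exact a h
    · exact b h
  · intro h; rcases eq_or_eq_neg_of_abs_eq h with h | h
    · exact c h
    · exact d h

/-- The ordinates of the facets of the sponge. -/
def spongeLevels (r R : ℝ) : Finset ℝ := {R, -R, r, -r}

/-- The facets of the sponge. -/
def spongeFacet (r R c : ℝ) : Set (ℝ × ℝ) :=
  {y | |y.1| ≤ R ∧ |y.2| ≤ R ∧ (r ≤ |y.1| ∨ r ≤ |y.2|) ∧ (|c| = R ∨ |y.1| ≤ r ∨ |y.2| ≤ r)}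

/-- The orientation of the facets of the sponge. -/
def spongeSign (r R c : ℝ) : ℝ := if c = R ∨ c = -r then 1 else -1

theorem mem_spongeLevels {r R c : ℝ} (hr : 0 < r) (hR : r < R) :
    c ∈ spongeLevels r R ↔ |c| = R ∨ |c| = r := by
  simp only [spongeLevels, Finset.mem_insert, Finset.mem_singleton, abs_eq hr.le,
    abs_eq (hr.trans hR).le]
  tauto

theorem spongeSign_outer {r R σ : ℝ} (hr : 0 < r) (hR : r < R) (hσ : σ = 1 ∨ σ = -1) :
    spongeSign r R (σ * R) = σ := by
  rcases hσ with rfl | rfl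
  · simp [spongeSign]
  · rw [spongeSign, if_neg]
    rintro (h | h) <;> linarith

theorem spongeSign_inner {r R σ : ℝ} (hr : 0 < r) (hR : r < R) (hσ : σ = 1 ∨ σ = -1) :
    spongeSign r R (σ * r) = -σ := by
  rcases hσ with rfl | rfl
  · rw [spongeSign, if_neg]
    rintro (h | h) <;> linarith
  · simp [spongeSign]

theorem exists_sign_mul_of_abs_eq {a c : ℝ} (h : |c| = a) : ∃ σ : ℝ, (σ = 1 ∨ σ = -1) ∧ c = σ * a := by
  rcases eq_or_eq_neg_of_abs_eq h with h | h
  · exact ⟨1, Or.inl rfl, by rw [h, one_mul]⟩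
  · exact ⟨-1, Or.inr rfl, by rw [h]; ring⟩

/-- The other coordinates are strictly below R and one of them is strictly above r. These conditions
persist nearby in space and time, so only the comparison of σ x_i with R can change. -/
theorem eventually_mem_sponge_iff_outer {r R : ℝ → ℝ} {t : ℝ} (hr : ContinuousAt r t)
    (hR : ContinuousAt R t) (h0 : 0 < r t) (h1 : r t < R t) {σ : ℝ} (hσ : σ = 1 ∨ σ = -1)
    {i j : Fin 3} (hij : j ≠ i) {x : E3} (hi : x i = σ * R t) (hlt : ∀ m, m ≠ i → |x m| < R t)
    (hj : r t < |x j|) :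
    ∀ᶠ q : E3 × ℝ in 𝓝 (x, t), (q.1 ∈ sponge (r q.2) (R q.2) ↔ σ * q.1 i - R q.2 < 0) := by
  have hσ2 : σ * σ = 1 := by rcases hσ with rfl | rfl <;> norm_num
  have cr : ContinuousAt (fun q : E3 × ℝ => r q.2) (x, t) := hr.comp continuousAt_snd
  have cR : ContinuousAt (fun q : E3 × ℝ => R q.2) (x, t) := hR.comp continuousAt_snd
  have cx : ∀ m, ContinuousAt (fun q : E3 × ℝ => |q.1 m|) (x, t) := fun m => by fun_prop
  have cs : ContinuousAt (fun q : E3 × ℝ => σ * q.1 i) (x, t) := by fun_prop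
  have e1 : ∀ᶠ q : E3 × ℝ in 𝓝 (x, t), ∀ m, m ≠ i → |q.1 m| < R q.2 := by
    rw [eventually_all]
    intro m
    by_cases hm : m = i
    · simp [hm]
    · filter_upwards [(cx m).eventually_lt cR (hlt m hm)] with q hq _ using hq
  have e3 : r t < σ * x i := by rw [hi, ← mul_assoc, hσ2, one_mul]; exact h1
  have e4 : 0 < σ * x i := h0.trans e3
  filter_upwards [e1, cr.eventually_lt (cx j) hj, cr.eventually_lt cs e3,
    continuousAt_const.eventually_lt cs e4] with q q1 q2 q3 q4
  have habs : |q.1 i| = σ * q.1 i := by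
    rcases hσ with rfl | rfl
    · rw [abs_of_pos (by linarith), one_mul]
    · rw [abs_of_neg (by linarith)]; ring
  constructor
  · intro hq; have := hq.1 i; linarith
  · intro hq
    refine ⟨fun m => ?_, i, j, hij.symm, by linarith, q2⟩
    by_cases hm : m = i
    · rw [hm]; linarith
    · exact q1 m hm

/-- Coordinate j stays above r and k stays below it, so there are two large coordinates exactly when
the i-th is one of them. -/
theorem eventually_mem_sponge_iff_inner {r R : ℝ → ℝ} {t : ℝ} (hr : ContinuousAt r t)
    (hR : ContinuousAt R t) (h0 : 0 < r t) (h1 : r t < R t) {σ : ℝ} (hσ : σ = 1 ∨ σ = -1)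
    {i j k : Fin 3} (hij : j ≠ i) (hik : k ≠ i) (hjk : j ≠ k) {x : E3} (hi : x i = σ * r t)
    (hj : r t < |x j|) (hj' : |x j| < R t) (hk : |x k| < r t) :
    ∀ᶠ q : E3 × ℝ in 𝓝 (x, t), (q.1 ∈ sponge (r q.2) (R q.2) ↔ r q.2 - σ * q.1 i < 0) := by
  have hσ2 : σ * σ = 1 := by rcases hσ with rfl | rfl <;> norm_num
  have cr : ContinuousAt (fun q : E3 × ℝ => r q.2) (x, t) := hr.comp continuousAt_snd
  have cR : ContinuousAt (fun q : E3 × ℝ => R q.2) (x, t) := hR.comp continuousAt_snd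
  have cx : ∀ m, ContinuousAt (fun q : E3 × ℝ => |q.1 m|) (x, t) := fun m => by fun_prop
  have cs : ContinuousAt (fun q : E3 × ℝ => σ * q.1 i) (x, t) := by fun_prop
  have e3 : σ * x i < R t := by rw [hi, ← mul_assoc, hσ2, one_mul]; exact h1
  have e4 : 0 < σ * x i := by rw [hi, ← mul_assoc, hσ2, one_mul]; exact h0
  filter_upwards [cr.eventually_lt (cx j) hj, (cx j).eventually_lt cR hj', cs.eventually_lt cR e3,
    continuousAt_const.eventually_lt cs e4, (cx k).eventually_lt cr hk,
    (cx k).eventually_lt cR (hk.trans h1)] with q q1 q2 q3 q4 q5 q6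
  have habs : |q.1 i| = σ * q.1 i := by
    rcases hσ with rfl | rfl
    · rw [abs_of_pos (by linarith), one_mul]
    · rw [abs_of_neg (by linarith)]; ring
  have hm : ∀ m, m = i ∨ m = j ∨ m = k := by
    intro m; omega
  constructor
  · rintro ⟨-, a, b, hab, ha, hb⟩
    have key : r q.2 < |q.1 i| := by
      rcases hm a with rfl | rfl | rfl
      · exact ha
      · rcases hm b with rfl | rfl | rfl
        · exact hb
        · exact absurd rfl hab
        · linarith
      · linarith
    linarith
  · intro hq
    refine ⟨fun m => ?_, i, j, hij.symm, by linarith, q1⟩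
    rcases hm m with rfl | rfl | rfl
    · linarith
    · exact q2
    · exact q6

theorem hasFDerivAt_moving_plane {f : ℝ → ℝ} {f' t σ : ℝ} (hf : HasDerivAt f f' t) (i : Fin 3)
    (x : E3) :
    HasFDerivAt (fun q : E3 × ℝ => σ * q.1 i - σ * f q.2)
      ((innerSL ℝ (σ • EuclideanSpace.single i (1 : ℝ) : E3)).coprod
        (ContinuousLinearMap.toSpanSingleton ℝ (-(σ * f')))) (x, t) := by
  have h1 : HasFDerivAt (fun q : E3 × ℝ => σ * q.1 i)
      (σ • ((EuclideanSpace.proj (𝕜 := ℝ) i : E3 →L[ℝ] ℝ).comp (ContinuousLinearMap.fst ℝ E3 ℝ)))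
      (x, t) :=
    ((EuclideanSpace.proj (𝕜 := ℝ) i : E3 →L[ℝ] ℝ).comp
      (ContinuousLinearMap.fst ℝ E3 ℝ)).hasFDerivAt.const_mul σ
  have h2 : HasFDerivAt (fun q : E3 × ℝ => σ * f q.2)
      (σ • ((ContinuousLinearMap.toSpanSingleton ℝ f').comp (ContinuousLinearMap.snd ℝ E3 ℝ)))
      (x, t) :=
    (HasFDerivAt.comp (x, t) hf.hasFDerivAt hasFDerivAt_snd).const_mul σ
  refine (h1.sub h2).congr_fderiv (ContinuousLinearMap.ext fun v => ?_)
  simp [EuclideanSpace.inner_single_left]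
  ring

theorem norm_smul_single {σ : ℝ} (hσ : σ = 1 ∨ σ = -1) (i : Fin 3) :
    ‖(σ • EuclideanSpace.single i (1 : ℝ) : E3)‖ = 1 := by
  rw [norm_smul]; rcases hσ with rfl | rfl <;> simp

/-- A set that near `(x, t)` is the half-space `{σ x_i < σ f(s)}` has normal `σ e_i` and normal
velocity `σ f'(t)`. -/
theorem hasNormalVelocity_of_eventually {A : ℝ → Set E3} {f : ℝ → ℝ} {f' t σ : ℝ} {i : Fin 3}
    {x : E3} (hf : HasDerivAt f f' t) (hσ : σ = 1 ∨ σ = -1) (hx : x i = f t)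
    (h : ∀ᶠ q : E3 × ℝ in 𝓝 (x, t), (q.1 ∈ A q.2 ↔ σ * q.1 i - σ * f q.2 < 0)) :
    HasNormalVelocity A t x (σ • EuclideanSpace.single i 1) (σ * f') := by
  refine ⟨_, _, _, ?_, ?_, hasFDerivAt_moving_plane hf i x, h, ?_, ?_⟩
  · simp [hx]
  · intro h0
    have := norm_smul_single hσ i
    rw [h0, norm_zero] at this; exact one_ne_zero this.symm
  · rw [norm_smul_single hσ]; simp
  · rw [norm_smul_single hσ]; simp

theorem HasNormalVelocity.isOuterNormal {A : ℝ → Set E3} {t V : ℝ} {x ν : E3}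
    (h : HasNormalVelocity A t x ν V) : IsOuterNormal (A t) x ν := by
  obtain ⟨ψ, p, τ, h0, hp, hd, hE, hν, -⟩ := h
  refine ⟨fun y => ψ (y, t), p, h0, ?_, hp, ?_, hν⟩
  · have h1 : HasFDerivAt (fun y : E3 => (y, t)) (ContinuousLinearMap.inl ℝ E3 ℝ) x :=
      hasFDerivAt_prodMk_left x t
    have h2 := HasFDerivAt.comp x hd h1
    refine h2.congr_fderiv ?_
    ext v; simp
  · exact (by fun_prop : Continuous fun y : E3 => (y, t)).continuousAt.eventually hE

theorem HasNormalVelocity.unique {A : ℝ → Set E3} {t V V' : ℝ} {x ν ν' : E3}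
    (h : HasNormalVelocity A t x ν V) (h' : HasNormalVelocity A t x ν' V') : ν = ν' ∧ V = V' := by
  refine ⟨h.isOuterNormal.unique h'.isOuterNormal, ?_⟩
  obtain ⟨ψ, p, τ, h0, hp, hd, hE, -, rfl⟩ := h
  obtain ⟨ψ', p', τ', h0', hp', hd', hE', -, rfl⟩ := h'
  have hne : ∀ {p : E3} {τ : ℝ}, p ≠ 0 →
      (innerSL ℝ p).coprod (ContinuousLinearMap.toSpanSingleton ℝ τ) ≠ 0 := fun {p τ} hp h => by
    have := congrArg (fun f : E3 × ℝ →L[ℝ] ℝ => f (p, 0)) h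
    simp at this; exact hp this
  obtain ⟨c, hc, he⟩ := exists_smul_of_neg_iff hd hd' h0 h0' (hne hp) (hne hp')
    ((hE.and hE').mono fun y hy => hy.1.symm.trans hy.2)
  have hτ : τ' = c * τ := by
    have := congrArg (fun f : E3 × ℝ →L[ℝ] ℝ => f (0, 1)) he
    simpa using this
  have hpp : p' = c • p := by
    refine ext_inner_right ℝ fun v => ?_
    have := congrArg (fun f : E3 × ℝ →L[ℝ] ℝ => f (v, 0)) he
    simpa [inner_smul_left] using this
  rw [hpp, hτ, norm_smul, Real.norm_eq_abs, abs_of_pos hc, ← mul_neg, mul_div_mul_left _ _ hc.ne']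

/-- Almost every point of a facet of a moving sponge moves with the facet. -/
theorem ae_hasNormalVelocity_sponge {r R : ℝ → ℝ} {t r' R' : ℝ} (h0 : 0 < r t) (h1 : r t < R t)
    (hr : HasDerivAt r r' t) (hR : HasDerivAt R R' t) (i : Fin 3) {c : ℝ}
    (hc : c ∈ spongeLevels (r t) (R t)) :
    ∀ᵐ y ∂(volume.restrict (spongeFacet (r t) (R t) c)),
      HasNormalVelocity (fun s => sponge (r s) (R s)) t (facetMap i c y)
        (spongeSign (r t) (R t) c • EuclideanSpace.single i 1) (if |c| = R t then R' else -r') := by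
  have hm : MeasurableSet (spongeFacet (r t) (R t) c) := by
    unfold spongeFacet; measurability
  filter_upwards [ae_restrict_mem hm, ae_restrict_of_ae (ae_abs_ne (r t)),
    ae_restrict_of_ae (ae_abs_ne (R t))] with y ⟨y1, y2, y3, y4⟩ hyr hyR
  have hy1 : |y.1| < R t := lt_of_le_of_ne y1 hyR.1
  have hy2 : |y.2| < R t := lt_of_le_of_ne y2 hyR.2
  have n1 := fin_three_add_one_ne i
  have n2 := fin_three_add_two_ne i
  have n3 : i + 1 ≠ i + 2 := by clear * -; decide +revert
  rcases (mem_spongeLevels h0 h1).1 hc with hcR | hcr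
  · obtain ⟨σ, hσ, rfl⟩ := exists_sign_mul_of_abs_eq hcR
    have hσ2 : σ * σ = 1 := by rcases hσ with rfl | rfl <;> norm_num
    rw [spongeSign_outer h0 h1 hσ, if_pos hcR]
    have hlt : ∀ m, m ≠ i → |facetMap i (σ * R t) y m| < R t := fun m hm => by
      rcases fin_three_cases i m with h | h | h
      · exact absurd h hm
      · rw [h, facetMap_one]; exact hy1
      · rw [h, facetMap_two]; exact hy2
    have key : ∀ᶠ q : E3 × ℝ in 𝓝 (facetMap i (σ * R t) y, t),
        (q.1 ∈ sponge (r q.2) (R q.2) ↔ σ * q.1 i - R q.2 < 0) := by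
      rcases y3 with h | h
      · exact eventually_mem_sponge_iff_outer hr.continuousAt hR.continuousAt h0 h1 hσ n1
          (facetMap_self i _ y) hlt (by rw [facetMap_one]; exact lt_of_le_of_ne h hyr.1.symm)
      · exact eventually_mem_sponge_iff_outer hr.continuousAt hR.continuousAt h0 h1 hσ n2
          (facetMap_self i _ y) hlt (by rw [facetMap_two]; exact lt_of_le_of_ne h hyr.2.symm)
    have := hasNormalVelocity_of_eventually (A := fun s => sponge (r s) (R s)) (hR.const_mul σ) hσ
      (facetMap_self i (σ * R t) y) (by simpa only [← mul_assoc, hσ2, one_mul] using key)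
    rwa [← mul_assoc, hσ2, one_mul] at this
  · obtain ⟨σ, hσ, rfl⟩ := exists_sign_mul_of_abs_eq hcr
    have hσ2 : σ * σ = 1 := by rcases hσ with rfl | rfl <;> norm_num
    have hcR : |σ * r t| ≠ R t := by rw [hcr]; exact h1.ne
    rw [spongeSign_inner h0 h1 hσ, if_neg hcR]
    have y4' := y4.resolve_left hcR
    have key : ∀ᶠ q : E3 × ℝ in 𝓝 (facetMap i (σ * r t) y, t),
        (q.1 ∈ sponge (r q.2) (R q.2) ↔ r q.2 - σ * q.1 i < 0) := by
      -- At almost every point of an inner facet exactly one of the two free coordinates exceeds r;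
      -- it may be either.
      have c1 : |y.1| < r t → r t < |y.2| → _ := fun a b =>
        eventually_mem_sponge_iff_inner (i := i) (j := i + 2) (k := i + 1) (x := facetMap i (σ * r t) y)
          hr.continuousAt hR.continuousAt h0 h1 hσ n2 n1 n3.symm (facetMap_self i _ y)
          (by rwa [facetMap_two]) (by rwa [facetMap_two]) (by rwa [facetMap_one])
      have c2 : |y.2| < r t → r t < |y.1| → _ := fun a b =>
        eventually_mem_sponge_iff_inner (i := i) (j := i + 1) (k := i + 2) (x := facetMap i (σ * r t) y)
          hr.continuousAt hR.continuousAt h0 h1 hσ n1 n2 n3 (facetMap_self i _ y)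
          (by rwa [facetMap_one]) (by rwa [facetMap_one]) (by rwa [facetMap_two])
      rcases y3 with a | a <;> rcases y4' with b | b
      · exact absurd (le_antisymm b a) hyr.1
      · exact c2 (lt_of_le_of_ne b hyr.2) (lt_of_le_of_ne a hyr.1.symm)
      · exact c1 (lt_of_le_of_ne b hyr.1) (lt_of_le_of_ne a hyr.2.symm)
      · exact absurd (le_antisymm b a) hyr.2
    have hσ' : -σ = 1 ∨ -σ = -1 := by rcases hσ with rfl | rfl <;> simp
    have := hasNormalVelocity_of_eventually (A := fun s => sponge (r s) (R s)) (hr.const_mul σ) hσ'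
      (facetMap_self i (σ * r t) y) (by
        refine key.mono fun q hq => hq.trans ?_
        have : -σ * q.1 i - -σ * (σ * r q.2) = r q.2 - σ * q.1 i := by
          linear_combination r q.2 * hσ2
        rw [this])
    rwa [← mul_assoc, neg_mul, hσ2, neg_mul, one_mul] at this

/-- Outer facets are squares with a square hole; each level ±r carries four rectangles, the walls of
tunnels along the two other axes. The normals are read off from the moving case with constant radii.
-/
theorem hasFacets_sponge {r R : ℝ} (hr : 0 < r) (hR : r < R) :
    HasFacets (sponge r R) (spongeLevels r R) (spongeFacet r R) (spongeSign r R) where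
  frontier_eq := by
    ext x
    simp only [Set.mem_ofPred_eq, mem_spongeLevels hr hR]
    constructor
    · intro hx
      have hle := ((mem_frontier_sponge hr hR).1 hx).1.1
      have hor : ∀ {i j : Fin 3}, i ≠ j → r ≤ |x j| → r ≤ |x (i + 1)| ∨ r ≤ |x (i + 2)| :=
        fun {i j} hij hj => by
          rcases fin_three_cases i j with h | h | h
          · exact absurd h.symm hij
          · exact Or.inl (h ▸ hj)
          · exact Or.inr (h ▸ hj)
      rcases frontier_sponge_cases hr hR hx with ⟨i, j, hij, hi, hj⟩ |
        ⟨-, i, j, k, hij, hik, hjk, hi, hj, hk⟩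
      · exact ⟨i, Or.inl hi, hle _, hle _, hor hij hj, Or.inl hi⟩
      · refine ⟨i, Or.inr hi, hle _, hle _, hor hij hj, Or.inr ?_⟩
        rcases fin_three_cases i k with h | h | h
        · exact absurd h.symm hik
        · exact Or.inl (h ▸ hk)
        · exact Or.inr (h ▸ hk)
    · rintro ⟨i, hi, y1, y2, y3, y4⟩
      simp only at y1 y2 y3 y4
      have n1 := (fin_three_add_one_ne i).symm
      have n2 := (fin_three_add_two_ne i).symm
      have n3 : i + 1 ≠ i + 2 := by clear * -; decide +revert
      have hle : ∀ m, |x m| ≤ R := fun m => by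
        rcases fin_three_cases i m with h | h | h
        · rw [h]; rcases hi with hi | hi <;> linarith
        · rwa [h]
        · rwa [h]
      by_cases hiR : |x i| = R
      · rcases y3 with h | h
        · exact mem_frontier_sponge_outer hr hR hle n1 hiR h
        · exact mem_frontier_sponge_outer hr hR hle n2 hiR h
      · have hir := hi.resolve_left hiR
        have y4' := y4.resolve_left hiR
        by_cases h1 : |x (i + 1)| ≤ r
        · by_cases h2 : r ≤ |x (i + 2)|
          · exact mem_frontier_sponge_inner hr hR hle n2 n1 n3.symm hir h2 h1
          · exact mem_frontier_sponge_inner hr hR hle n1 n2 n3 hir (y3.resolve_right h2)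
              (not_le.1 h2).le
        · exact mem_frontier_sponge_inner hr hR hle n1 n2 n3 hir (not_le.1 h1).le
            (y4'.resolve_left h1)
  measurableSet := fun c _ => by unfold spongeFacet; measurability
  symm := fun c a b => by simp only [spongeFacet, Set.mem_ofPred_eq]; tauto
  bounded := ⟨R, fun c _ y hy => ⟨abs_le.1 hy.1, abs_le.1 hy.2.1⟩⟩
  sign := fun c _ => by unfold spongeSign; split_ifs <;> simp
  normal := fun i c hc => by
    filter_upwards [ae_hasNormalVelocity_sponge (r := fun _ => r) (R := fun _ => R) (t := 0) hr hR
      (hasDerivAt_const _ _) (hasDerivAt_const _ _) i hc] with y hy using hy.isOuterNormal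

end Sponge
end

noncomputable section
namespace Sponge

/-! ### Planar slices -/

/-- With ζ affine and η its slope, the integrand is the derivative of G - σ ζ F. The profiles are
prescribed only on the open interval because η may jump where pieces meet. -/
theorem integral_edge {a b za zb σ : ℝ} (hab : a < b) {F F' G' G ζ η : ℝ → ℝ}
    (hF' : Continuous F') (hG' : Continuous G') (hF : ∀ x, HasDerivAt F (F' x) x)
    (hG : ∀ x, HasDerivAt G (G' x) x)
    (hζ : ∀ x ∈ Set.Ioo a b, ζ x = za + (zb - za) / (b - a) * (x - a))
    (hη : ∀ x ∈ Set.Ioo a b, η x = (zb - za) / (b - a)) :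
    IntegrableOn (fun x => G' x - σ * (ζ x * F' x) - σ * (η x * F x)) (Set.Ioo a b) ∧
    ∫ x in Set.Ioo a b, (G' x - σ * (ζ x * F' x) - σ * (η x * F x)) =
      (G b - σ * zb * F b) - (G a - σ * za * F a) := by
  set β := (zb - za) / (b - a) with hβ
  have hFc : Continuous F := continuous_iff_continuousAt.2 fun x => (hF x).continuousAt
  have hcont : Continuous fun x => G' x - σ * ((za + β * (x - a)) * F' x) - σ * (β * F x) := by
    fun_prop
  have heq : Set.EqOn (fun x => G' x - σ * ((za + β * (x - a)) * F' x) - σ * (β * F x))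
      (fun x => G' x - σ * (ζ x * F' x) - σ * (η x * F x)) (Set.Ioo a b) := fun x hx => by
    simp only [hζ x hx, hη x hx]
  have hd : ∀ x, HasDerivAt (fun x => G x - σ * ((za + β * (x - a)) * F x))
      (G' x - σ * ((za + β * (x - a)) * F' x) - σ * (β * F x)) x := fun x => by
    have h1 : HasDerivAt (fun x : ℝ => za + β * (x - a)) β x := by
      simpa using (((hasDerivAt_id x).sub_const a).const_mul β).const_add za
    refine ((hG x).sub ((h1.mul (hF x)).const_mul σ)).congr_deriv ?_
    ring
  constructor
  · refine IntegrableOn.congr_fun ?_ heq measurableSet_Ioo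
    exact (hcont.integrableOn_Icc (a := a) (b := b)).mono_set Set.Ioo_subset_Icc_self
  · rw [← setIntegral_congr_fun measurableSet_Ioo heq, ← integral_Ioc_eq_integral_Ioo,
      ← intervalIntegral.integral_of_le hab.le,
      intervalIntegral.integral_eq_sub_of_hasDerivAt (fun x _ => hd x)
        (hcont.intervalIntegrable _ _)]
    have : β * (b - a) = zb - za := by
      rw [hβ]; field_simp [sub_ne_zero.2 hab.ne']
    linear_combination (-σ * F b) * this

/-- The Cahn-Hoffman profile of the sponge in slices consisting of four squares. -/
def squareProfile (r R b : ℝ) : ℝ :=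
  if b < 0 then -(2 * (-b - r) / (R - r) - 1) else 2 * (b - r) / (R - r) - 1

/-- The Cahn-Hoffman profile of the sponge on the outer edges of slices which are annuli. -/
def annulusProfile (r R b : ℝ) : ℝ :=
  if b < -r then (b + r) / (R - r) else if b ≤ r then 0 else (b - r) / (R - r)

/-- The component of the Cahn-Hoffman field of the sponge in the direction of the first argument. -/
def spongeField (r R b a t : ℝ) : ℝ :=
  if |a| < r ∨ |t| < r then squareProfile r R b
  else if |a| = r ∨ |t| = r then -b / r else annulusProfile r R b

/-- The derivative of `spongeField` in its first argument. -/
def spongeFieldDeriv (r R b a t : ℝ) : ℝ :=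
  if |a| < r ∨ |t| < r then 2 / (R - r)
  else if |a| = r ∨ |t| = r then -1 / r else if |b| ≤ r then 0 else 1 / (R - r)

theorem sum_spongeLevels {r R : ℝ} (hr : 0 < r) (hR : r < R) (f : ℝ → ℝ) :
    ∑ c ∈ spongeLevels r R, f c = f R + f (-R) + f r + f (-r) := by
  have h1 : R ≠ -R := by linarith
  have h2 : R ≠ r := by linarith
  have h3 : R ≠ -r := by linarith
  have h4 : -R ≠ r := by linarith
  have h5 : r ≠ -r := by linarith
  have h6 : -R ≠ -r := by intro h; linarith
  rw [spongeLevels, Finset.sum_insert (by simp [h1, h2, h3]),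
    Finset.sum_insert (by simp only [Finset.mem_insert, Finset.mem_singleton]; tauto),
    Finset.sum_pair h5]
  ring

theorem spongeSign_values {r R : ℝ} (hr : 0 < r) (hR : r < R) :
    spongeSign r R R = 1 ∧ spongeSign r R (-R) = -1 ∧ spongeSign r R r = -1 ∧
      spongeSign r R (-r) = 1 := by
  have h1 := spongeSign_outer hr hR (Or.inl rfl : (1 : ℝ) = 1 ∨ (1 : ℝ) = -1)
  have h2 := spongeSign_outer hr hR (Or.inr rfl : (-1 : ℝ) = 1 ∨ (-1 : ℝ) = -1)
  have h3 := spongeSign_inner hr hR (Or.inl rfl : (1 : ℝ) = 1 ∨ (1 : ℝ) = -1)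
  have h4 := spongeSign_inner hr hR (Or.inr rfl : (-1 : ℝ) = 1 ∨ (-1 : ℝ) = -1)
  simp only [one_mul, neg_mul, neg_neg] at h1 h2 h3 h4
  exact ⟨h1, h2, h3, h4⟩

theorem setOf_abs_Icc_ae {r R : ℝ} (hr : 0 < r) :
    {b : ℝ | r ≤ |b| ∧ |b| ≤ R} =ᵐ[volume] (Set.Ioo (-R) (-r) ∪ Set.Ioo r R : Set ℝ) := by
  have h : {b : ℝ | r ≤ |b| ∧ |b| ≤ R} = (Set.Icc (-R) (-r) ∪ Set.Icc r R : Set ℝ) := by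
    ext b
    simp only [Set.mem_ofPred_eq, Set.mem_union, Set.mem_Icc, le_abs, abs_le]
    constructor
    · rintro ⟨h1 | h1, h2, h3⟩
      · exact Or.inr ⟨h1, h3⟩
      · exact Or.inl ⟨h2, by linarith⟩
    · rintro (⟨h1, h2⟩ | ⟨h1, h2⟩)
      · exact ⟨Or.inr (by linarith), h1, by linarith⟩
      · exact ⟨Or.inl h1, by linarith, h2⟩
  rw [h]
  exact (Ioo_ae_eq_Icc.symm).union Ioo_ae_eq_Icc.symm

theorem setOf_abs_le_ae (r : ℝ) : {b : ℝ | |b| ≤ r} =ᵐ[volume] (Set.Ioo (-r) r : Set ℝ) := by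
  have h : {b : ℝ | |b| ≤ r} = Set.Icc (-r) r := by ext b; simp [abs_le]
  rw [h]; exact Ioo_ae_eq_Icc.symm

section slices

variable {r R t : ℝ} {F F₂ G G₂ : ℝ → ℝ → ℝ}

/-- For |t| < r the two large coordinates must be the two free ones, so the slice consists of four
squares of side R - r. On each edge ζ rises from -1 to 1, the normals of the edges met at its ends.
-/
theorem integral_edge_squares (hr : 0 < r) (hR : r < R) (ht : |t| < r)
    (cF₂ : Continuous (Function.uncurry F₂)) (cG₂ : Continuous (Function.uncurry G₂))
    (hF₂ : ∀ a b, HasDerivAt (F a) (F₂ a b) b) (hG₂ : ∀ a b, HasDerivAt (G a) (G₂ a b) b)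
    {c : ℝ} (σ : ℝ) :
    ∫ b in {b | (b, t) ∈ spongeFacet r R c}, (G₂ c b - σ * (spongeField r R b c t * F₂ c b) -
      σ * (spongeFieldDeriv r R b c t * F c b)) =
    G c R - G c r + G c (-r) - G c (-R) - σ * (F c R + F c r + F c (-r) + F c (-R)) := by
  have hs : {b | (b, t) ∈ spongeFacet r R c} = {b | r ≤ |b| ∧ |b| ≤ R} := by
    ext b
    simp only [spongeFacet, Set.mem_ofPred_eq]
    constructor
    · rintro ⟨h1, -, h3 | h3, -⟩
      · exact ⟨h3, h1⟩
      · linarith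
    · rintro ⟨h1, h2⟩
      exact ⟨h2, by linarith, Or.inl h1, Or.inr (Or.inr ht.le)⟩
  have hRr : R - r ≠ 0 := by linarith
  have cF : Continuous (F₂ c) := cF₂.comp (by fun_prop : Continuous fun b : ℝ => (c, b))
  have cG : Continuous (G₂ c) := cG₂.comp (by fun_prop : Continuous fun b : ℝ => (c, b))
  obtain ⟨i1, e1⟩ := integral_edge (a := r) (b := R) (za := -1) (zb := 1) (σ := σ)
    (ζ := fun b => spongeField r R b c t) (η := fun b => spongeFieldDeriv r R b c t) hR cF cG (hF₂ c)
    (hG₂ c) (fun b hb => by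
      have hb1 : ¬ b < 0 := by linarith [hb.1]
      simp only [spongeField, ht, or_true, if_true, squareProfile, hb1, if_false]
      ring) (fun b hb => by
      simp only [spongeFieldDeriv, ht, or_true, if_true]; ring)
  obtain ⟨i2, e2⟩ := integral_edge (a := -R) (b := -r) (za := -1) (zb := 1) (σ := σ)
    (ζ := fun b => spongeField r R b c t) (η := fun b => spongeFieldDeriv r R b c t)
    (by linarith) cF cG (hF₂ c)
    (hG₂ c) (fun b hb => by
      have hb1 : b < 0 := by linarith [hb.2]
      have : -r - -R ≠ 0 := by intro h; apply hRr; linarith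
      simp only [spongeField, ht, or_true, if_true, squareProfile, hb1]
      field_simp; ring) (fun b hb => by
      have : -r - -R = R - r := by ring
      simp only [spongeFieldDeriv, ht, or_true, if_true, this]; ring)
  rw [hs, setIntegral_congr_set (setOf_abs_Icc_ae hr), setIntegral_union
    (Set.disjoint_left.2 fun b hb hb' => by linarith [hb.2, hb'.1]) measurableSet_Ioo i2 i1]
  rw [e1, e2]; ring

/-- For |t| > r one large coordinate is already present, so the slice is a square annulus. On an
outer edge ζ rises from -1 to 1 but stays 0 on [-r, r]: at those points of the facet the slices in
the other direction already supply the whole divergence 2 / (R - r). -/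
theorem integral_edge_annulus_outer (hr : 0 < r) (hR : r < R) (ht : r < |t|) (ht' : |t| ≤ R)
    (cF₂ : Continuous (Function.uncurry F₂)) (cG₂ : Continuous (Function.uncurry G₂))
    (hF₂ : ∀ a b, HasDerivAt (F a) (F₂ a b) b) (hG₂ : ∀ a b, HasDerivAt (G a) (G₂ a b) b)
    {c : ℝ} (σ : ℝ) (hc : |c| = R) :
    ∫ b in {b | (b, t) ∈ spongeFacet r R c}, (G₂ c b - σ * (spongeField r R b c t * F₂ c b) -
      σ * (spongeFieldDeriv r R b c t * F c b)) =
    G c R - G c (-R) - σ * (F c R + F c (-R)) := by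
  have hs : {b | (b, t) ∈ spongeFacet r R c} = {b | |b| ≤ R} := by
    ext b
    simp only [spongeFacet, Set.mem_ofPred_eq]
    exact ⟨fun h => h.1, fun h => ⟨h, ht', Or.inr ht.le, Or.inl hc⟩⟩
  have hRr : R - r ≠ 0 := by linarith
  have cF : Continuous (F₂ c) := cF₂.comp (by fun_prop : Continuous fun b : ℝ => (c, b))
  have cG : Continuous (G₂ c) := cG₂.comp (by fun_prop : Continuous fun b : ℝ => (c, b))
  have n1 : ¬ (|c| < r ∨ |t| < r) := by rw [hc]; rintro (h | h) <;> linarith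
  have n2 : ¬ (|c| = r ∨ |t| = r) := by rw [hc]; rintro (h | h) <;> linarith
  have hz : ∀ b, spongeField r R b c t = annulusProfile r R b := fun b => by
    rw [spongeField, if_neg n1, if_neg n2]
  have hy : ∀ b, spongeFieldDeriv r R b c t = if |b| ≤ r then 0 else 1 / (R - r) := fun b => by
    rw [spongeFieldDeriv, if_neg n1, if_neg n2]
  obtain ⟨i1, e1⟩ := integral_edge (a := r) (b := R) (za := 0) (zb := 1) (σ := σ)
    (ζ := fun b => spongeField r R b c t) (η := fun b => spongeFieldDeriv r R b c t) hR cF cG (hF₂ c)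
    (hG₂ c) (fun b hb => by
      have hb1 : ¬ b < -r := by linarith [hb.1]
      have hb2 : ¬ b ≤ r := by linarith [hb.1]
      simp only [hz, annulusProfile, hb1, hb2, if_false]
      ring) (fun b hb => by
      have : ¬ |b| ≤ r := by rw [not_le, lt_abs]; exact Or.inl hb.1
      simp only [hy, this, if_false]; ring)
  obtain ⟨i2, e2⟩ := integral_edge (a := -R) (b := -r) (za := -1) (zb := 0) (σ := σ)
    (ζ := fun b => spongeField r R b c t) (η := fun b => spongeFieldDeriv r R b c t)
    (by linarith) cF cG (hF₂ c)
    (hG₂ c) (fun b hb => by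
      have : -r - -R ≠ 0 := by intro h; apply hRr; linarith
      have hb1 : b < -r := hb.2
      simp only [hz, annulusProfile, hb1, if_true]
      field_simp; ring) (fun b hb => by
      have h1 : -r - -R = R - r := by ring
      have : ¬ |b| ≤ r := by rw [not_le, lt_abs]; exact Or.inr (by linarith [hb.2])
      simp only [hy, this, if_false, h1]; ring)
  obtain ⟨i3, e3⟩ := integral_edge (a := -r) (b := r) (za := 0) (zb := 0) (σ := σ)
    (ζ := fun b => spongeField r R b c t) (η := fun b => spongeFieldDeriv r R b c t)
    (by linarith) cF cG (hF₂ c)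
    (hG₂ c) (fun b hb => by
      have hb1 : ¬ b < -r := by linarith [hb.1]
      have hb2 : b ≤ r := hb.2.le
      simp only [hz, annulusProfile, hb1, hb2, if_true, if_false]
      ring) (fun b hb => by
      have : |b| ≤ r := (abs_lt.2 hb).le
      simp only [hy, this, if_true]; ring)
  have hset : {b : ℝ | |b| ≤ R} =ᵐ[volume]
      (Set.Ioo (-R) (-r) ∪ (Set.Ioo (-r) r ∪ Set.Ioo r R) : Set ℝ) := by
    have h : {b : ℝ | |b| ≤ R} = {b : ℝ | r ≤ |b| ∧ |b| ≤ R} ∪ {b : ℝ | |b| ≤ r} := by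
      ext b
      simp only [Set.mem_ofPred_eq, Set.mem_union]
      constructor
      · intro h; rcases le_total r |b| with h' | h'
        · exact Or.inl ⟨h', h⟩
        · exact Or.inr h'
      · rintro (h | h)
        · exact h.2
        · linarith
    rw [h]
    refine ((setOf_abs_Icc_ae hr).union (setOf_abs_le_ae r)).trans (Filter.EventuallyEq.of_eq ?_)
    rw [Set.union_assoc, Set.union_comm (Set.Ioo r R)]
  rw [hs, setIntegral_congr_set hset, setIntegral_union _
      (measurableSet_Ioo.union measurableSet_Ioo) i2 (i3.union i1), setIntegral_union _
      measurableSet_Ioo i3 i1]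
  · rw [e1, e2, e3]; ring
  · exact Set.disjoint_left.2 fun b hb hb' => by linarith [hb.2, hb'.1]
  · refine Set.disjoint_left.2 fun b hb hb' => ?_
    rcases hb' with hb' | hb' <;> linarith [hb.2, hb'.1]

/-- Around the hole the outer normals point inwards, so on an inner edge ζ falls from 1 to -1. The
resulting slope -1 / r is what makes the curvature of the inner facets change sign at R = 3r. -/
theorem integral_edge_annulus_inner (hr : 0 < r) (hR : r < R) (ht : r < |t|) (ht' : |t| ≤ R)
    (cF₂ : Continuous (Function.uncurry F₂)) (cG₂ : Continuous (Function.uncurry G₂))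
    (hF₂ : ∀ a b, HasDerivAt (F a) (F₂ a b) b) (hG₂ : ∀ a b, HasDerivAt (G a) (G₂ a b) b)
    {c : ℝ} (σ : ℝ) (hc : |c| = r) :
    ∫ b in {b | (b, t) ∈ spongeFacet r R c}, (G₂ c b - σ * (spongeField r R b c t * F₂ c b) -
      σ * (spongeFieldDeriv r R b c t * F c b)) =
    G c r - G c (-r) + σ * (F c r + F c (-r)) := by
  have hs : {b | (b, t) ∈ spongeFacet r R c} = {b | |b| ≤ r} := by
    ext b
    simp only [spongeFacet, Set.mem_ofPred_eq]
    constructor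
    · rintro ⟨-, -, -, h | h | h⟩ <;> linarith
    · intro h; exact ⟨by linarith, ht', Or.inr ht.le, Or.inr (Or.inl h)⟩
  have cF : Continuous (F₂ c) := cF₂.comp (by fun_prop : Continuous fun b : ℝ => (c, b))
  have cG : Continuous (G₂ c) := cG₂.comp (by fun_prop : Continuous fun b : ℝ => (c, b))
  have n1 : ¬ (|c| < r ∨ |t| < r) := by rw [hc]; rintro (h | h) <;> linarith
  have n3 : r - -r ≠ 0 := by linarith
  obtain ⟨i1, e1⟩ := integral_edge (a := -r) (b := r) (za := 1) (zb := -1) (σ := σ)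
    (ζ := fun b => spongeField r R b c t) (η := fun b => spongeFieldDeriv r R b c t)
    (by linarith) cF cG (hF₂ c)
    (hG₂ c) (fun b hb => by
      simp only [spongeField]
      rw [if_neg n1, if_pos (Or.inl hc)]
      field_simp; ring) (fun b hb => by
      simp only [spongeFieldDeriv]
      rw [if_neg n1, if_pos (Or.inl hc)]
      field_simp; ring)
  rw [hs, setIntegral_congr_set (setOf_abs_le_ae r)]
  rw [e1]; ring

/-- At a corner of the slice each component of the field equals the sign of the edge it is normal
to; hence the end terms of the two families of edges cancel corner by corner. -/
theorem sliceIdentity_sponge (hr : 0 < r) (hR : r < R) (h1 : |t| ≠ r) :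
    SliceIdentity (spongeLevels r R) (spongeFacet r R) (spongeSign r R) (spongeField r R)
      (spongeFieldDeriv r R) t := by
  intro F F₁ F₂ G G₁ G₂ cF₁ cF₂ cG₁ cG₂ hF₁ hF₂ hG₁ hG₂
  obtain ⟨s1, s2, s3, s4⟩ := spongeSign_values hr hR
  have aR : |R| = R := abs_of_pos (hr.trans hR)
  have ar : |r| = r := abs_of_pos hr
  have swap : ∀ {f : ℝ → ℝ → ℝ}, Continuous (Function.uncurry f) →
      Continuous (Function.uncurry fun c a => f a c) := fun {f} hf => hf.comp continuous_swap
  rw [edgeSum, edgeSum, sum_spongeLevels hr hR, sum_spongeLevels hr hR, s1, s2, s3, s4]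
  by_cases ht : |t| ≤ R
  · rcases lt_or_gt_of_ne h1 with h | h
    · rw [integral_edge_squares hr hR h cF₂ cG₂ hF₂ hG₂,
        integral_edge_squares hr hR h cF₂ cG₂ hF₂ hG₂,
        integral_edge_squares hr hR h cF₂ cG₂ hF₂ hG₂,
        integral_edge_squares hr hR h cF₂ cG₂ hF₂ hG₂]
      have key := fun c σ => integral_edge_squares (F := fun c a => G a c) (F₂ := fun c a => G₁ a c)
        (G := fun c a => F a c) (G₂ := fun c a => F₁ a c) hr hR h (swap cG₁) (swap cF₁)
        (fun a b => hG₁ b a) (fun a b => hF₁ b a) (c := c) σ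
      rw [key, key, key, key]; ring
    · have e1 := fun c σ => integral_edge_annulus_outer hr hR h ht cF₂ cG₂ hF₂ hG₂ (c := c) σ
      have e2 := fun c σ => integral_edge_annulus_inner hr hR h ht cF₂ cG₂ hF₂ hG₂ (c := c) σ
      have e3 := fun c σ => integral_edge_annulus_outer (F := fun c a => G a c)
        (F₂ := fun c a => G₁ a c)
        (G := fun c a => F a c) (G₂ := fun c a => F₁ a c) hr hR h ht (swap cG₁) (swap cF₁)
        (fun a b => hG₁ b a) (fun a b => hF₁ b a) (c := c) σ
      have e4 := fun c σ => integral_edge_annulus_inner (F := fun c a => G a c)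
        (F₂ := fun c a => G₁ a c)
        (G := fun c a => F a c) (G₂ := fun c a => F₁ a c) hr hR h ht (swap cG₁) (swap cF₁)
        (fun a b => hG₁ b a) (fun a b => hF₁ b a) (c := c) σ
      have aR' : |-R| = R := by rw [abs_neg, aR]
      have ar' : |-r| = r := by rw [abs_neg, ar]
      rw [e1 _ _ aR, e1 _ _ aR', e2 _ _ ar, e2 _ _ ar', e3 _ _ aR, e3 _ _ aR', e4 _ _ ar,
        e4 _ _ ar']
      ring
  · have hs : ∀ c, {b | (b, t) ∈ spongeFacet r R c} = ∅ := fun c => by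
      ext b; simp only [spongeFacet, Set.mem_ofPred_eq, Set.mem_empty_iff_false, iff_false]
      exact fun h => ht h.2.1
    simp [hs]

end slices

/-- The curvature of the facets of the sponge. -/
def spongeLevelCurvature (r R c : ℝ) : ℝ :=
  if |c| = R then -2 / (R - r) else (R - 3 * r) / (r * (R - r))

/-- The branch `|a| = r ∨ |t| = r` of `spongeField` is not negligible: one of these arguments is the
level of the facet itself, so it singles out inner facets. On outer facets the two derivatives are
2/(R-r) and 0 beside the hole, and 1/(R-r) each near the corners; on inner facets they are 2/(R-r)
and -1/r. -/
theorem isFacetField_sponge {r R : ℝ} (hr : 0 < r) (hR : r < R) :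
    IsFacetField (spongeLevels r R) (spongeFacet r R) (spongeSign r R) (spongeLevelCurvature r R)
      (spongeField r R) (spongeFieldDeriv r R) := by
  have hRr : 0 < R - r := by linarith
  obtain ⟨s1, s2, s3, s4⟩ := spongeSign_values hr hR
  have sq : ∀ b, r ≤ |b| → |b| ≤ R → |squareProfile r R b| ≤ 1 := fun b h1 h2 => by
    unfold squareProfile
    split_ifs with h
    · rw [abs_of_neg h] at h1 h2
      rw [abs_neg, abs_le]
      constructor
      · have : 0 ≤ 2 * (-b - r) / (R - r) := div_nonneg (by linarith) hRr.le
        linarith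
      · have : 2 * (-b - r) / (R - r) ≤ 2 := by rw [div_le_iff₀ hRr]; linarith
        linarith
    · rw [abs_of_nonneg (not_lt.1 h)] at h1 h2
      rw [abs_le]
      constructor
      · have : 0 ≤ 2 * (b - r) / (R - r) := div_nonneg (by linarith) hRr.le
        linarith
      · have : 2 * (b - r) / (R - r) ≤ 2 := by rw [div_le_iff₀ hRr]; linarith
        linarith
  have an : ∀ b, |b| ≤ R → |annulusProfile r R b| ≤ 1 := fun b h => by
    obtain ⟨h1, h2⟩ := abs_le.1 h
    unfold annulusProfile
    split_ifs with h3 h4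
    · rw [abs_div, abs_of_pos hRr, div_le_one hRr, abs_of_neg (by linarith)]; linarith
    · simp
    · rw [abs_div, abs_of_pos hRr, div_le_one hRr, abs_of_pos (by linarith)]; linarith
  have hm : ∀ c, MeasurableSet (spongeFacet r R c) := fun c => by
    unfold spongeFacet; measurability
  have bound : ∀ b c t, |c| = R ∨ |c| = r → |t| ≠ r → (b, t) ∈ spongeFacet r R c →
      |spongeField r R b c t| ≤ 1 := fun b c t hc ht ⟨y1, y2, y3, y4⟩ => by
    simp only at y1 y2 y3 y4
    unfold spongeField
    split_ifs with h1 h2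
    · rcases h1 with h1 | h1
      · rcases hc with hc | hc <;> linarith
      · exact sq b (y3.resolve_right (not_le.2 h1)) y1
    · have hcr := h2.resolve_right ht
      have ht' : r < |t| := lt_of_le_of_ne (not_lt.1 fun h => h1 (Or.inr h)) ht.symm
      have hb : |b| ≤ r := by
        rcases y4 with h | h | h
        · linarith
        · exact h
        · linarith
      rw [abs_div, abs_neg, abs_of_pos hr, div_le_one hr]; exact hb
    · exact an b y1
  refine ⟨?_, ?_, ⟨2 / (R - r) + 1 / r, fun b a t => ?_⟩, fun b a t => ?_, fun c hc => ?_,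
    fun c hc => ?_, fun c hc => ?_, ?_⟩
  · unfold spongeField squareProfile annulusProfile
    refine Measurable.ite (by measurability) (Measurable.ite (by measurability) (by fun_prop)
      (by fun_prop)) (Measurable.ite (by measurability) (by fun_prop)
        (Measurable.ite (by measurability) (by fun_prop) (Measurable.ite (by measurability)
          (by fun_prop) (by fun_prop))))
  · unfold spongeFieldDeriv
    refine Measurable.ite (by measurability) (by fun_prop) (Measurable.ite (by measurability)
      (by fun_prop) (Measurable.ite (by measurability) (by fun_prop) (by fun_prop)))
  · have p1 : 0 < 1 / (R - r) := by positivity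
    have p2 : 0 < 1 / r := by positivity
    have p3 : 2 / (R - r) = 2 * (1 / (R - r)) := by ring
    have p4 : -1 / r = -(1 / r) := by ring
    unfold spongeFieldDeriv
    rw [p3, p4, abs_le]
    split_ifs <;> constructor <;> linarith
  · simp only [spongeField, or_comm]
  · filter_upwards [ae_restrict_mem (hm c), ae_restrict_of_ae (ae_abs_ne r)] with y
      ⟨y1, y2, y3, y4⟩ hyr
    have n0 : ¬ R < 0 := by linarith
    have n1 : ¬ r < 0 := by linarith
    have n2 : -R < 0 := by linarith
    have n3 : -r < 0 := by linarith
    have n4 : ¬ R < -r := by linarith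
    have n5 : ¬ R ≤ r := by linarith
    have n6 : -R < -r := by linarith
    have hsq : squareProfile r R c = spongeSign r R c := by
      simp only [spongeLevels, Finset.mem_insert, Finset.mem_singleton] at hc
      rcases hc with rfl | rfl | rfl | rfl <;> simp only [s1, s2, s3, s4, squareProfile, n0, n1, n2,
        n3, if_true, if_false] <;> field_simp <;> ring
    unfold spongeField
    split_ifs with h1 h2
    · exact hsq
    · exact absurd h2 (not_or.2 hyr)
    · have hc' : |c| = R := by
        rcases y4 with h | h | h
        · exact h
        · exact absurd (Or.inl (lt_of_le_of_ne h hyr.1)) h1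
        · exact absurd (Or.inr (lt_of_le_of_ne h hyr.2)) h1
      rcases eq_or_eq_neg_of_abs_eq hc' with rfl | rfl
      · simp only [annulusProfile, n4, n5, if_false, s1]; field_simp
      · simp only [annulusProfile, n6, if_true, s2]; field_simp; ring
  · filter_upwards [ae_restrict_mem (hm c), ae_restrict_of_ae (ae_abs_ne r)] with y hy hyr
    have hc' := (mem_spongeLevels hr hR).1 hc
    exact ⟨bound _ _ _ hc' hyr.2 hy, bound _ _ _ hc' hyr.1
      (((hasFacets_sponge hr hR).symm c y.1 y.2).1 hy)⟩
  · filter_upwards [ae_restrict_mem (hm c), ae_restrict_of_ae (ae_abs_ne r)] with y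
      ⟨y1, y2, y3, y4⟩ hyr
    have key : ∀ a b : ℝ, |a| ≠ r → |b| ≠ r → r ≤ |a| → (|c| = R ∨ |b| ≤ r) →
        spongeFieldDeriv r R a c b + spongeFieldDeriv r R b c a = -spongeLevelCurvature r R c := by
      intro a b ha hb hra hb2
      have a1 : ¬ |a| < r := not_lt.2 hra
      have a2 : ¬ |a| ≤ r := fun h => ha (le_antisymm h hra)
      rcases (mem_spongeLevels hr hR).1 hc with hcR | hcr
      · have c1 : ¬ R < r := by linarith
        have c2 : ¬ R = r := by linarith
        simp only [spongeFieldDeriv, spongeLevelCurvature, hcR, c1, c2, a1, a2, ha, hb, false_or,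
          if_false, if_true]
        by_cases hb3 : |b| < r
        · simp only [hb3, hb3.le, if_true]; ring
        · have hb4 : ¬ |b| ≤ r := fun h => hb3 (lt_of_le_of_ne h hb)
          simp only [hb3, hb4, if_false]; ring
      · have c1 : ¬ r = R := by linarith
        have hb3 : |b| < r := lt_of_le_of_ne (hb2.resolve_left (by rw [hcr]; exact c1)) hb
        simp only [spongeFieldDeriv, spongeLevelCurvature, hcr, lt_irrefl, a1, hb3, or_true, true_or,
          or_false, if_false, if_true, c1]
        field_simp; ring
    rcases y3 with h | h
    · refine key _ _ hyr.1 hyr.2 h ?_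
      rcases y4 with h' | h' | h'
      · exact Or.inl h'
      · exact absurd (le_antisymm h' h) hyr.1
      · exact Or.inr h'
    · rw [add_comm]
      refine key _ _ hyr.2 hyr.1 h ?_
      rcases y4 with h' | h' | h'
      · exact Or.inl h'
      · exact Or.inr h'
      · exact absurd (le_antisymm h' h) hyr.2
  · have h1 : ∀ᵐ t : ℝ, t ≠ r := by simp [ae_iff]
    have h2 : ∀ᵐ t : ℝ, t ≠ -r := by simp [ae_iff]
    filter_upwards [h1, h2] with t h1 h2
    refine sliceIdentity_sponge hr hR fun h => ?_
    rcases eq_or_eq_neg_of_abs_eq h with h | h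
    · exact h1 h
    · exact h2 h

/-- Facets at c and -c have opposite orientation and equal curvature, so an odd φ needs to be fitted
only at R and r. A linear and a cubic term suffice. -/
theorem exists_odd_cubic {r R A B : ℝ} (hr : 0 < r) (hR : r < R) :
    ∃ φ : ℝ → ℝ, ContDiff ℝ ∞ φ ∧ φ R = A ∧ φ r = B ∧ ∀ x, φ (-x) = -φ x := by
  have h : R ^ 2 - r ^ 2 ≠ 0 := by nlinarith
  have hR0 : R ≠ 0 := by linarith
  refine ⟨fun x => (A / R - (A / R - B / r) / (R ^ 2 - r ^ 2) * R ^ 2) * x +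
    (A / R - B / r) / (R ^ 2 - r ^ 2) * x ^ 3, by fun_prop, ?_, ?_, fun x => by ring⟩
  · field_simp; ring
  · field_simp; ring

theorem spongeCurvature_facetMap (r R : ℝ) (i : Fin 3) (c : ℝ) :
    ∀ᵐ y ∂(volume.restrict (spongeFacet r R c)),
      spongeCurvature r R (facetMap i c y) = spongeLevelCurvature r R c := by
  refine ae_restrict_of_ae ?_
  filter_upwards [ae_abs_ne R] with y hy
  have : (∃ m, |facetMap i c y m| = R) ↔ |c| = R := by
    constructor
    · rintro ⟨m, hm⟩
      rcases fin_three_cases i m with h | h | h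
      · rwa [h, facetMap_self] at hm
      · rw [h, facetMap_one] at hm; exact absurd hm hy.1
      · rw [h, facetMap_two] at hm; exact absurd hm hy.2
    · exact fun h => ⟨i, by rwa [facetMap_self]⟩
  simp only [spongeCurvature, spongeLevelCurvature, this]

theorem isCrystallineCurvature_sponge {r R : ℝ} (hr : 0 < r) (hR : r < R) :
    IsCrystallineCurvature l1 (sponge r R) (spongeCurvature r R) ∧
      ∀ κ, IsCrystallineCurvature l1 (sponge r R) κ →
        κ =ᵐ[area (sponge r R)] spongeCurvature r R := by
  obtain ⟨φ, hφ, h1, h2, h3⟩ := exists_odd_cubic (A := -2 / (R - r))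
    (B := -((R - 3 * r) / (r * (R - r)))) hr hR
  obtain ⟨s1, s2, s3, s4⟩ := spongeSign_values hr hR
  refine (isFacetField_sponge hr hR).isCrystallineCurvature (hasFacets_sponge hr hR) hφ
    (fun c hc => ?_) fun i c _ => spongeCurvature_facetMap r R i c
  have aR : |R| = R := abs_of_pos (hr.trans hR)
  have ar : |r| = r := abs_of_pos hr
  simp only [spongeLevels, Finset.mem_insert, Finset.mem_singleton] at hc
  rcases hc with rfl | rfl | rfl | rfl
  · simp [spongeLevelCurvature, s1, aR, h1]
  · simp [spongeLevelCurvature, s2, aR, h1, h3]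
  · simp [spongeLevelCurvature, s3, ar, h2, hR.ne]
  · simp [spongeLevelCurvature, s4, ar, h2, h3, hR.ne]

end Sponge
end

/-! ### From curvature to motion: sponges, cubes and the empty set. -/

noncomputable section
namespace Sponge

/-! ### The velocity law for moving sponges -/

theorem volume_spongeFacet_ne_zero {r R : ℝ} (hr : 0 < r) (hR : r < R) (c : ℝ) :
    volume (spongeFacet r R c) ≠ 0 := by
  have hsub : Set.Ioo r R ×ˢ Set.Ioo (-r) r ⊆ spongeFacet r R c := by
    rintro ⟨a, b⟩ ⟨⟨a1, a2⟩, b1, b2⟩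
    simp only at a1 a2 b1 b2
    have ha : |a| = a := abs_of_pos (hr.trans a1)
    have hb : |b| < r := abs_lt.2 ⟨b1, b2⟩
    exact ⟨by simp only [ha]; exact a2.le, by simp only; linarith, Or.inl (by simp only [ha]; exact a1.le),
      Or.inr (Or.inr hb.le)⟩
  have hpos : 0 < volume (Set.Ioo r R ×ˢ Set.Ioo (-r) r) := by
    rw [Measure.volume_eq_prod, Measure.prod_prod, Real.volume_Ioo, Real.volume_Ioo]
    exact ENNReal.mul_pos (by simpa using hR) (by simpa using hr)
  exact (hpos.trans_le (measure_mono hsub)).ne'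

/-- On every facet σ(ν) = 1. For necessity, curvature and velocity are both unique almost everywhere
and facets have positive area, so one good point at each of the levels R and r yields the two
equations. -/
theorem satisfiesLaw_sponge_iff {r R : ℝ → ℝ} {t : ℝ} (h0 : 0 < r t) (h1 : r t < R t)
    (hr : DifferentiableAt ℝ r t) (hR : DifferentiableAt ℝ R t) :
    SatisfiesLaw l1 (fun s => sponge (r s) (R s)) t ↔
      HasDerivAt R (-2 / (R t - r t)) t ∧
      HasDerivAt r (-(R t - 3 * r t) / (r t * (R t - r t))) t := by
  have hF := hasFacets_sponge h0 h1
  obtain ⟨hC, hU⟩ := isCrystallineCurvature_sponge h0 h1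
  have aR : |R t| = R t := abs_of_pos (h0.trans h1)
  have ar : |r t| = r t := abs_of_pos h0
  constructor
  · rintro ⟨κ, hκ, hlaw⟩
    have key : ∀ c ∈ spongeLevels (r t) (R t),
        (if |c| = R t then deriv R t else -deriv r t) = spongeLevelCurvature (r t) (R t) c := by
      intro c hc
      have : (ae (volume.restrict (spongeFacet (r t) (R t) c))).NeBot :=
        ae_restrict_neBot.2 (volume_spongeFacet_ne_zero h0 h1 c)
      obtain ⟨y, hy1, hy2, ⟨ν, V, hV, hVκ⟩, hy4⟩ := ((spongeCurvature_facetMap (r t) (R t) 0 c).and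
        ((hF.ae_area_iff.1 (hU κ hκ) 0 c hc).and ((hF.ae_area_iff.1 hlaw 0 c hc).and
          (ae_hasNormalVelocity_sponge h0 h1 hr.hasDerivAt hR.hasDerivAt 0 hc)))).exists
      obtain ⟨rfl, rfl⟩ := hV.unique hy4
      rw [hVκ, l1_single (hF.sign c hc), one_mul, hy2, hy1]
    have k1 := key (R t) ((mem_spongeLevels h0 h1).2 (Or.inl aR))
    have k2 := key (r t) ((mem_spongeLevels h0 h1).2 (Or.inr ar))
    rw [if_pos aR, spongeLevelCurvature, if_pos aR] at k1
    rw [if_neg (by rw [ar]; exact h1.ne), spongeLevelCurvature,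
      if_neg (by rw [ar]; exact h1.ne)] at k2
    refine ⟨k1 ▸ hR.hasDerivAt, ?_⟩
    rw [neg_div, ← k2, neg_neg]
    exact hr.hasDerivAt
  · rintro ⟨hR', hr'⟩
    refine ⟨_, hC, hF.ae_area_iff.2 fun i c hc => ?_⟩
    filter_upwards [spongeCurvature_facetMap (r t) (R t) i c,
      ae_hasNormalVelocity_sponge h0 h1 hr' hR' i hc] with y hy1 hy2
    refine ⟨_, _, hy2, ?_⟩
    rw [l1_single (hF.sign c hc), one_mul, hy1, spongeLevelCurvature]
    split_ifs
    · rfl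
    · ring

/-! ### The velocity law for moving cubes -/

theorem isOpen_cube (R : ℝ) : IsOpen (cube R) := by
  have h : cube R = ⋂ i : Fin 3, {x : E3 | |x i| < R} := by ext x; simp [cube]
  rw [h]
  exact isOpen_iInter_of_finite fun i => isOpen_lt (by fun_prop) (by fun_prop)

theorem closure_cube {R : ℝ} (hR : 0 < R) : closure (cube R) = {x : E3 | ∀ i, |x i| ≤ R} := by
  apply Set.Subset.antisymm
  · refine closure_minimal (fun x hx i => (hx i).le) ?_
    simp only [Set.ofPred_forall]
    exact isClosed_iInter fun i => isClosed_le (by fun_prop) (by fun_prop)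
  · intro x hx
    have ht : Tendsto (fun t : ℝ => (1 - t) • x) (𝓝[>] 0) (𝓝 x) := by
      have : Tendsto (fun t : ℝ => (1 - t) • x) (𝓝 0) (𝓝 ((1 - (0 : ℝ)) • x)) :=
        Continuous.tendsto (by fun_prop) 0
      rw [sub_zero, one_smul] at this
      exact this.mono_left nhdsWithin_le_nhds
    refine mem_closure_of_tendsto ht ?_
    filter_upwards [Ioo_mem_nhdsGT (show (0 : ℝ) < 1 by norm_num)] with t ht i
    rw [PiLp.smul_apply, smul_eq_mul, abs_mul, abs_of_pos (by linarith [ht.2])]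
    have := hx i
    nlinarith [ht.1, ht.2, abs_nonneg (x i)]

/-- The ordinates of the facets of the cube. -/
def cubeLevels (R : ℝ) : Finset ℝ := {R, -R}

/-- The orientation of the facets of the cube. -/
def cubeSign (R c : ℝ) : ℝ := if c = R then 1 else -1

/-- The facets of the cube. -/
def cubeFacet (R : ℝ) (_ : ℝ) : Set (ℝ × ℝ) := {y | |y.1| ≤ R ∧ |y.2| ≤ R}

theorem mem_cubeLevels {R c : ℝ} (hR : 0 < R) : c ∈ cubeLevels R ↔ |c| = R := by
  simp [cubeLevels, abs_eq hR.le]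

theorem cubeSign_mul {R σ : ℝ} (hR : 0 < R) (hσ : σ = 1 ∨ σ = -1) : cubeSign R (σ * R) = σ := by
  rcases hσ with rfl | rfl
  · simp [cubeSign]
  · rw [cubeSign, if_neg]
    intro h; linarith

theorem ae_hasNormalVelocity_cube {R : ℝ → ℝ} {t R' : ℝ} (h0 : 0 < R t) (hR : HasDerivAt R R' t)
    (i : Fin 3) {c : ℝ} (hc : c ∈ cubeLevels (R t)) :
    ∀ᵐ y ∂(volume.restrict (cubeFacet (R t) c)),
      HasNormalVelocity (fun s => cube (R s)) t (facetMap i c y)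
        (cubeSign (R t) c • EuclideanSpace.single i 1) R' := by
  have hm : MeasurableSet (cubeFacet (R t) c) := by
    unfold cubeFacet; measurability
  filter_upwards [ae_restrict_mem hm, ae_restrict_of_ae (ae_abs_ne (R t))] with y ⟨y1, y2⟩ hyR
  obtain ⟨σ, hσ, rfl⟩ := exists_sign_mul_of_abs_eq ((mem_cubeLevels h0).1 hc)
  have hσ2 : σ * σ = 1 := by rcases hσ with rfl | rfl <;> norm_num
  rw [cubeSign_mul h0 hσ]
  set x := facetMap i (σ * R t) y with hx
  have hlt : ∀ m, m ≠ i → |x m| < R t := fun m hm => by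
    rcases fin_three_cases i m with h | h | h
    · exact absurd h hm
    · rw [h, hx, facetMap_one]; exact lt_of_le_of_ne y1 hyR.1
    · rw [h, hx, facetMap_two]; exact lt_of_le_of_ne y2 hyR.2
  have cR : ContinuousAt (fun q : E3 × ℝ => R q.2) (x, t) := hR.continuousAt.comp continuousAt_snd
  have cx : ∀ m, ContinuousAt (fun q : E3 × ℝ => |q.1 m|) (x, t) := fun m => by fun_prop
  have cs : ContinuousAt (fun q : E3 × ℝ => σ * q.1 i) (x, t) := by fun_prop
  have e1 : ∀ᶠ q : E3 × ℝ in 𝓝 (x, t), ∀ m, m ≠ i → |q.1 m| < R q.2 := by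
    rw [eventually_all]
    intro m
    by_cases hm : m = i
    · simp [hm]
    · filter_upwards [(cx m).eventually_lt cR (hlt m hm)] with q hq _ using hq
  have e4 : 0 < σ * x i := by rw [hx, facetMap_self, ← mul_assoc, hσ2, one_mul]; exact h0
  have key : ∀ᶠ q : E3 × ℝ in 𝓝 (x, t), (q.1 ∈ cube (R q.2) ↔ σ * q.1 i - R q.2 < 0) := by
    filter_upwards [e1, continuousAt_const.eventually_lt cs e4] with q q1 q4
    have habs : |q.1 i| = σ * q.1 i := by
      rcases hσ with rfl | rfl
      · rw [abs_of_pos (by linarith), one_mul]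
      · rw [abs_of_neg (by linarith)]; ring
    constructor
    · intro hq; have := hq i; linarith
    · intro hq m
      by_cases hm : m = i
      · rw [hm]; linarith
      · exact q1 m hm
  have := hasNormalVelocity_of_eventually (A := fun s => cube (R s)) (hR.const_mul σ) hσ
    (facetMap_self i (σ * R t) y) (by simpa only [← mul_assoc, hσ2, one_mul] using key)
  rwa [← mul_assoc, hσ2, one_mul] at this

theorem hasFacets_cube {R : ℝ} (hR : 0 < R) :
    HasFacets (cube R) (cubeLevels R) (cubeFacet R) (cubeSign R) where
  frontier_eq := by
    rw [(isOpen_cube R).frontier_eq, closure_cube hR]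
    ext x
    simp only [Set.mem_sdiff, Set.mem_ofPred_eq, mem_cubeLevels hR, cube, cubeFacet, not_forall,
      not_lt]
    constructor
    · rintro ⟨h, i, hi⟩
      exact ⟨i, le_antisymm (h i) hi, h _, h _⟩
    · rintro ⟨i, hi, h1, h2⟩
      refine ⟨fun m => ?_, i, hi.ge⟩
      rcases fin_three_cases i m with h | h | h
      · rw [h]; exact hi.le
      · rwa [h]
      · rwa [h]
  measurableSet := fun c _ => by unfold cubeFacet; measurability
  symm := fun c a b => by simp only [cubeFacet, Set.mem_ofPred_eq]; tauto
  bounded := ⟨R, fun c _ y hy => ⟨abs_le.1 hy.1, abs_le.1 hy.2⟩⟩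
  sign := fun c _ => by unfold cubeSign; split_ifs <;> simp
  normal := fun i c hc => by
    filter_upwards [ae_hasNormalVelocity_cube (R := fun _ => R) (t := 0) hR
      (hasDerivAt_const _ _) i hc] with y hy using hy.isOuterNormal

/-- The field is x / R: on each edge of the square slice it runs from -1 to 1. -/
theorem sliceIdentity_cube {R : ℝ} (hR : 0 < R) (t : ℝ) :
    SliceIdentity (cubeLevels R) (cubeFacet R) (cubeSign R) (fun b _ _ => b / R)
      (fun _ _ _ => 1 / R) t := by
  intro F F₁ F₂ G G₁ G₂ cF₁ cF₂ cG₁ cG₂ hF₁ hF₂ hG₁ hG₂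
  have hne : R ≠ -R := by linarith
  have s1 : cubeSign R R = 1 := by simp [cubeSign]
  have s2 : cubeSign R (-R) = -1 := by simp [cubeSign, hne.symm]
  rw [edgeSum, edgeSum, cubeLevels, Finset.sum_pair hne, Finset.sum_pair hne, s1, s2]
  by_cases ht : |t| ≤ R
  · have hs : ∀ c, {b | (b, t) ∈ cubeFacet R c} = {b | |b| ≤ R} := fun c => by
      ext b; simp [cubeFacet, ht]
    simp only [hs, setIntegral_congr_set (setOf_abs_le_ae R)]
    have e1 : ∀ c (σ : ℝ), ∫ b in Set.Ioo (-R) R, (G₂ c b - σ * (b / R * F₂ c b) -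
        σ * (1 / R * F c b)) = _ := fun c σ =>
      (integral_edge (a := -R) (b := R) (za := -1) (zb := 1) (σ := σ) (F := F c) (G := G c)
        (ζ := fun b => b / R) (η := fun _ => 1 / R) (by linarith)
        (cF₂.comp (by fun_prop : Continuous fun b : ℝ => (c, b)))
        (cG₂.comp (by fun_prop : Continuous fun b : ℝ => (c, b))) (hF₂ c) (hG₂ c)
        (fun b _ => by field_simp; ring) (fun b _ => by field_simp)).2
    have e2 : ∀ c (σ : ℝ), ∫ b in Set.Ioo (-R) R, (F₁ b c - σ * (b / R * G₁ b c) -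
        σ * (1 / R * G b c)) = _ := fun c σ =>
      (integral_edge (a := -R) (b := R) (za := -1) (zb := 1) (σ := σ) (F := fun b => G b c)
        (G := fun b => F b c) (ζ := fun b => b / R) (η := fun _ => 1 / R) (by linarith)
        (cG₁.comp (by fun_prop : Continuous fun b : ℝ => (b, c)))
        (cF₁.comp (by fun_prop : Continuous fun b : ℝ => (b, c))) (fun b => hG₁ b c)
        (fun b => hF₁ b c)
        (fun b _ => by field_simp; ring) (fun b _ => by field_simp)).2
    rw [e1, e1, e2, e2]; ring
  · have hs : ∀ c, {b | (b, t) ∈ cubeFacet R c} = ∅ := fun c => by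
      ext b; simp only [cubeFacet, Set.mem_ofPred_eq, Set.mem_empty_iff_false, iff_false]
      exact fun h => ht h.2
    simp [hs]

theorem isFacetField_cube {R : ℝ} (hR : 0 < R) :
    IsFacetField (cubeLevels R) (cubeFacet R) (cubeSign R) (fun _ => -2 / R) (fun b _ _ => b / R)
      (fun _ _ _ => 1 / R) := by
  refine ⟨by fun_prop, by fun_prop, ⟨|1 / R|, fun _ _ _ => le_rfl⟩, fun _ _ _ => rfl,
    fun c hc => ae_of_all _ fun y => ?_, fun c hc => ?_, fun c hc => ae_of_all _ fun y => ?_,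
    ae_of_all _ (sliceIdentity_cube hR)⟩
  · obtain ⟨σ, hσ, rfl⟩ := exists_sign_mul_of_abs_eq ((mem_cubeLevels hR).1 hc)
    rw [cubeSign_mul hR hσ]; field_simp
  · filter_upwards [ae_restrict_mem ((hasFacets_cube hR).measurableSet c hc)] with y hy
    simp only [abs_div, abs_of_pos hR, div_le_one hR]
    exact hy
  · ring

theorem satisfiesLaw_cube {R : ℝ → ℝ} {t : ℝ} (h0 : 0 < R t) (hR : HasDerivAt R (-2 / R t) t) :
    SatisfiesLaw l1 (fun s => cube (R s)) t := by
  have hF := hasFacets_cube h0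
  obtain ⟨hC, -⟩ := (isFacetField_cube h0).isCrystallineCurvature hF
    (φ := fun x => -2 / R t ^ 2 * x) (by fun_prop) (fun c hc => by
      obtain ⟨σ, hσ, rfl⟩ := exists_sign_mul_of_abs_eq ((mem_cubeLevels h0).1 hc)
      have hσ2 : σ * σ = 1 := by rcases hσ with rfl | rfl <;> norm_num
      rw [cubeSign_mul h0 hσ]
      field_simp
      linear_combination hσ2) (κ := fun _ => -2 / R t) fun i c hc => ae_of_all _ fun _ => rfl
  refine ⟨_, hC, hF.ae_area_iff.2 fun i c hc => ?_⟩
  filter_upwards [ae_hasNormalVelocity_cube h0 hR i hc] with y hy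
  exact ⟨_, _, hy, by rw [l1_single (hF.sign c hc), one_mul]⟩

/-! ### Localization of the velocity law -/

/-- The law at t only involves the evolution near t, so an evolution defined piecewise in time can
be checked branch by branch. -/
theorem SatisfiesLaw.congr {σ : E3 → ℝ} {A B : ℝ → Set E3} {t : ℝ} (h : SatisfiesLaw σ A t)
    (hAB : A =ᶠ[𝓝 t] B) : SatisfiesLaw σ B t := by
  obtain ⟨κ, hκ, hV⟩ := h
  rw [hAB.eq_of_nhds] at hκ hV
  refine ⟨κ, hκ, hV.mono fun x hx => ?_⟩
  obtain ⟨ν, V, ⟨ψ, p, τ, h0, hp, hd, hE, hν, hV'⟩, hVκ⟩ := hx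
  refine ⟨ν, V, ⟨ψ, p, τ, h0, hp, hd, ?_, hν, hV'⟩, hVκ⟩
  have : ∀ᶠ q : E3 × ℝ in 𝓝 (x, t), A q.2 = B q.2 :=
    (continuous_snd.tendsto (x, t)).eventually hAB
  filter_upwards [hE, this] with q h1 h2
  rw [← h2]; exact h1

theorem satisfiesLaw_empty (σ : E3 → ℝ) (t : ℝ) : SatisfiesLaw σ (fun _ => (∅ : Set E3)) t := by
  have h : area (∅ : Set E3) = 0 := by simp [area]
  refine ⟨fun _ => 0, ⟨fun _ => 0, ⟨by simp [h], by simp [h]⟩, ⟨fun _ => 0,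
    ⟨by simp [h], by simp [h]⟩, ⟨by simp [h], fun X _ _ => by simp [h]⟩⟩,
    fun z w _ _ => by simp [h]⟩, by simp [h]⟩

end Sponge
end

/-! ### Linearization of the system and maximal solutions. -/

noncomputable section
namespace Sponge

/-! ### The system of ordinary differential equations -/

/-- The second root of `x² = 3 x + 2`. -/
def xiConj : ℝ := 3 - xiStar

theorem xiStar_sq : xiStar ^ 2 = 3 * xiStar + 2 := by
  have h : √17 ^ 2 = 17 := Real.sq_sqrt (by norm_num)
  unfold xiStar; linear_combination h / 4

theorem xiStar_mul_xiConj : xiStar * xiConj = -2 := by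
  unfold xiConj; linear_combination -xiStar_sq

theorem three_lt_xiStar : 3 < xiStar := by
  have h : (3 : ℝ) < √17 := by
    rw [Real.lt_sqrt (by norm_num)]; norm_num
  unfold xiStar; linarith

theorem xiConj_neg : xiConj < 0 := by
  unfold xiConj; linarith [three_lt_xiStar]

theorem cStar_pos : 0 < cStar :=
  div_pos (by linarith [three_lt_xiStar]) (by linarith [three_lt_xiStar])

/-- The coefficient of the growing mode. -/
def growingMode (r₀ R₀ : ℝ) : ℝ := (xiStar * r₀ - R₀) / (xiStar - xiConj)

/-- The coefficient of the decaying mode. -/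
def decayingMode (r₀ R₀ : ℝ) : ℝ := (R₀ - xiConj * r₀) / (xiStar - xiConj)

/-- The inner radius as a function of the new time `τ`, `dτ = dt / (r (R - r))`. -/
def orbitInner (r₀ R₀ τ : ℝ) : ℝ :=
  growingMode r₀ R₀ * Real.exp (xiStar * τ) + decayingMode r₀ R₀ * Real.exp (xiConj * τ)

/-- The outer radius as a function of the new time `τ`, `dτ = dt / (r (R - r))`. -/
def orbitOuter (r₀ R₀ τ : ℝ) : ℝ :=
  xiConj * growingMode r₀ R₀ * Real.exp (xiStar * τ) +
    xiStar * decayingMode r₀ R₀ * Real.exp (xiConj * τ)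

/-- The old time as a function of the new time. -/
def orbitTime (r₀ R₀ τ : ℝ) : ℝ :=
  ∫ u in (0 : ℝ)..τ, orbitInner r₀ R₀ u * (orbitOuter r₀ R₀ u - orbitInner r₀ R₀ u)

theorem xiStar_sub_xiConj_pos : 0 < xiStar - xiConj := by
  linarith [xiConj_neg, three_lt_xiStar]

section orbit

variable (r₀ R₀ : ℝ)

theorem orbitInner_zero : orbitInner r₀ R₀ 0 = r₀ := by
  have := xiStar_sub_xiConj_pos.ne'
  simp only [orbitInner, growingMode, decayingMode, mul_zero, Real.exp_zero]
  field_simp; ring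

theorem orbitOuter_zero : orbitOuter r₀ R₀ 0 = R₀ := by
  have := xiStar_sub_xiConj_pos.ne'
  simp only [orbitOuter, growingMode, decayingMode, mul_zero, Real.exp_zero]
  field_simp; ring

theorem hasDerivAt_exp_mul (a τ : ℝ) :
    HasDerivAt (fun τ => Real.exp (a * τ)) (a * Real.exp (a * τ)) τ := by
  have := ((hasDerivAt_id τ).const_mul a).exp
  simpa [mul_comm] using this

/-- In the new time the system is r' = 3r - R, R' = -2r. An eigenvector with eigenvalue λ has R / r
= 3 - λ, so the growing mode has ratio `xiConj` and the decaying one has ratio `xiStar`. -/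
theorem hasDerivAt_orbitInner (τ : ℝ) :
    HasDerivAt (orbitInner r₀ R₀) (-(orbitOuter r₀ R₀ τ - 3 * orbitInner r₀ R₀ τ)) τ := by
  refine (((hasDerivAt_exp_mul xiStar τ).const_mul (growingMode r₀ R₀)).add
    ((hasDerivAt_exp_mul xiConj τ).const_mul (decayingMode r₀ R₀))).congr_deriv ?_
  simp only [orbitInner, orbitOuter, xiConj]; ring

theorem hasDerivAt_orbitOuter (τ : ℝ) :
    HasDerivAt (orbitOuter r₀ R₀) (-2 * orbitInner r₀ R₀ τ) τ := by
  refine (((hasDerivAt_exp_mul xiStar τ).const_mul (xiConj * growingMode r₀ R₀)).add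
    ((hasDerivAt_exp_mul xiConj τ).const_mul (xiStar * decayingMode r₀ R₀))).congr_deriv ?_
  simp only [orbitInner]
  linear_combination (growingMode r₀ R₀ * Real.exp (xiStar * τ) +
    decayingMode r₀ R₀ * Real.exp (xiConj * τ)) * xiStar_mul_xiConj

theorem continuous_orbitInner : Continuous (orbitInner r₀ R₀) :=
  continuous_iff_continuousAt.2 fun τ => (hasDerivAt_orbitInner r₀ R₀ τ).continuousAt

theorem continuous_orbitOuter : Continuous (orbitOuter r₀ R₀) :=
  continuous_iff_continuousAt.2 fun τ => (hasDerivAt_orbitOuter r₀ R₀ τ).continuousAt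

theorem hasDerivAt_orbitTime (τ : ℝ) :
    HasDerivAt (orbitTime r₀ R₀)
      (orbitInner r₀ R₀ τ * (orbitOuter r₀ R₀ τ - orbitInner r₀ R₀ τ)) τ := by
  have h : Continuous fun u => orbitInner r₀ R₀ u * (orbitOuter r₀ R₀ u - orbitInner r₀ R₀ u) :=
    (continuous_orbitInner r₀ R₀).mul
      ((continuous_orbitOuter r₀ R₀).sub (continuous_orbitInner r₀ R₀))
  exact h.integral_hasStrictDerivAt 0 τ |>.hasDerivAt

@[simp] theorem orbitTime_zero : orbitTime r₀ R₀ 0 = 0 := by simp [orbitTime]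

theorem continuous_orbitTime : Continuous (orbitTime r₀ R₀) :=
  continuous_iff_continuousAt.2 fun τ => (hasDerivAt_orbitTime r₀ R₀ τ).continuousAt

theorem strictMonoOn_orbitTime {L : ℝ}
    (h : ∀ τ ∈ Set.Ico 0 L, 0 < orbitInner r₀ R₀ τ ∧ orbitInner r₀ R₀ τ < orbitOuter r₀ R₀ τ) :
    StrictMonoOn (orbitTime r₀ R₀) (Set.Icc 0 L) := by
  refine strictMonoOn_of_deriv_pos (convex_Icc 0 L) (continuous_orbitTime r₀ R₀).continuousOn
    fun τ hτ => ?_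
  rw [interior_Icc] at hτ
  obtain ⟨h1, h2⟩ := h τ ⟨hτ.1.le, hτ.2⟩
  rw [(hasDerivAt_orbitTime r₀ R₀ τ).deriv]
  exact mul_pos h1 (by linarith)

end orbit

theorem IsSpongeODE.range_Ico {r₀ R₀ T : ℝ} {r R : ℝ → ℝ} (h : IsSpongeODE r₀ R₀ T r R)
    (h0 : 0 < r₀) (h1 : r₀ < R₀) {t : ℝ} (ht : t ∈ Set.Ico 0 T) : 0 < r t ∧ r t < R t := by
  rcases ht.1.eq_or_lt with h' | h'
  · rw [← h', h.init_r, h.init_R]; exact ⟨h0, h1⟩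
  · exact h.range t ⟨h', ht.2⟩

/-- Every solution of the system runs along the orbit. -/
theorem IsSpongeODE.exists_orbit_parameter {r₀ R₀ T : ℝ} {r R : ℝ → ℝ} (h : IsSpongeODE r₀ R₀ T r R)
    (h0 : 0 < r₀) (h1 : r₀ < R₀) :
    ∃ τ : ℝ → ℝ, ∀ t ∈ Set.Ico 0 T, 0 ≤ τ t ∧ r t = orbitInner r₀ R₀ (τ t) ∧
      R t = orbitOuter r₀ R₀ (τ t) ∧ orbitTime r₀ R₀ (τ t) = t ∧
      ∀ u ∈ Set.Icc 0 (τ t), 0 < orbitInner r₀ R₀ u ∧ orbitInner r₀ R₀ u < orbitOuter r₀ R₀ u := by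
  have hm := xiConj_neg
  have hl : 0 < xiStar := by linarith [three_lt_xiStar]
  have hlm := xiStar_mul_xiConj
  have hsum : xiConj = 3 - xiStar := rfl
  have hpos := fun t (ht : t ∈ Set.Ico 0 T) => h.range_Ico h0 h1 ht
  let p : ℝ → ℝ := fun t => R t - xiConj * r t
  -- The combination p is positive and decays exactly like exp (xiConj τ), so the new time is read
  -- off from p by a logarithm instead of integrating 1 / (r (R - r)).
  let τ : ℝ → ℝ := fun t => Real.log (p t / p 0) / xiConj
  have hp : ∀ t ∈ Set.Ico 0 T, 0 < p t := fun t ht => by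
    obtain ⟨a, b⟩ := hpos t ht
    have : xiConj * r t < 0 := mul_neg_of_neg_of_pos hm a
    simp only [p]; linarith
  have h0T : (0 : ℝ) ∈ Set.Ico 0 T := ⟨le_rfl, h.pos⟩
  have hp0 := hp 0 h0T
  have hpc : ContinuousOn p (Set.Ico 0 T) := h.cont_R.sub (h.cont_r.const_mul xiConj)
  have hτc : ContinuousOn τ (Set.Ico 0 T) :=
    ((hpc.div_const _).log fun t ht => (div_pos (hp t ht) hp0).ne').div_const _
  have hτ0 : τ 0 = 0 := by simp [τ, div_self hp0.ne']
  have hexp : ∀ t ∈ Set.Ico 0 T, p t = p 0 * Real.exp (xiConj * τ t) := fun t ht => by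
    simp only [τ]
    rw [mul_div_cancel₀ _ hm.ne, Real.exp_log (div_pos (hp t ht) hp0), mul_div_cancel₀ _ hp0.ne']
  have hτd : ∀ t ∈ Set.Ioo 0 T, HasDerivAt τ (1 / (r t * (R t - r t))) t := fun t ht => by
    obtain ⟨a, b⟩ := h.range t ht
    have hRr : R t - r t ≠ 0 := by linarith
    have hpt := (hp t ⟨ht.1.le, ht.2⟩).ne'
    have hpd : HasDerivAt p (xiConj * p t / (r t * (R t - r t))) t := by
      refine ((h.deriv_R t ht).sub ((h.deriv_r t ht).const_mul xiConj)).congr_deriv ?_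
      simp only [p]
      field_simp
      rw [hsum] at hlm ⊢
      linear_combination (-r t) * hlm
    refine (((hpd.div_const (p 0)).log (div_pos (hp t ⟨ht.1.le, ht.2⟩) hp0).ne').div_const
      xiConj).congr_deriv ?_
    field_simp
    exact div_self hm.ne
  have hconst : ∀ {f : ℝ → ℝ}, ContinuousOn f (Set.Ico 0 T) →
      (∀ t ∈ Set.Ioo 0 T, HasDerivAt f 0 t) → ∀ t ∈ Set.Ico 0 T, f t = f 0 := by
    intro f hf hd t ht
    rcases ht.1.eq_or_lt with h' | h'
    · rw [← h']
    · obtain ⟨c, -, hc⟩ := exists_hasDerivAt_eq_slope f (fun _ => 0) h'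
        (hf.mono fun s hs => ⟨hs.1, hs.2.trans_lt ht.2⟩)
        fun s hs => hd s ⟨hs.1, hs.2.trans ht.2⟩
      rw [eq_div_iff (by linarith), zero_mul] at hc
      linarith
  -- The second eigencoordinate grows like exp (xiStar τ); dividing by this factor leaves a
  -- constant. Together with p it determines r and R.
  have hq : ∀ t ∈ Set.Ico 0 T, xiStar * r t - R t = (xiStar * r₀ - R₀) * Real.exp (xiStar * τ t) := by
    intro t ht
    have := hconst (f := fun t => (xiStar * r t - R t) * Real.exp (-(xiStar * τ t)))
      (((h.cont_r.const_mul xiStar).sub h.cont_R).mul (hτc.const_mul xiStar).neg.rexp)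
      (fun t ht => by
        obtain ⟨a, b⟩ := h.range t ht
        have hRr : R t - r t ≠ 0 := by linarith
        refine ((((h.deriv_r t ht).const_mul xiStar).sub (h.deriv_R t ht)).mul
          ((hτd t ht).const_mul xiStar).neg.exp).congr_deriv ?_
        simp only [Pi.neg_apply, Pi.sub_apply]
        field_simp
        rw [hsum] at hlm
        linear_combination (Real.exp (-(xiStar * τ t)) * r t) * hlm) t ht
    simp only [hτ0, mul_zero, neg_zero, Real.exp_zero, mul_one, h.init_r, h.init_R] at this
    rw [← this, mul_assoc, ← Real.exp_add]; simp
  have hlm' := xiStar_sub_xiConj_pos.ne'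
  have hr : ∀ t ∈ Set.Ico 0 T, r t = orbitInner r₀ R₀ (τ t) := fun t ht => by
    have e1 := hexp t ht
    have e2 := hq t ht
    simp only [p, h.init_r, h.init_R] at e1
    simp only [orbitInner, growingMode, decayingMode]
    field_simp
    linear_combination e1 + e2
  have hR : ∀ t ∈ Set.Ico 0 T, R t = orbitOuter r₀ R₀ (τ t) := fun t ht => by
    have e1 := hexp t ht
    have e2 := hq t ht
    simp only [p, h.init_r, h.init_R] at e1
    simp only [orbitOuter, growingMode, decayingMode]
    field_simp
    linear_combination xiStar * e1 + xiConj * e2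
  have hmono : MonotoneOn τ (Set.Ico 0 T) := by
    refine monotoneOn_of_deriv_nonneg (convex_Ico 0 T) hτc ?_ ?_ <;> rw [interior_Ico]
    · exact fun t ht => (hτd t ht).differentiableAt.differentiableWithinAt
    · intro t ht
      obtain ⟨a, b⟩ := h.range t ht
      rw [(hτd t ht).deriv]
      have : 0 < R t - r t := by linarith
      positivity
  refine ⟨τ, fun t ht => ⟨hτ0 ▸ hmono h0T ht ht.1, hr t ht, hR t ht, ?_, fun u hu => ?_⟩⟩
  · have := hconst (f := fun t => orbitTime r₀ R₀ (τ t) - t)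
      (((continuous_orbitTime r₀ R₀).comp_continuousOn hτc).sub continuousOn_id)
      (fun t ht => by
        obtain ⟨a, b⟩ := h.range t ht
        have hRr : R t - r t ≠ 0 := by linarith
        refine (((hasDerivAt_orbitTime r₀ R₀ (τ t)).comp t (hτd t ht)).sub
          (hasDerivAt_id t)).congr_deriv ?_
        rw [← hr t ⟨ht.1.le, ht.2⟩, ← hR t ⟨ht.1.le, ht.2⟩]
        field_simp; ring) t ht
    simp only [hτ0, orbitTime_zero, sub_zero] at this
    linarith
  -- By continuity every new time in [0, τ t] is attained, so the orbit stays in the admissible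
  -- range up to τ t. Hence no solution can pass an exit point of the orbit.
  · have hsub : Set.Icc 0 t ⊆ Set.Ico 0 T := fun s hs => ⟨hs.1, hs.2.trans_lt ht.2⟩
    obtain ⟨s, hs, rfl⟩ : u ∈ τ '' Set.Icc 0 t :=
      intermediate_value_Icc ht.1 (hτc.mono hsub) (by rwa [hτ0])
    rw [← hr s (hsub hs), ← hR s (hsub hs)]
    exact hpos s (hsub hs)

end Sponge
end

noncomputable section
namespace Sponge

/-! ### Maximal solutions -/

/-- `(r, R)` is a solution on `[0, T)` that extends every other solution. -/
def IsMaximalSolution (r₀ R₀ T : ℝ) (r R : ℝ → ℝ) : Prop :=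
  IsSpongeODE r₀ R₀ T r R ∧
    ∀ (T' : ℝ) (r' R' : ℝ → ℝ), IsSpongeODE r₀ R₀ T' r' R' →
      T' ≤ T ∧ Set.EqOn r' r (Set.Ico 0 T') ∧ Set.EqOn R' R (Set.Ico 0 T')

theorem IsSpongeODE.congr {r₀ R₀ T : ℝ} {r R r' R' : ℝ → ℝ} (h : IsSpongeODE r₀ R₀ T r R)
    (hr : Set.EqOn r' r (Set.Ico 0 T)) (hR : Set.EqOn R' R (Set.Ico 0 T)) :
    IsSpongeODE r₀ R₀ T r' R' := by
  have h0T : (0 : ℝ) ∈ Set.Ico 0 T := ⟨le_rfl, h.pos⟩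
  have hev : ∀ {f g : ℝ → ℝ}, Set.EqOn f g (Set.Ico 0 T) → ∀ t ∈ Set.Ioo 0 T, f =ᶠ[𝓝 t] g :=
    fun hfg t ht => by
      filter_upwards [Ioo_mem_nhds ht.1 ht.2] with s hs using hfg ⟨hs.1.le, hs.2⟩
  refine ⟨h.pos, h.cont_r.congr hr, h.cont_R.congr hR, (hr h0T).trans h.init_r,
    (hR h0T).trans h.init_R, fun t ht => ?_, fun t ht => ?_, fun t ht => ?_⟩
  · rw [hr ⟨ht.1.le, ht.2⟩, hR ⟨ht.1.le, ht.2⟩]; exact h.range t ht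
  · rw [hr ⟨ht.1.le, ht.2⟩, hR ⟨ht.1.le, ht.2⟩]
    exact (h.deriv_R t ht).congr_of_eventuallyEq (hev hR t ht)
  · rw [hr ⟨ht.1.le, ht.2⟩, hR ⟨ht.1.le, ht.2⟩]
    exact (h.deriv_r t ht).congr_of_eventuallyEq (hev hr t ht)

/-- The equations are only tested on [0, T), so r and R may be redefined from T on, in particular
extended continuously. -/
theorem IsMaximalSolution.congr {r₀ R₀ T : ℝ} {r R r' R' : ℝ → ℝ}
    (h : IsMaximalSolution r₀ R₀ T r R)
    (hr : Set.EqOn r' r (Set.Ico 0 T)) (hR : Set.EqOn R' R (Set.Ico 0 T)) :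
    IsMaximalSolution r₀ R₀ T r' R' := by
  refine ⟨h.1.congr hr hR, fun T' p P hp => ?_⟩
  obtain ⟨a, b, c⟩ := h.2 T' p P hp
  have hsub : Set.Ico 0 T' ⊆ Set.Ico 0 T := Set.Ico_subset_Ico_right a
  exact ⟨a, b.trans (hr.mono hsub).symm, c.trans (hR.mono hsub).symm⟩

/-- A strictly increasing continuous function on an interval has a continuous inverse. -/
theorem exists_continuous_inverse {G : ℝ → ℝ} {L : ℝ} (hL : 0 < L) (hG : Continuous G)
    (hmono : StrictMonoOn G (Set.Icc 0 L)) (hG0 : G 0 = 0) :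
    ∃ τ : ℝ → ℝ, Continuous τ ∧ StrictMono τ ∧ τ 0 = 0 ∧ τ (G L) = L ∧
      ∀ t ∈ Set.Icc 0 (G L), G (τ t) = t := by
  -- Adding the overshoot x - c x to G (c x) extends G with slope one to an increasing bijection of
  -- ℝ, whose inverse is continuous everywhere.
  let c : ℝ → ℝ := fun x => max 0 (min x L)
  have hc : ∀ x, c x ∈ Set.Icc 0 L := fun x => ⟨le_max_left _ _, max_le hL.le (min_le_right _ _)⟩
  have hcid : ∀ x ∈ Set.Icc 0 L, c x = x := fun x hx => by
    simp only [c, min_eq_left hx.2, max_eq_right hx.1]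
  have hcmono : Monotone c := fun x y h => max_le_max le_rfl (min_le_min h le_rfl)
  have hdiff : Monotone fun x => x - c x := fun x y h => by
    simp only [c]
    rcases max_cases 0 (min x L) with a | a <;> rcases max_cases 0 (min y L) with b | b <;>
      rcases min_cases x L with d | d <;> rcases min_cases y L with e | e <;> linarith
  let F : ℝ → ℝ := fun x => G (c x) + (x - c x)
  have hFmono : StrictMono F := fun x y h => by
    rcases (hcmono h.le).lt_or_eq with h' | h'
    · exact add_lt_add_of_lt_of_le (hmono (hc x) (hc y) h') (hdiff h.le)
    · simp only [F, h']; linarith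
  have hFc : Continuous F := by
    have : Continuous c := by fun_prop
    fun_prop
  have hFid : ∀ x ∈ Set.Icc 0 L, F x = G x := fun x hx => by simp [F, hcid x hx]
  have hG' : ∀ x ∈ Set.Icc 0 L, G x ∈ Set.Icc 0 (G L) := fun x hx =>
    ⟨hG0 ▸ hmono.monotoneOn ⟨le_rfl, hL.le⟩ hx hx.1, hmono.monotoneOn hx ⟨hL.le, le_rfl⟩ hx.2⟩
  have hFs : Function.Surjective F := by
    refine hFc.surjective ?_ ?_
    · refine tendsto_atTop_mono (fun x => ?_) (tendsto_atTop_add_const_right _ (-L) tendsto_id)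
      have := (hG' _ (hc x)).1
      have := (hc x).2
      simp only [F, id]; linarith
    · refine tendsto_atBot_mono (fun x => ?_) (tendsto_atBot_add_const_right _ (G L) tendsto_id)
      have := (hG' _ (hc x)).2
      have := (hc x).1
      simp only [F, id]; linarith
  let e : ℝ ≃o ℝ := hFmono.orderIsoOfSurjective F hFs
  have he : ∀ x, e x = F x := fun x => rfl
  have h0 : F 0 = 0 := by rw [hFid 0 ⟨le_rfl, hL.le⟩, hG0]
  have h1 : F L = G L := hFid L ⟨hL.le, le_rfl⟩
  have t0 : e.symm 0 = 0 := by rw [OrderIso.symm_apply_eq, he, h0]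
  have t1 : e.symm (G L) = L := by rw [OrderIso.symm_apply_eq, he, h1]
  refine ⟨e.symm, e.symm.continuous, e.symm.strictMono, t0, t1, fun t ht => ?_⟩
  have : e.symm t ∈ Set.Icc 0 L :=
    ⟨t0 ▸ e.symm.monotone ht.1, (e.symm.monotone ht.2).trans_eq t1⟩
  rw [← hFid _ this, ← he, e.apply_symm_apply]

/-- The maximal solution, if the orbit leaves the range `0 < r < R` in finite new time `L`. -/
theorem exists_isMaximalSolution {r₀ R₀ L : ℝ} (h0 : 0 < r₀) (h1 : r₀ < R₀) (hL : 0 < L)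
    (hpos : ∀ τ ∈ Set.Ico 0 L,
      0 < orbitInner r₀ R₀ τ ∧ orbitInner r₀ R₀ τ < orbitOuter r₀ R₀ τ)
    (hexit : ¬(0 < orbitInner r₀ R₀ L ∧ orbitInner r₀ R₀ L < orbitOuter r₀ R₀ L)) :
    ∃ (T : ℝ) (τ : ℝ → ℝ), 0 < T ∧ Continuous τ ∧ StrictMono τ ∧ τ 0 = 0 ∧ τ T = L ∧
      IsMaximalSolution r₀ R₀ T (fun t => orbitInner r₀ R₀ (τ t))
        (fun t => orbitOuter r₀ R₀ (τ t)) := by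
  have hmono := strictMonoOn_orbitTime r₀ R₀ hpos
  obtain ⟨τ, hτc, hτm, hτ0, hτT, hτ⟩ :=
    exists_continuous_inverse hL (continuous_orbitTime r₀ R₀) hmono (orbitTime_zero r₀ R₀)
  set T := orbitTime r₀ R₀ L with hT
  have hTpos : 0 < T := by
    have := hmono ⟨le_rfl, hL.le⟩ ⟨hL.le, le_rfl⟩ hL
    rwa [orbitTime_zero] at this
  have hτmem : ∀ t ∈ Set.Ioo 0 T, τ t ∈ Set.Ioo 0 L := fun t ht =>
    ⟨hτ0 ▸ hτm ht.1, hτT ▸ hτm ht.2⟩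
  have hrange : ∀ t ∈ Set.Ioo 0 T,
      0 < orbitInner r₀ R₀ (τ t) ∧ orbitInner r₀ R₀ (τ t) < orbitOuter r₀ R₀ (τ t) :=
    fun t ht => hpos _ ⟨(hτmem t ht).1.le, (hτmem t ht).2⟩
  have hτd : ∀ t ∈ Set.Ioo 0 T, HasDerivAt τ
      (orbitInner r₀ R₀ (τ t) * (orbitOuter r₀ R₀ (τ t) - orbitInner r₀ R₀ (τ t)))⁻¹ t := by
    intro t ht
    obtain ⟨a, b⟩ := hrange t ht
    refine HasDerivAt.of_local_left_inverse hτc.continuousAt (hasDerivAt_orbitTime r₀ R₀ (τ t))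
      (mul_pos a (by linarith)).ne' ?_
    filter_upwards [Ioo_mem_nhds ht.1 ht.2] with s hs using hτ s ⟨hs.1.le, hs.2.le⟩
  refine ⟨T, τ, hTpos, hτc, hτm, hτ0, hτT, ⟨hTpos, ?_, ?_, ?_, ?_, hrange, ?_, ?_⟩, ?_⟩
  · exact ((continuous_orbitInner r₀ R₀).comp hτc).continuousOn
  · exact ((continuous_orbitOuter r₀ R₀).comp hτc).continuousOn
  · simp only [hτ0, orbitInner_zero]
  · simp only [hτ0, orbitOuter_zero]
  · intro t ht
    obtain ⟨a, b⟩ := hrange t ht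
    refine ((hasDerivAt_orbitOuter r₀ R₀ (τ t)).comp t (hτd t ht)).congr_deriv ?_
    have : orbitOuter r₀ R₀ (τ t) - orbitInner r₀ R₀ (τ t) ≠ 0 := by linarith
    field_simp
  · intro t ht
    obtain ⟨a, b⟩ := hrange t ht
    exact ((hasDerivAt_orbitInner r₀ R₀ (τ t)).comp t (hτd t ht)).congr_deriv
      (div_eq_mul_inv _ _).symm
  · intro T' r' R' h'
    obtain ⟨σ, hσ⟩ := h'.exists_orbit_parameter h0 h1
    have hlt : ∀ t ∈ Set.Ico 0 T', σ t < L := fun t ht => by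
      obtain ⟨-, -, -, -, e⟩ := hσ t ht
      by_contra! hle
      exact hexit (e L ⟨hL.le, hle⟩)
    have htT : ∀ t ∈ Set.Ico 0 T', t < T := fun t ht => by
      obtain ⟨a, -, -, d, -⟩ := hσ t ht
      rw [← d]
      exact hmono ⟨a, (hlt t ht).le⟩ ⟨hL.le, le_rfl⟩ (hlt t ht)
    have heq : ∀ t ∈ Set.Ico 0 T', σ t = τ t := fun t ht => by
      obtain ⟨a, -, -, d, -⟩ := hσ t ht
      have hm := htT t ht
      refine hmono.injOn ⟨a, (hlt t ht).le⟩ ⟨hτ0 ▸ hτm.monotone ht.1, ?_⟩ ?_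
      · exact (hτm.monotone hm.le).trans_eq hτT
      · rw [d, hτ t ⟨ht.1, hm.le⟩]
    refine ⟨?_, fun t ht => ?_, fun t ht => ?_⟩
    · by_contra! hlt'
      exact lt_irrefl _ (htT T ⟨hTpos.le, hlt'⟩)
    · rw [(hσ t ht).2.1, heq t ht]
    · rw [(hσ t ht).2.2.1, heq t ht]

/-- A decaying minus a growing exponential vanishes once. -/
theorem exists_first_zero_exp_sub_exp {a b l m : ℝ} (ha : 0 < a) (hab : a < b) (hml : m < l) :
    ∃ L, 0 < L ∧ b * Real.exp (m * L) - a * Real.exp (l * L) = 0 ∧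
      ∀ τ < L, 0 < b * Real.exp (m * τ) - a * Real.exp (l * τ) := by
  have hlm : 0 < l - m := by linarith
  have key : ∀ τ, b * Real.exp (m * τ) - a * Real.exp (l * τ) =
      a * Real.exp (m * τ) * (b / a - Real.exp ((l - m) * τ)) := fun τ => by
    rw [mul_sub, mul_assoc _ _ (Real.exp ((l - m) * τ)), ← Real.exp_add]
    have : m * τ + (l - m) * τ = l * τ := by ring
    rw [this]; field_simp
  have hba : 1 < b / a := (one_lt_div ha).2 hab
  refine ⟨Real.log (b / a) / (l - m), div_pos (Real.log_pos hba) hlm, ?_, fun τ hτ => ?_⟩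
  · rw [key, mul_div_cancel₀ _ hlm.ne', Real.exp_log (by linarith)]; simp
  · rw [key]
    have : Real.exp ((l - m) * τ) < b / a := by
      rw [← Real.lt_log_iff_exp_lt (by linarith)]
      rw [lt_div_iff₀ hlm] at hτ; linarith
    have := Real.exp_pos (m * τ)
    refine mul_pos (by positivity) (by linarith)

theorem decayingMode_pos {r₀ R₀ : ℝ} (h0 : 0 < r₀) (h1 : r₀ < R₀) : 0 < decayingMode r₀ R₀ := by
  have := mul_neg_of_neg_of_pos xiConj_neg h0
  exact div_pos (by linarith) xiStar_sub_xiConj_pos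

theorem growingMode_add_decayingMode (r₀ R₀ : ℝ) :
    growingMode r₀ R₀ + decayingMode r₀ R₀ = r₀ := by
  simpa [orbitInner] using orbitInner_zero r₀ R₀

theorem mul_growingMode_add_mul_decayingMode (r₀ R₀ : ℝ) :
    xiConj * growingMode r₀ R₀ + xiStar * decayingMode r₀ R₀ = R₀ := by
  simpa [orbitOuter] using orbitOuter_zero r₀ R₀

/-- Below the critical ratio the gap `R - r` closes while `r` stays positive. -/
theorem exists_exit_of_lt {r₀ R₀ : ℝ} (h0 : 0 < r₀) (h1 : r₀ < R₀) (h : R₀ < xiStar * r₀) :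
    ∃ L, 0 < L ∧ (∀ τ ∈ Set.Icc 0 L, 0 < orbitInner r₀ R₀ τ) ∧
      (∀ τ ∈ Set.Ico 0 L, orbitInner r₀ R₀ τ < orbitOuter r₀ R₀ τ) ∧
      orbitInner r₀ R₀ L = orbitOuter r₀ R₀ L := by
  have hA : 0 < growingMode r₀ R₀ := div_pos (by linarith) xiStar_sub_xiConj_pos
  have hB := decayingMode_pos h0 h1
  have e1 := growingMode_add_decayingMode r₀ R₀
  have e2 := mul_growingMode_add_mul_decayingMode r₀ R₀
  have hm := xiConj_neg
  -- Both modes have positive coefficients: r is a positive sum, and R - r is a decaying exponential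
  -- minus a growing one.
  obtain ⟨L, hL, hz, hp⟩ := exists_first_zero_exp_sub_exp
    (a := (1 - xiConj) * growingMode r₀ R₀) (b := (xiStar - 1) * decayingMode r₀ R₀)
    (l := xiStar) (m := xiConj) (mul_pos (by linarith) hA) (by linarith)
    (by linarith [xiStar_sub_xiConj_pos])
  refine ⟨L, hL, fun τ _ => ?_, fun τ hτ => ?_, ?_⟩
  · unfold orbitInner; positivity
  · have := hp τ hτ.2
    unfold orbitInner orbitOuter; linarith
  · unfold orbitInner orbitOuter; linarith

/-- Above the critical ratio `r` vanishes while the gap `R - r` stays positive. -/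
theorem exists_exit_of_gt {r₀ R₀ : ℝ} (h0 : 0 < r₀) (h1 : r₀ < R₀) (h : xiStar * r₀ < R₀) :
    ∃ L, 0 < L ∧ (∀ τ ∈ Set.Ico 0 L, 0 < orbitInner r₀ R₀ τ) ∧
      (∀ τ ∈ Set.Icc 0 L, orbitInner r₀ R₀ τ < orbitOuter r₀ R₀ τ) ∧
      orbitInner r₀ R₀ L = 0 := by
  have hA : growingMode r₀ R₀ < 0 := div_neg_of_neg_of_pos (by linarith) xiStar_sub_xiConj_pos
  have hB := decayingMode_pos h0 h1
  have e1 := growingMode_add_decayingMode r₀ R₀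
  have hm := xiConj_neg
  have hl := three_lt_xiStar
  -- The growing mode is negative: r itself is decaying minus growing, while R - r is a positive
  -- sum.
  obtain ⟨L, hL, hz, hp⟩ := exists_first_zero_exp_sub_exp
    (a := -growingMode r₀ R₀) (b := decayingMode r₀ R₀)
    (l := xiStar) (m := xiConj) (by linarith) (by linarith)
    (by linarith [xiStar_sub_xiConj_pos])
  refine ⟨L, hL, fun τ hτ => ?_, fun τ _ => ?_, ?_⟩
  · have := hp τ hτ.2
    unfold orbitInner; linarith
  · have a1 : 0 < (xiConj - 1) * growingMode r₀ R₀ * Real.exp (xiStar * τ) :=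
      mul_pos (mul_pos_of_neg_of_neg (by linarith) hA) (Real.exp_pos _)
    have a2 : 0 < (xiStar - 1) * decayingMode r₀ R₀ * Real.exp (xiConj * τ) :=
      mul_pos (mul_pos (by linarith) hB) (Real.exp_pos _)
    unfold orbitInner orbitOuter; linarith
  · unfold orbitInner; linarith

/-- At the critical ratio the solution is self-similar. -/
theorem isMaximalSolution_critical {r₀ : ℝ} (h0 : 0 < r₀) :
    IsMaximalSolution r₀ (xiStar * r₀) (r₀ ^ 2 / (2 * cStar))
      (fun t => √(r₀ ^ 2 - 2 * cStar * t)) (fun t => xiStar * √(r₀ ^ 2 - 2 * cStar * t)) := by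
  have hc := cStar_pos
  have hl := three_lt_xiStar
  have hlm := xiStar_mul_xiConj
  have hcl : cStar * (xiStar - 1) = xiStar - 3 := div_mul_cancel₀ _ (by linarith)
  have hrad : ∀ t < r₀ ^ 2 / (2 * cStar), 0 < r₀ ^ 2 - 2 * cStar * t := fun t ht => by
    rw [lt_div_iff₀ (by linarith)] at ht; linarith
  have hcont : Continuous fun t => √(r₀ ^ 2 - 2 * cStar * t) := by fun_prop
  have hd : ∀ t < r₀ ^ 2 / (2 * cStar), HasDerivAt (fun t => √(r₀ ^ 2 - 2 * cStar * t))
      (-cStar / √(r₀ ^ 2 - 2 * cStar * t)) t := fun t ht => by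
    have : HasDerivAt (fun t => r₀ ^ 2 - 2 * cStar * t) (-(2 * cStar)) t := by
      simpa using ((hasDerivAt_id t).const_mul (2 * cStar)).const_sub (r₀ ^ 2)
    refine (this.sqrt (hrad t ht).ne').congr_deriv ?_
    have := (Real.sqrt_pos.2 (hrad t ht)).ne'
    field_simp
  refine ⟨⟨by positivity, hcont.continuousOn, (hcont.const_mul _).continuousOn, ?_, ?_,
    fun t ht => ?_, fun t ht => ?_, fun t ht => ?_⟩, fun T' r' R' h' => ?_⟩
  · simp [Real.sqrt_sq h0.le]
  · simp [Real.sqrt_sq h0.le]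
  · have := Real.sqrt_pos.2 (hrad t ht.2)
    exact ⟨this, by nlinarith⟩
  · have := Real.sqrt_pos.2 (hrad t ht.2)
    refine ((hd t ht.2).const_mul xiStar).congr_deriv ?_
    have h2 : xiStar - 1 ≠ 0 := by linarith
    have h3 : xiStar * √(r₀ ^ 2 - 2 * cStar * t) - √(r₀ ^ 2 - 2 * cStar * t) =
      (xiStar - 1) * √(r₀ ^ 2 - 2 * cStar * t) := by ring
    rw [h3]
    generalize √(r₀ ^ 2 - 2 * cStar * t) = s at this ⊢
    field_simp
    linear_combination (-xiStar) * hcl - xiStar_sq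
  · have := Real.sqrt_pos.2 (hrad t ht.2)
    refine (hd t ht.2).congr_deriv ?_
    have h2 : xiStar - 1 ≠ 0 := by linarith
    have h3 : xiStar * √(r₀ ^ 2 - 2 * cStar * t) - √(r₀ ^ 2 - 2 * cStar * t) =
      (xiStar - 1) * √(r₀ ^ 2 - 2 * cStar * t) := by ring
    rw [h3]
    generalize √(r₀ ^ 2 - 2 * cStar * t) = s at this ⊢
    field_simp
    linear_combination -hcl
  -- The orbit stays in range for all new times, so maximality comes from the old time: on the ray R
  -- = xiStar r the quantity 2ct + r² is constant, and no solution can reach r = 0.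
  · obtain ⟨σ, hσ⟩ := h'.exists_orbit_parameter h0 (by nlinarith)
    have hA : growingMode r₀ (xiStar * r₀) = 0 := by simp [growingMode]
    have hB : decayingMode r₀ (xiStar * r₀) = r₀ := by
      have := growingMode_add_decayingMode r₀ (xiStar * r₀)
      rwa [hA, zero_add] at this
    have hin : ∀ τ, orbitInner r₀ (xiStar * r₀) τ = r₀ * Real.exp (xiConj * τ) := fun τ => by
      simp [orbitInner, hA, hB]
    have hout : ∀ τ, orbitOuter r₀ (xiStar * r₀) τ = xiStar * r₀ * Real.exp (xiConj * τ) :=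
      fun τ => by simp [orbitOuter, hA, hB]
    have htime : ∀ τ, 2 * cStar * orbitTime r₀ (xiStar * r₀) τ =
        r₀ ^ 2 - r₀ ^ 2 * Real.exp (xiConj * τ) ^ 2 := by
      have hder : ∀ τ, HasDerivAt (fun τ => 2 * cStar * orbitTime r₀ (xiStar * r₀) τ +
          r₀ ^ 2 * Real.exp (xiConj * τ) ^ 2) 0 τ := fun τ => by
        refine (((hasDerivAt_orbitTime r₀ (xiStar * r₀) τ).const_mul (2 * cStar)).add
          (((hasDerivAt_exp_mul xiConj τ).pow 2).const_mul (r₀ ^ 2))).congr_deriv ?_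
        rw [hin, hout]
        simp only [xiConj]
        push_cast
        linear_combination (2 * r₀ ^ 2 * Real.exp ((3 - xiStar) * τ) ^ 2) * hcl
      intro τ
      have := is_const_of_deriv_eq_zero (fun τ => (hder τ).differentiableAt)
        (fun τ => (hder τ).deriv) τ 0
      simp only [orbitTime_zero, mul_zero, Real.exp_zero] at this
      linarith
    have hr' : ∀ t ∈ Set.Ico 0 T', 0 < r' t ∧ r' t ^ 2 = r₀ ^ 2 - 2 * cStar * t ∧
        R' t = xiStar * r' t := fun t ht => by
      obtain ⟨a, b, c, d, -⟩ := hσ t ht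
      have := htime (σ t)
      rw [hin] at b
      rw [hout] at c
      rw [d] at this
      refine ⟨b ▸ by positivity, ?_, ?_⟩
      · rw [b]; linarith
      · rw [b, c]; ring
    have hr'' : ∀ t ∈ Set.Ico 0 T', r' t = √(r₀ ^ 2 - 2 * cStar * t) := fun t ht => by
      obtain ⟨a, b, -⟩ := hr' t ht
      rw [← b, Real.sqrt_sq a.le]
    refine ⟨?_, hr'', fun t ht => by rw [(hr' t ht).2.2, hr'' t ht]⟩
    by_contra! hlt
    obtain ⟨a, b, -⟩ := hr' (r₀ ^ 2 / (2 * cStar)) ⟨by positivity, hlt⟩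
    have : 2 * cStar * (r₀ ^ 2 / (2 * cStar)) = r₀ ^ 2 := by field_simp
    rw [this] at b
    nlinarith

end Sponge
end

/-! ### Assembling the evolutions. -/

noncomputable section
namespace Sponge

/-! ### Families of sponges -/

theorem sponge_eq_empty {r R : ℝ} (h : R ≤ r) : sponge r R = ∅ := by
  ext x
  simp only [Set.mem_empty_iff_false, iff_false]
  rintro ⟨h1, i, j, -, h2, -⟩
  linarith [h1 i]

theorem cube_eq_empty {R : ℝ} (h : R ≤ 0) : cube R = ∅ := by
  ext x
  simp only [Set.mem_empty_iff_false, iff_false]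
  intro h1
  linarith [h1 0, abs_nonneg (x 0)]

theorem diagonal_mem_sponge_iff {r R a : ℝ} (ha : 0 < a) :
    WithLp.toLp 2 (fun _ => a) ∈ sponge r R ↔ r < a ∧ a < R := by
  constructor
  · rintro ⟨h1, i, j, -, h2, -⟩
    have := h1 0
    simp only [abs_of_pos ha] at this h2
    exact ⟨h2, this⟩
  · rintro ⟨h1, h2⟩
    exact ⟨fun i => by simpa only [abs_of_pos ha], 0, 1, by decide,
      by simpa only [abs_of_pos ha], by simpa only [abs_of_pos ha]⟩

theorem sponge_nonempty {r R : ℝ} (h0 : 0 < r) (h1 : r < R) : (sponge r R).Nonempty :=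
  ⟨_, (diagonal_mem_sponge_iff (a := (r + R) / 2) (by linarith)).2
    ⟨by linarith, by linarith⟩⟩

/-- The radii are the ends of the interval of those a > 0 for which (a, a, a) lies in the sponge. -/
theorem eq_of_sponge_eq {r R r' R' : ℝ} (h0 : 0 < r) (h1 : r < R) (h0' : 0 < r') (h1' : r' < R')
    (h : sponge r R = sponge r' R') : r = r' ∧ R = R' := by
  have hI : Set.Ioo r R = Set.Ioo r' R' := by
    ext a
    constructor <;> intro ha
    · exact (diagonal_mem_sponge_iff (by linarith [ha.1])).1
        (h ▸ (diagonal_mem_sponge_iff (by linarith [ha.1])).2 ha)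
    · exact (diagonal_mem_sponge_iff (by linarith [ha.1])).1
        (h ▸ (diagonal_mem_sponge_iff (by linarith [ha.1])).2 ha)
  exact ⟨by rw [← csInf_Ioo h1, hI, csInf_Ioo h1'], by rw [← csSup_Ioo h1, hI, csSup_Ioo h1']⟩

theorem smul_sponge {l : ℝ} (hl : 0 < l) (r R : ℝ) : l • sponge r R = sponge (l * r) (l * R) := by
  ext x
  have h1 : ∀ a b : ℝ, l⁻¹ * a < b ↔ a < l * b := fun a b => inv_mul_lt_iff₀ hl
  have h2 : ∀ a b : ℝ, a < l⁻¹ * b ↔ l * a < b := fun a b => lt_inv_mul_iff₀ hl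
  rw [Set.mem_smul_set_iff_inv_smul_mem₀ hl.ne']
  simp only [sponge, Set.mem_ofPred_eq, PiLp.smul_apply, smul_eq_mul, abs_mul,
    abs_of_pos (inv_pos.2 hl), h1, h2]

/-- Dilation preserves the ratio of the radii. Off the critical ratio this contradicts the limit of
R / r at T. -/
theorem ratio_eq_of_isSelfSimilar {E : ℝ → Set E3} (h : IsSelfSimilar E) {T : ℝ} {r R : ℝ → ℝ}
    (hT : 0 < T) (hpos : ∀ t ∈ Set.Ico 0 T, 0 < r t ∧ r t < R t)
    (hE : ∀ t ∈ Set.Ico 0 T, E t = sponge (r t) (R t)) :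
    ∀ t ∈ Set.Ico 0 T, R t / r t = R 0 / r 0 := by
  intro t ht
  have h0 : (0 : ℝ) ∈ Set.Ico 0 T := ⟨le_rfl, hT⟩
  obtain ⟨a, b⟩ := hpos t ht
  obtain ⟨a0, b0⟩ := hpos 0 h0
  obtain ⟨l, hl, hlE⟩ := h t ht.1 (hE t ht ▸ sponge_nonempty a b)
  rw [hE t ht, hE 0 h0, smul_sponge hl] at hlE
  obtain ⟨e1, e2⟩ := eq_of_sponge_eq a b (mul_pos hl a0) (mul_lt_mul_of_pos_left b0 hl) hlE
  rw [e1, e2, mul_div_mul_left _ _ hl.ne']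

theorem ae_forall_abs_ne (c : ℝ) : ∀ᵐ x : E3, ∀ i, |x i| ≠ c := by
  have h : ∀ (d : ℝ) (i : Fin 3), ∀ᵐ x : E3, x i ≠ d := fun d i => by
    have : ∀ᵐ y : Fin 3 → ℝ, y i ≠ d := by
      rw [ae_iff]
      simpa [volume_pi] using Measure.pi_hyperplane (fun _ : Fin 3 => (volume : Measure ℝ)) i d
    exact (PiLp.volume_preserving_ofLp (Fin 3)).quasiMeasurePreserving.ae this
  rw [ae_all_iff]
  intro i
  filter_upwards [h c i, h (-c) i] with x h1 h2 h3
  rcases abs_choice (x i) with h | h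
  · exact h1 (by rw [← h3, h])
  · exact h2 (by linarith)

/-- Sponges vary continuously in volume with their radii. -/
theorem tendsto_volume_symmDiff_sponge {r R : ℝ → ℝ} (hr : Continuous r) (hR : Continuous R)
    (t : ℝ) :
    Tendsto (fun s => volume (symmDiff (sponge (r s) (R s)) (sponge (r t) (R t)))) (𝓝 t) (𝓝 0) := by
  have hm : ∀ s, MeasurableSet (sponge (r s) (R s)) := fun s => (isOpen_sponge _ _).measurableSet
  -- Dominated convergence: unless some |x i| equals r t or R t, membership of x in the sponge is
  -- the same for all times near t.
  have := tendsto_measure_of_ae_tendsto_indicator (μ := (volume : Measure E3)) (L := 𝓝 t)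
    (A := ∅) (As := fun s => symmDiff (sponge (r s) (R s)) (sponge (r t) (R t)))
    (B := Metric.closedBall 0 (3 * (|R t| + 1))) MeasurableSet.empty
    (fun s => (hm s).symmDiff (hm t)) measurableSet_closedBall
    measure_closedBall_lt_top.ne ?_ ?_
  · simpa using this
  · have hsub : ∀ s, R s < |R t| + 1 → sponge (r s) (R s) ⊆
        Metric.closedBall (0 : E3) (3 * (|R t| + 1)) := fun s hs =>
      have h : sponge (r s) (R s) ⊆ sponge (r s) (|R t| + 1) :=
        fun x hx => ⟨fun i => (hx.1 i).trans hs, hx.2⟩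
      h.trans (sponge_subset_closedBall (by positivity))
    have ht : R t < |R t| + 1 := by linarith [le_abs_self (R t)]
    filter_upwards [hR.continuousAt.eventually_lt continuousAt_const ht] with s hs
    exact Set.symmDiff_subset_union.trans (Set.union_subset (hsub s hs) (hsub t ht))
  · filter_upwards [ae_forall_abs_ne (r t), ae_forall_abs_ne (R t)] with x h1 h2
    have e1 : ∀ᶠ s in 𝓝 t, ∀ i, r s < |x i| ↔ r t < |x i| := eventually_all.2 fun i => by
      rcases (h1 i).lt_or_gt with h | h
      · filter_upwards [continuousAt_const.eventually_lt hr.continuousAt h] with s hs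
        constructor <;> intro <;> linarith
      · filter_upwards [hr.continuousAt.eventually_lt continuousAt_const h] with s hs
        simp [hs, h]
    have e2 : ∀ᶠ s in 𝓝 t, ∀ i, |x i| < R s ↔ |x i| < R t := eventually_all.2 fun i => by
      rcases (h2 i).lt_or_gt with h | h
      · filter_upwards [continuousAt_const.eventually_lt hR.continuousAt h] with s hs
        simp [hs, h]
      · filter_upwards [hR.continuousAt.eventually_lt continuousAt_const h] with s hs
        constructor <;> intro <;> linarith
    filter_upwards [e1, e2] with s a b
    simp only [Set.mem_symmDiff, sponge, Set.mem_ofPred_eq, a, b, Set.mem_empty_iff_false,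
      and_not_self, or_self]

theorem IsSpongeODE.satisfiesLaw {r₀ R₀ T : ℝ} {r R : ℝ → ℝ} (h : IsSpongeODE r₀ R₀ T r R) {t : ℝ}
    (ht : t ∈ Set.Ioo 0 T) : SatisfiesLaw l1 (fun s => sponge (r s) (R s)) t :=
  (satisfiesLaw_sponge_iff (h.range t ht).1 (h.range t ht).2 (h.deriv_r t ht).differentiableAt
    (h.deriv_R t ht).differentiableAt).2 ⟨h.deriv_R t ht, h.deriv_r t ht⟩

/-- A sponge that degenerates at the end of the existence interval gives a flow that becomes
extinct there. -/
theorem isFlow_sponge {r₀ R₀ T : ℝ} {r R : ℝ → ℝ} (h : IsSpongeODE r₀ R₀ T r R)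
    (hr : Continuous r) (hR : Continuous R) (hT : ∀ t, T ≤ t → R t ≤ r t) :
    IsFlow l1 (fun t => sponge (r t) (R t)) {T} := by
  refine ⟨fun t h0 ht => ?_, fun t _ =>
    (tendsto_volume_symmDiff_sponge hr hR t).mono_left nhdsWithin_le_nhds⟩
  rw [Finset.mem_singleton] at ht
  rcases lt_or_gt_of_ne ht with h' | h'
  · exact h.satisfiesLaw ⟨h0, h'⟩
  · refine (satisfiesLaw_empty l1 t).congr ?_
    filter_upwards [Ioi_mem_nhds h'] with s hs
    exact (sponge_eq_empty (hT s hs.le)).symm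

/-- The set with inner radius `r` before time `T`, and without holes from then on. -/
def filledAfter (T : ℝ) (r R : ℝ → ℝ) (t : ℝ) : Set E3 :=
  if t < T then sponge (r t) (R t) else cube (R t)

/-- A sponge with r = 0 is the cube without the coordinate axes. Up to null sets the filled family
is therefore a continuous family of sponges. -/
theorem filledAfter_ae_eq {T : ℝ} {r R : ℝ → ℝ} (hr : ∀ t, T ≤ t → r t = 0) (t : ℝ) :
    filledAfter T r R t =ᵐ[volume] sponge (r t) (R t) := by
  unfold filledAfter
  split_ifs with h
  · rfl
  · rw [hr t (not_lt.1 h)]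
    filter_upwards [ae_forall_abs_ne 0] with x hx
    have hp : ∀ i, 0 < |x i| := fun i => (abs_nonneg _).lt_of_ne (hx i).symm
    refine propext ⟨fun h => ⟨h, 0, 1, by decide, hp 0, hp 1⟩, fun h => h.1⟩

/-- A sponge whose holes close at the end of the existence interval continues as a cube. -/
theorem isFlow_filledAfter {r₀ R₀ T T₁ : ℝ} {r R : ℝ → ℝ} (h : IsSpongeODE r₀ R₀ T r R)
    (hr : Continuous r) (hR : Continuous R) (hrT : ∀ t, T ≤ t → r t = 0)
    (hRT : ∀ t ∈ Set.Ioo T T₁, 0 < R t ∧ HasDerivAt R (-2 / R t) t)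
    (hRT₁ : ∀ t, T₁ ≤ t → R t = 0) : IsFlow l1 (filledAfter T r R) {T, T₁} := by
  refine ⟨fun t h0 ht => ?_, fun t _ => ?_⟩
  · simp only [Finset.mem_insert, Finset.mem_singleton, not_or] at ht
    rcases lt_or_gt_of_ne ht.1 with h' | h'
    · refine (h.satisfiesLaw ⟨h0, h'⟩).congr ?_
      filter_upwards [Iio_mem_nhds h'] with s hs
      exact (if_pos hs).symm
    · rcases lt_or_gt_of_ne ht.2 with h'' | h''
      · obtain ⟨a, b⟩ := hRT t ⟨h', h''⟩
        refine (satisfiesLaw_cube a b).congr ?_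
        filter_upwards [Ioi_mem_nhds h'] with s hs
        exact (if_neg (not_lt.2 hs.le)).symm
      · refine (satisfiesLaw_empty l1 t).congr ?_
        filter_upwards [Ioi_mem_nhds h', Ioi_mem_nhds h''] with s hs hs'
        exact (((if_neg (not_lt.2 hs.le)).trans (cube_eq_empty (hRT₁ s hs'.le).le))).symm
  · refine ((tendsto_volume_symmDiff_sponge hr hR t).mono_left nhdsWithin_le_nhds).congr fun s => ?_
    exact measure_congr ((filledAfter_ae_eq hrT s).symm.symmDiff (filledAfter_ae_eq hrT t).symm)

/-! ### Convergence to the edges -/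

theorem norm_le_of_abs_le {x : E3} {δ : ℝ} (h : ∀ i, |x i| ≤ δ) : ‖x‖ ≤ 3 * δ := by
  have hδ := (abs_nonneg _).trans (h 0)
  rw [EuclideanSpace.norm_eq]
  refine Real.sqrt_le_iff.2 ⟨by linarith, ?_⟩
  simp only [Fin.sum_univ_three, Real.norm_eq_abs]
  have h0 := pow_le_pow_left₀ (abs_nonneg _) (h 0) 2
  have h1 := pow_le_pow_left₀ (abs_nonneg _) (h 1) 2
  have h2 := pow_le_pow_left₀ (abs_nonneg _) (h 2) 2
  nlinarith

theorem exists_abs_eq_abs_sub_eq (x : ℝ) {ρ : ℝ} (hρ : 0 ≤ ρ) :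
    ∃ y, |y| = ρ ∧ |x - y| = |(|x| - ρ)| := by
  rcases le_total 0 x with h | h
  · exact ⟨ρ, abs_of_nonneg hρ, by rw [abs_of_nonneg h]⟩
  · refine ⟨-ρ, by rw [abs_neg, abs_of_nonneg hρ], ?_⟩
    rw [abs_of_nonpos h, ← abs_neg]; congr 1; ring

theorem exists_abs_le_abs_sub_le (x : ℝ) {ρ δ : ℝ} (hρ : 0 ≤ ρ) (hδ : 0 ≤ δ) (h : |x| ≤ ρ + δ) :
    ∃ y, |y| ≤ ρ ∧ |x - y| ≤ δ := by
  rcases le_total |x| ρ with h' | h'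
  · exact ⟨x, h', by simpa⟩
  · obtain ⟨y, h1, h2⟩ := exists_abs_eq_abs_sub_eq x hρ
    refine ⟨y, h1.le, ?_⟩
    rw [h2, abs_of_nonneg (by linarith)]; linarith

/-- Coordinates with |x k| > r lie between r and R and move to ±ρ at cost δ; the others are only
clamped to [-ρ, ρ]. Conversely, a point of the edges is dilated to the middle radius (r + R) / 2.
The factor 3 is a crude comparison of the Euclidean and the maximum norm. -/
theorem hausdorffEDist_sponge_cubeEdges_le {r R ρ δ : ℝ} (h0 : 0 < r) (h1 : r < R) (hρ : 0 < ρ)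
    (hr : |r - ρ| ≤ δ) (hR : |R - ρ| ≤ δ) :
    Metric.hausdorffEDist (sponge r R) (cubeEdges ρ) ≤ ENNReal.ofReal (3 * δ) := by
  have hδ := (abs_nonneg _).trans hr
  rw [abs_le] at hr hR
  have hed : ∀ {x y : E3}, (∀ i, |x i - y i| ≤ δ) → edist x y ≤ ENNReal.ofReal (3 * δ) :=
    fun {x y} h => by
      rw [edist_dist, dist_eq_norm]
      exact ENNReal.ofReal_le_ofReal (norm_le_of_abs_le fun i => by simpa using h i)
  refine Metric.hausdorffEDist_le_of_mem_edist ?_ ?_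
  · rintro x ⟨hx, i, j, hij, hi, hj⟩
    have : ∀ k, ∃ y : ℝ, |y| ≤ ρ ∧ |x k - y| ≤ δ ∧ (r < |x k| → |y| = ρ) := fun k => by
      by_cases hk : r < |x k|
      · obtain ⟨y, e1, e2⟩ := exists_abs_eq_abs_sub_eq (x k) hρ.le
        refine ⟨y, e1.le, ?_, fun _ => e1⟩
        rw [e2, abs_le]
        constructor <;> linarith [hx k]
      · obtain ⟨y, e1, e2⟩ := exists_abs_le_abs_sub_le (x k) hρ.le hδ (by linarith [hx k])
        exact ⟨y, e1, e2, fun h => absurd h hk⟩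
    choose y hy1 hy2 hy3 using this
    exact ⟨WithLp.toLp 2 y, ⟨hy1, i, j, hij, hy3 i hi, hy3 j hj⟩, hed hy2⟩
  · rintro x ⟨hx, i, j, hij, hi, hj⟩
    have hm : 0 < (r + R) / 2 / ρ := div_pos (by linarith) hρ
    have hab : ∀ k, |(((r + R) / 2 / ρ) • x) k| = (r + R) / 2 / ρ * |x k| := fun k => by
      rw [PiLp.smul_apply, smul_eq_mul, abs_mul, abs_of_pos hm]
    have hmρ : (r + R) / 2 / ρ * ρ = (r + R) / 2 := div_mul_cancel₀ _ hρ.ne'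
    refine ⟨((r + R) / 2 / ρ) • x, ⟨fun k => ?_, i, j, hij, ?_, ?_⟩, hed fun k => ?_⟩
    · rw [hab]
      have := mul_le_mul_of_nonneg_left (hx k) hm.le
      linarith
    · rw [hab, hi]; linarith
    · rw [hab, hj]; linarith
    · rw [PiLp.smul_apply, smul_eq_mul]
      have e : x k - (r + R) / 2 / ρ * x k = (ρ - (r + R) / 2) / ρ * x k := by field_simp
      rw [e, abs_mul, abs_div, abs_of_pos hρ]
      have h2 : |ρ - (r + R) / 2| ≤ δ := abs_le.2 ⟨by linarith, by linarith⟩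
      calc |ρ - (r + R) / 2| / ρ * |x k| ≤ |ρ - (r + R) / 2| / ρ * ρ := by gcongr; exact hx k
        _ ≤ δ := by rwa [div_mul_cancel₀ _ hρ.ne']

theorem tendsto_hausdorffEDist_sponge_cubeEdges {α : Type*} {l : Filter α} {r R : α → ℝ} {ρ : ℝ}
    (hρ : 0 < ρ) (hr : Tendsto r l (𝓝 ρ)) (hR : Tendsto R l (𝓝 ρ))
    (h : ∀ᶠ t in l, 0 < r t ∧ r t < R t) :
    Tendsto (fun t => Metric.hausdorffEDist (sponge (r t) (R t)) (cubeEdges ρ)) l (𝓝 0) := by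
  have hlim : Tendsto (fun t => ENNReal.ofReal (3 * (|r t - ρ| + |R t - ρ|))) l (𝓝 0) := by
    have h1 := (hr.sub_const ρ).abs
    have h2 := (hR.sub_const ρ).abs
    have := ENNReal.tendsto_ofReal ((h1.add h2).const_mul 3)
    simpa using this
  refine tendsto_of_tendsto_of_tendsto_of_le_of_le' tendsto_const_nhds hlim
    (Eventually.of_forall fun _ => zero_le) ?_
  filter_upwards [h] with t ht
  exact hausdorffEDist_sponge_cubeEdges_le ht.1 ht.2 hρ (by linarith [abs_nonneg (R t - ρ)])
    (by linarith [abs_nonneg (r t - ρ)])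

end Sponge
end

noncomputable section
namespace Sponge

/-! ### The three regimes -/

/-- Below the critical ratio `r` and `R` meet at a positive value. -/
theorem exists_isMaximalSolution_of_lt {r₀ R₀ : ℝ} (h0 : 0 < r₀) (h1 : r₀ < R₀)
    (h : R₀ < xiStar * r₀) :
    ∃ (T : ℝ) (r R : ℝ → ℝ), IsMaximalSolution r₀ R₀ T r R ∧ Continuous r ∧ Continuous R ∧
      (∀ t, T ≤ t → R t = r t) ∧ 0 < r T ∧
      StrictAntiOn (fun t => R t - r t) (Set.Ico 0 T) := by
  obtain ⟨L, hL, hpos, hlt, hexit⟩ := exists_exit_of_lt h0 h1 h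
  obtain ⟨T, τ, hT, hτc, hτm, hτ0, hτT, hmax⟩ := exists_isMaximalSolution h0 h1 hL
    (fun τ hτ => ⟨hpos τ ⟨hτ.1, hτ.2.le⟩, hlt τ hτ⟩) fun h => h.2.ne hexit
  have hA : 0 < growingMode r₀ R₀ := div_pos (by linarith) xiStar_sub_xiConj_pos
  have hB := decayingMode_pos h0 h1
  have hm := xiConj_neg
  have hl := three_lt_xiStar
  have hgap : StrictAnti fun u => orbitOuter r₀ R₀ u - orbitInner r₀ R₀ u := fun u v huv => by
    have e1 : Real.exp (xiStar * u) < Real.exp (xiStar * v) := by gcongr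
    have e2 : Real.exp (xiConj * v) < Real.exp (xiConj * u) :=
      Real.exp_lt_exp.2 (mul_lt_mul_of_neg_left huv hm)
    have e3 := mul_lt_mul_of_pos_left e1 (mul_pos (show 0 < 1 - xiConj by linarith) hA)
    have e4 := mul_lt_mul_of_pos_left e2 (mul_pos (show 0 < xiStar - 1 by linarith) hB)
    simp only [orbitInner, orbitOuter]
    linarith
  have hmin : ∀ t ∈ Set.Ico 0 T, min t T = t := fun t ht => min_eq_left ht.2.le
  -- Freezing the orbit at T keeps both radii continuous and equal from T on, where the sponge is
  -- then empty.
  refine ⟨T, fun t => orbitInner r₀ R₀ (τ (min t T)), fun t => orbitOuter r₀ R₀ (τ (min t T)),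
    hmax.congr (fun t ht => by simp only [hmin t ht]) (fun t ht => by simp only [hmin t ht]),
    (continuous_orbitInner r₀ R₀).comp (by fun_prop),
    (continuous_orbitOuter r₀ R₀).comp (by fun_prop), fun t ht => ?_, ?_, fun s hs t ht hst => ?_⟩
  · simp only [min_eq_right ht, hτT, hexit]
  · simp only [min_self, hτT]; exact hpos L ⟨hL.le, le_rfl⟩
  · simp only [hmin s hs, hmin t ht]
    exact hgap (hτm hst)

/-- Above the critical ratio `r` vanishes first, and `R` continues as the radius of a cube. -/
theorem exists_isMaximalSolution_of_gt {r₀ R₀ : ℝ} (h0 : 0 < r₀) (h1 : r₀ < R₀)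
    (h : xiStar * r₀ < R₀) :
    ∃ (T T₁ : ℝ) (r R : ℝ → ℝ), IsMaximalSolution r₀ R₀ T r R ∧ Continuous r ∧ Continuous R ∧
      (∀ t, T ≤ t → r t = 0) ∧ 0 < R T ∧ T < T₁ ∧
      (∀ t ∈ Set.Ioo T T₁, 0 < R t ∧ HasDerivAt R (-2 / R t) t) ∧ ∀ t, T₁ ≤ t → R t = 0 := by
  obtain ⟨L, hL, hpos, hlt, hexit⟩ := exists_exit_of_gt h0 h1 h
  obtain ⟨T, τ, hT, hτc, hτm, hτ0, hτT, hmax⟩ := exists_isMaximalSolution h0 h1 hL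
    (fun τ hτ => ⟨hpos τ hτ, hlt τ ⟨hτ.1, hτ.2.le⟩⟩) fun h => h.1.ne' hexit
  have hP : 0 < orbitOuter r₀ R₀ L := hexit ▸ hlt L ⟨hL.le, le_rfl⟩
  set P := orbitOuter r₀ R₀ L with hPdef
  have hmin : ∀ t ∈ Set.Ico 0 T, min t T = t := fun t ht => min_eq_left ht.2.le
  -- After T the equation R' = -2 / R makes R² decrease at rate 4 from P², hence T₁ = T + P² / 4.
  -- Beyond T₁ the radicand is negative and the root is 0.
  let Q : ℝ → ℝ := fun t => if t ≤ T then orbitOuter r₀ R₀ (τ t) else √(P ^ 2 - 4 * (t - T))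
  have hQ : ∀ t, T < t → Q t = √(P ^ 2 - 4 * (t - T)) := fun t ht => if_neg (not_le.2 ht)
  have hT₁ : T < T + P ^ 2 / 4 := by have := pow_pos hP 2; linarith
  refine ⟨T, T + P ^ 2 / 4, fun t => orbitInner r₀ R₀ (τ (min t T)), Q,
    hmax.congr (fun t ht => by simp only [hmin t ht]) (fun t ht => if_pos ht.2.le),
    (continuous_orbitInner r₀ R₀).comp (by fun_prop), ?_, fun t ht => ?_, ?_, hT₁,
    fun t ht => ?_, fun t ht => ?_⟩
  · refine Continuous.if_le ((continuous_orbitOuter r₀ R₀).comp hτc) (by fun_prop) continuous_id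
      continuous_const fun t ht => ?_
    rw [ht, hτT, sub_self, mul_zero, sub_zero, Real.sqrt_sq hP.le]
  · simp only [min_eq_right ht, hτT, hexit]
  · simp only [Q, le_refl, if_true, hτT, ← hPdef, hP]
  · have hrad : 0 < P ^ 2 - 4 * (t - T) := by linarith [ht.2]
    have hs := Real.sqrt_pos.2 hrad
    rw [hQ t ht.1]
    refine ⟨hs, ?_⟩
    have hd : HasDerivAt (fun t => P ^ 2 - 4 * (t - T)) (-4) t := by
      simpa using (((hasDerivAt_id t).sub_const T).const_mul 4).const_sub (P ^ 2)
    refine ((hd.sqrt hrad.ne').congr_deriv ?_).congr_of_eventuallyEq ?_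
    · generalize √(P ^ 2 - 4 * (t - T)) = s at hs ⊢
      field_simp; norm_num
    · filter_upwards [Ioi_mem_nhds ht.1] with s hs using hQ s hs
  · rw [hQ t (by linarith)]
    exact Real.sqrt_eq_zero_of_nonpos (by linarith)

theorem Ico_zero_mem_nhdsLT {T : ℝ} (hT : 0 < T) : Set.Ico 0 T ∈ 𝓝[<] T :=
  mem_of_superset (Ioo_mem_nhdsLT hT) Set.Ioo_subset_Ico_self

theorem isSelfSimilar_critical {r₀ : ℝ} (h0 : 0 < r₀) :
    IsSelfSimilar fun t => sponge (√(r₀ ^ 2 - 2 * cStar * t)) (xiStar * √(r₀ ^ 2 - 2 * cStar * t)) := by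
  intro t _ hne
  have hl := three_lt_xiStar
  have hs : 0 < √(r₀ ^ 2 - 2 * cStar * t) := by
    refine (Real.sqrt_nonneg _).lt_of_ne fun h => ?_
    simp only [← h, mul_zero, sponge_eq_empty le_rfl, Set.not_nonempty_empty] at hne
  refine ⟨√(r₀ ^ 2 - 2 * cStar * t) / r₀, by positivity, ?_⟩
  simp only [mul_zero, sub_zero, Real.sqrt_sq h0.le]
  rw [smul_sponge (by positivity), mul_left_comm, div_mul_cancel₀ _ h0.ne']

end Sponge
end

theorem mainTheorem2 :
    -- the boundary of each sponge is a closed surface of genus 5, with the stated curvature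
    (∀ r R : ℝ, 0 < r → r < R →
      IsClosedSurfaceOfGenus (frontier (sponge r R)) 5 ∧
      IsCrystallineCurvature l1 (sponge r R) (spongeCurvature r R)) ∧
    -- for moving sponges the velocity law is the system of ODEs
    (∀ (r R : ℝ → ℝ) (t : ℝ), 0 < r t → r t < R t →
      DifferentiableAt ℝ r t → DifferentiableAt ℝ R t →
      (SatisfiesLaw l1 (fun s => sponge (r s) (R s)) t ↔
        HasDerivAt R (-2 / (R t - r t)) t ∧
        HasDerivAt r (-(R t - 3 * r t) / (r t * (R t - r t))) t)) ∧
    -- the evolution from an arbitrary sponge and its classification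
    (∀ r₀ R₀ : ℝ, 0 < r₀ → r₀ < R₀ →
      ∃ (T : ℝ) (r R : ℝ → ℝ) (E : ℝ → Set E3) (J : Finset ℝ),
        IsSpongeODE r₀ R₀ T r R ∧
        (∀ (T' : ℝ) (r' R' : ℝ → ℝ), IsSpongeODE r₀ R₀ T' r' R' →
          T' ≤ T ∧ Set.EqOn r' r (Set.Ico 0 T') ∧ Set.EqOn R' R (Set.Ico 0 T')) ∧
        IsFlow l1 E J ∧
        E 0 = sponge r₀ R₀ ∧
        (∀ t ∈ Set.Ico 0 T, E t = sponge (r t) (R t)) ∧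
        (IsSelfSimilar E ↔ R₀ / r₀ = xiStar) ∧
        -- below the critical ratio: thinning out to the edges of a cube, then extinction
        (R₀ / r₀ < xiStar →
          J = {T} ∧
          StrictAntiOn (fun t => R t - r t) (Set.Ico 0 T) ∧
          Tendsto (fun t => R t / r t) (𝓝[<] T) (𝓝 1) ∧
          Tendsto (fun t => R t - r t) (𝓝[<] T) (𝓝 0) ∧
          (∃ ρ : ℝ, 0 < ρ ∧ Tendsto R (𝓝[<] T) (𝓝 ρ) ∧
            Tendsto (fun t => Metric.hausdorffEDist (E t) (cubeEdges ρ)) (𝓝[<] T) (𝓝 0)) ∧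
          ∀ t, T ≤ t → E t = ∅) ∧
        -- at the critical ratio: self-similar shrinking, then extinction
        (R₀ / r₀ = xiStar →
          J = {T} ∧ 0 < cStar ∧ T = r₀ ^ 2 / (2 * cStar) ∧
          (∀ t ∈ Set.Ico 0 T,
            r t = √(r₀ ^ 2 - 2 * cStar * t) ∧ R t = xiStar * r t) ∧
          ∀ t, T ≤ t → E t = ∅) ∧
        -- above the critical ratio: the holes close, a cube remains and vanishes later
        (xiStar < R₀ / r₀ →
          Tendsto r (𝓝[<] T) (𝓝 0) ∧
          Tendsto (fun t => R t / r t) (𝓝[<] T) atTop ∧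
          0 < R T ∧
          ∃ T₁ : ℝ, T < T₁ ∧ J = {T, T₁} ∧
            ContinuousOn R (Set.Icc 0 T₁) ∧
            (∀ t ∈ Set.Ioo T T₁, 0 < R t ∧ HasDerivAt R (-2 / R t) t) ∧
            R T₁ = 0 ∧
            (∀ t ∈ Set.Ico T T₁, E t = cube (R t)) ∧
            ∀ t, T₁ ≤ t → E t = ∅)) := by
  refine ⟨fun r R h0 h1 => ⟨isClosedSurfaceOfGenus_frontier_sponge h0 h1,
    (isCrystallineCurvature_sponge h0 h1).1⟩, fun r R t h0 h1 hr hR =>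
    satisfiesLaw_sponge_iff h0 h1 hr hR, fun r₀ R₀ h0 h1 => ?_⟩
  have hl := three_lt_xiStar
  rcases lt_trichotomy (R₀ / r₀) xiStar with h | h | h
  · obtain ⟨T, r, R, hmax, hr, hR, hRr, hrT, hanti⟩ :=
      exists_isMaximalSolution_of_lt h0 h1 ((div_lt_iff₀ h0).1 h)
    have hT := hmax.1.pos
    have hlim_r : Tendsto r (𝓝[<] T) (𝓝 (r T)) := (hr.tendsto T).mono_left nhdsWithin_le_nhds
    have hlim_R : Tendsto R (𝓝[<] T) (𝓝 (r T)) :=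
      hRr T le_rfl ▸ (hR.tendsto T).mono_left nhdsWithin_le_nhds
    have hratio : Tendsto (fun t => R t / r t) (𝓝[<] T) (𝓝 1) := by
      rw [← div_self hrT.ne']
      exact hlim_R.div hlim_r hrT.ne'
    have hpos := fun t (ht : t ∈ Set.Ico 0 T) => hmax.1.range_Ico h0 h1 ht
    refine ⟨T, r, R, fun t => sponge (r t) (R t), {T}, hmax.1, hmax.2,
      isFlow_sponge hmax.1 hr hR fun t ht => (hRr t ht).le, by
        simp only [hmax.1.init_r, hmax.1.init_R], fun t _ => rfl,
      ⟨fun hs => ?_, fun e => absurd e h.ne⟩, fun _ => ⟨rfl, hanti, hratio, ?_, ⟨r T, hrT, hlim_R,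
        tendsto_hausdorffEDist_sponge_cubeEdges hrT hlim_r hlim_R ?_⟩, fun t ht =>
        sponge_eq_empty (hRr t ht).le⟩, fun e => absurd e h.ne, fun e => absurd e h.not_gt⟩
    -- A constant ratio would equal both R₀ / r₀ > 1 and its limit 1.
    · have hc := ratio_eq_of_isSelfSimilar hs hT hpos fun t _ => rfl
      rw [hmax.1.init_r, hmax.1.init_R] at hc
      have : Tendsto (fun t => R t / r t) (𝓝[<] T) (𝓝 (R₀ / r₀)) :=
        tendsto_const_nhds.congr' <| by
          filter_upwards [Ico_zero_mem_nhdsLT hT] with t ht using (hc t ht).symm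
      have := tendsto_nhds_unique hratio this
      have := (one_lt_div h0).2 h1
      linarith
    · simpa using hlim_R.sub hlim_r
    · filter_upwards [Ico_zero_mem_nhdsLT hT] with t ht using hpos t ht
  · obtain rfl : R₀ = xiStar * r₀ := (div_eq_iff h0.ne').1 h
    have hmax := isMaximalSolution_critical h0
    have hc := cStar_pos
    have hzero : ∀ t, r₀ ^ 2 / (2 * cStar) ≤ t → √(r₀ ^ 2 - 2 * cStar * t) = 0 := fun t ht => by
      rw [div_le_iff₀ (by linarith)] at ht
      exact Real.sqrt_eq_zero_of_nonpos (by linarith)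
    refine ⟨_, _, _, fun t => sponge _ _, {r₀ ^ 2 / (2 * cStar)}, hmax.1, hmax.2,
      isFlow_sponge hmax.1 (by fun_prop) (by fun_prop) fun t ht => by simp [hzero t ht],
      by simp [Real.sqrt_sq h0.le], fun t _ => rfl, iff_of_true (isSelfSimilar_critical h0) h,
      fun e => absurd h e.ne, fun _ => ⟨rfl, hc, rfl, fun t _ => ⟨rfl, rfl⟩, fun t ht =>
        sponge_eq_empty (by simp [hzero t ht])⟩, fun e => absurd h e.ne'⟩
  · obtain ⟨T, T₁, r, R, hmax, hr, hR, hrT, hRT, hTT₁, hcube, hRT₁⟩ :=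
      exists_isMaximalSolution_of_gt h0 h1 ((lt_div_iff₀ h0).1 h)
    have hT := hmax.1.pos
    have hpos := fun t (ht : t ∈ Set.Ico 0 T) => hmax.1.range_Ico h0 h1 ht
    have hlim_r : Tendsto r (𝓝[<] T) (𝓝 0) :=
      hrT T le_rfl ▸ (hr.tendsto T).mono_left nhdsWithin_le_nhds
    have hratio : Tendsto (fun t => R t / r t) (𝓝[<] T) atTop := by
      have hr0 : Tendsto r (𝓝[<] T) (𝓝[>] 0) := tendsto_nhdsWithin_iff.2 ⟨hlim_r, by
        filter_upwards [Ico_zero_mem_nhdsLT hT] with t ht using (hpos t ht).1⟩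
      simp only [div_eq_mul_inv]
      exact ((hR.tendsto T).mono_left nhdsWithin_le_nhds).pos_mul_atTop hRT
        (tendsto_inv_nhdsGT_zero.comp hr0)
    have hE : ∀ t ∈ Set.Ico 0 T, filledAfter T r R t = sponge (r t) (R t) := fun t ht =>
      if_pos ht.2
    have hE' : ∀ t, T ≤ t → filledAfter T r R t = cube (R t) := fun t ht => if_neg (not_lt.2 ht)
    refine ⟨T, r, R, filledAfter T r R, {T, T₁}, hmax.1, hmax.2,
      isFlow_filledAfter hmax.1 hr hR hrT hcube hRT₁, ?_, hE, ⟨fun hs => ?_, fun e =>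
        absurd e h.ne'⟩, fun e => absurd e h.not_gt, fun e => absurd e h.ne', fun _ =>
      ⟨hlim_r, hratio, hRT, T₁, hTT₁, rfl, hR.continuousOn, hcube, hRT₁ T₁ le_rfl,
        fun t ht => hE' t ht.1, fun t ht => ?_⟩⟩
    · rw [hE 0 ⟨le_rfl, hT⟩, hmax.1.init_r, hmax.1.init_R]
    · have hc := ratio_eq_of_isSelfSimilar hs hT hpos hE
      have : Tendsto (fun t => R t / r t) (𝓝[<] T) (𝓝 (R 0 / r 0)) :=
        tendsto_const_nhds.congr' <| by
          filter_upwards [Ico_zero_mem_nhdsLT hT] with t ht using (hc t ht).symm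
      exact absurd this (not_tendsto_nhds_of_tendsto_atTop hratio _)
    · rw [hE' t (hTT₁.le.trans ht), cube_eq_empty (hRT₁ t ht).le]
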